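/- Let $P_4$ denote the path on four vertices. A star $3$-colouring of a graph $G=(V,E)$ is a map $c:V\to\{1,2,3\}$ with $c(u)\neq c(v)$ for every edge $uv\in E$ such that, for any two distinct colours $i,j$, the subgraph of $G$ induced by $c^{-1}(i)\cup c^{-1}(j)$ is a $P_4$-free forest (that is, a disjoint union of stars). The problem Star $3$-Colouring is to decide whether a given finite simple graph has a star $3$-colouring. Star $3$-Colouring is polynomial-time solvable on graphs of diameter at most $3$. More precisely, there is a random access machine program (unit cost per elementary instruction, all numbers of $O(\log n)$ bits) that, given as a list of its edges any connected graph $G$ with $n$ vertices, $m$ edges and diameter at most $3$, decides whether $G$ has a star $3$-colouring in $O(nm^2)$ time (in $O(1)$ time if $m=0$). -/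

import Mathlib

/-! ### Star colourings -/

/-- A (proper) colouring `c` of `G` is a star colouring if for every two distinct colours `i`, `j`
the subgraph of `G` induced by the union of the colour classes of `i` and `j` is a `P₄`-free forest
(it is acyclic and has no induced subgraph isomorphic to the path on four vertices). -/
def IsStarColouring {V : Type*} (G : SimpleGraph V) {k : ℕ} (c : G.Coloring (Fin k)) : Prop :=
  ∀ i j : Fin k, i ≠ j →
    (G.induce {v | c v = i ∨ c v = j}).IsAcyclic ∧
      ¬ (SimpleGraph.pathGraph 4).IsIndContained (G.induce {v | c v = i ∨ c v = j})

/-- `G` has a star `k`-colouring. -/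
def StarColourable {V : Type*} (G : SimpleGraph V) (k : ℕ) : Prop :=
  ∃ c : G.Coloring (Fin k), IsStarColouring G c

/-! ### Random access machine programs and their running time -/

/-- Memory of a random access machine: registers, and arrays with random access. A program text
mentions only finitely many registers and finitely many arrays. -/
structure RamState where
  /-- the content of register `r` -/
  reg : ℕ → ℕ
  /-- the content of cell `i` of array `a` -/
  arr : ℕ → ℕ → ℕ

/-- The elementary instructions. The array and the registers are fixed in the program text; the
cell of an array that is read or written is given by the content of a register. -/
inductive RamInstr where
  /-- `R[d] := c` -/
  | const (d c : ℕ)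
  /-- `R[d] := R[x]` -/
  | copy (d x : ℕ)
  /-- `R[d] := R[x] + R[y]` -/
  | add (d x y : ℕ)
  /-- `R[d] := max (R[x] - R[y]) 0` -/
  | sub (d x y : ℕ)
  /-- `R[d] := R[x] * R[y]` -/
  | mul (d x y : ℕ)
  /-- `R[d] := A_a[R[x]]` -/
  | load (d a x : ℕ)
  /-- `A_a[R[x]] := R[y]` -/
  | store (a x y : ℕ)

/-- The number that an instruction writes. -/
def RamInstr.value (s : RamState) : RamInstr → ℕ
  | .const _ c => c
  | .copy _ x => s.reg x
  | .add _ x y => s.reg x + s.reg y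
  | .sub _ x y => s.reg x - s.reg y
  | .mul _ x y => s.reg x * s.reg y
  | .load _ a x => s.arr a (s.reg x)
  | .store _ _ y => s.reg y

/-- Write the number `v` into register `d`. -/
def RamState.setReg (s : RamState) (d v : ℕ) : RamState :=
  { s with reg := Function.update s.reg d v }

/-- Write the number `v` into cell `i` of array `a`. -/
def RamState.setArr (s : RamState) (a i v : ℕ) : RamState :=
  { s with arr := Function.update s.arr a (Function.update (s.arr a) i v) }

/-- The state after an instruction. -/
def RamInstr.exec (s : RamState) (I : RamInstr) : RamState :=
  match I with
  | .const d _ | .copy d _ | .add d _ _ | .sub d _ _ | .mul d _ _ | .load d _ _ =>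
      s.setReg d (I.value s)
  | .store a x _ => s.setArr a (s.reg x) (I.value s)

/-- Programs: finite texts built from instructions by sequencing, branching and looping. -/
inductive RamProg where
  /-- do nothing -/
  | skip
  /-- one elementary instruction -/
  | instr (I : RamInstr)
  /-- first `p`, then `q` -/
  | seq (p q : RamProg)
  /-- if `R[x] < R[y]` then `p` else `q` -/
  | ite (x y : ℕ) (p q : RamProg)
  /-- while `R[x] < R[y]` do `p` -/
  | loop (x y : ℕ) (p : RamProg)

/-- `RamExec B p s s' t`: the program `p`, started in state `s`, halts in state `s'` after exactly
`t` steps, and no number that is written on the way exceeds `B`. Every elementary instruction,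
every evaluation of a test and every `skip` counts as one step. -/
inductive RamExec (B : ℕ) : RamProg → RamState → RamState → ℕ → Prop where
  | skip (s : RamState) : RamExec B .skip s s 1
  | instr (I : RamInstr) (s : RamState) (h : I.value s ≤ B) :
      RamExec B (.instr I) s (I.exec s) 1
  | seq {p q : RamProg} {s₁ s₂ s₃ : RamState} {t₁ t₂ : ℕ}
      (hp : RamExec B p s₁ s₂ t₁) (hq : RamExec B q s₂ s₃ t₂) :
      RamExec B (.seq p q) s₁ s₃ (t₁ + t₂)
  | ite_true {x y : ℕ} {p q : RamProg} {s s' : RamState} {t : ℕ}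
      (h : s.reg x < s.reg y) (hp : RamExec B p s s' t) :
      RamExec B (.ite x y p q) s s' (t + 1)
  | ite_false {x y : ℕ} {p q : RamProg} {s s' : RamState} {t : ℕ}
      (h : ¬ s.reg x < s.reg y) (hq : RamExec B q s s' t) :
      RamExec B (.ite x y p q) s s' (t + 1)
  | loop_done {x y : ℕ} {p : RamProg} {s : RamState} (h : ¬ s.reg x < s.reg y) :
      RamExec B (.loop x y p) s s 1
  | loop_step {x y : ℕ} {p : RamProg} {s₁ s₂ s₃ : RamState} {t₁ t₂ : ℕ}
      (h : s₁.reg x < s₁.reg y) (hp : RamExec B p s₁ s₂ t₁)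
      (hl : RamExec B (.loop x y p) s₂ s₃ t₂) :
      RamExec B (.loop x y p) s₁ s₃ (t₁ + t₂ + 1)

/-! ### Graphs as inputs -/

/-- `es` lists every edge of `G` exactly once; the order of the edges in the list and the order of
the two ends of an edge are arbitrary. -/
def IsEdgeList {n : ℕ} (G : SimpleGraph (Fin n)) (es : List (Fin n × Fin n)) : Prop :=
  (es.map fun e => s(e.1, e.2)).Nodup ∧
    ∀ e : Sym2 (Fin n), e ∈ (es.map fun e => s(e.1, e.2)) ↔ e ∈ G.edgeSet

/-- The initial state for a graph with vertices `0, …, n - 1` that is given by an edge list: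
register `0` holds the number of vertices, register `1` the number of edges, cell `i` of the arrays
`0` and `1` holds the first and the second end of edge number `i`, and all the rest is `0`. -/
def graphInput {n : ℕ} (es : List (Fin n × Fin n)) : RamState where
  reg r := if r = 0 then n else if r = 1 then es.length else 0
  arr a i :=
    if a = 0 then (es[i]?.map fun e => (e.1 : ℕ)).getD 0
    else if a = 1 then (es[i]?.map fun e => (e.2 : ℕ)).getD 0
    else 0

/-! In a star colouring every edge joins the centre of a two-coloured star to one of its leaves. It
therefore carries an arc `Arc G c u v`, from the centre `u` to a leaf `v` that sees the colour of
`u` only at `u`. A proper `3`-colouring is a star colouring exactly when every edge carries an arc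
in at least one direction (`IsStarColouring.isStar`, `IsStar.isStarColouring`). This local form is
used throughout.

Structure. In diameter at most three the arcs are so rigid that some colour class can be read off
from the distances to the two ends of one edge, by one of four fixed rules
(`IsStar.exists_pattern`). There are four cases. If no vertex is a root, then climbing from parent
to parent gives an endless chain, which the diameter folds into a directed triangle
(`IsStar.exists_fans`), and the triangle determines a class (`IsStar.triangle`). If all vertices far
from some root have its colour, the class of the root is the root together with its third
neighbourhood (`IsStar.good_root`). If the neighbours of some root use one colour only, the second
neighbourhood is a class (`IsStar.mono_root`). Otherwise a path `r x q z` to a far vertex of another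
colour closes up to a `7`-cycle `r x q z t y s` in which `x`, `z`, `y` have degree two and `r`, `q`,
`t` are roots. The class of `r` is then given by the distances to `r` and `s` (`IsStar.far_class`).

Algorithm. Once one class is known, what is left is a `2`-colouring problem. Properness and the arcs
forced by vertices with two neighbours in the known class say that certain pairs of vertices get
different colours, and satisfying these constraints suffices as soon as any star colouring with this
class exists (`IsStar.edgeOk_of_partner`). Components are merged by relabelling, in `O(n)` time per
directed edge, and the outcome is checked at all edges, so a wrong guess cannot give a wrong
positive answer. One guess costs `O(nm)` and there are `8m` guesses: four rules for each of the `2m`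
directed edges. -/

/-! ### Arcs of a star colouring -/

section Structure

variable {V : Type*} {G : SimpleGraph V} {c : V → Fin 3}

/-- `u` is the only neighbour of `v` that has the colour of `u`. -/
def Arc (G : SimpleGraph V) (c : V → Fin 3) (u v : V) : Prop :=
  ∀ x, G.Adj v x → c x = c u → x = u

/-- The local description of star `3`-colourings: each edge points from the centre to a leaf in
some star. -/
structure IsStar (G : SimpleGraph V) (c : V → Fin 3) : Prop where
  proper : ∀ u v, G.Adj u v → c u ≠ c v
  arc : ∀ u v, G.Adj u v → Arc G c u v ∨ Arc G c v u

/-- `v` has distance at most two from `a`. -/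
def WithinTwo (G : SimpleGraph V) (a v : V) : Prop :=
  a = v ∨ G.Adj a v ∨ ∃ p, G.Adj a p ∧ G.Adj p v

/-- Every two vertices have distance at most three. -/
def DiamLeThree (G : SimpleGraph V) : Prop :=
  ∀ a v, a = v ∨ ∃ p, G.Adj a p ∧ WithinTwo G p v

/-- All arcs at `r` leave `r`. -/
def IsRoot (G : SimpleGraph V) (c : V → Fin 3) (r : V) : Prop :=
  ∀ x, G.Adj r x → Arc G c r x

theorem fin_three_eq {i j k : Fin 3} (hij : i ≠ j) (hik : i ≠ k) (hjk : j ≠ k) {x : Fin 3}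
    (hi : x ≠ i) (hj : x ≠ j) : x = k := by
  revert i j k x; decide

theorem fin_three_cases {i j k : Fin 3} (hij : i ≠ j) (hik : i ≠ k) (hjk : j ≠ k) (x : Fin 3) :
    x = i ∨ x = j ∨ x = k := by
  revert i j k x; decide

/-- Two neighbours of one colour rule out an arc into `b` from either of them, so `b` is their
centre. Nearly every arc below arises in this way. -/
theorem IsStar.arc_of_two (h : IsStar G c) {b x z : V} (hx : G.Adj b x) (hz : G.Adj b z)
    (hxz : x ≠ z) (hc : c x = c z) : Arc G c b x := by
  rcases h.arc b x hx with h1 | h1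
  · exact h1
  · exact absurd (h1 z hz hc.symm).symm hxz

theorem exists_two_of_not_arc {u v : V} (h : ¬ Arc G c u v) :
    ∃ x, G.Adj v x ∧ c x = c u ∧ x ≠ u := by
  simpa [Arc] using h

/-! ### A root whose third neighbourhood has its colour, and a root with one colour around it -/

/-- A neighbour of a root sees the root's colour only at the root, so this colour does not recur at
distance one or two. -/
theorem IsStar.good_root (h : IsStar G c) {r : V} (hr : IsRoot G c r)
    (hg : ∀ v, ¬ WithinTwo G r v → c v = c r) (v : V) :
    c v = c r ↔ r = v ∨ ¬ WithinTwo G r v := by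
  constructor
  · intro hv
    by_contra hn
    push Not at hn
    rcases hn.2 with e | e | ⟨p, hp, hpv⟩
    · exact hn.1 e
    · exact h.proper _ _ e hv.symm
    · exact hn.1 (hr p hp v hpv hv).symm
  · rintro (rfl | hv)
    · rfl
    · exact hg v hv

/-- At distance two the root's colour is excluded by the root and `j` by properness, which leaves
`k`. A vertex at distance three has a neighbour at distance two, so it cannot have the colour `k`.
-/
theorem IsStar.mono_root (h : IsStar G c) (hd : DiamLeThree G) {r : V} (hr : IsRoot G c r)
    {j k : Fin 3} (hj : c r ≠ j) (hk : c r ≠ k) (hjk : j ≠ k) (hm : ∀ x, G.Adj r x → c x = j)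
    (v : V) : c v = k ↔ WithinTwo G r v ∧ r ≠ v ∧ ¬ G.Adj r v := by
  have key : ∀ v, WithinTwo G r v → r ≠ v → ¬ G.Adj r v → c v = k := by
    rintro v (e | e | ⟨p, hp, hpv⟩) h1 h2
    · exact absurd e h1
    · exact absurd e h2
    · refine fin_three_eq hj hk hjk (fun e => h1 (hr p hp v hpv e).symm) ?_
      rw [← hm p hp]; exact (h.proper _ _ hpv).symm
  constructor
  · intro hv
    have h1 : r ≠ v := by rintro rfl; exact hk hv
    have h2 : ¬ G.Adj r v := fun e => hjk ((hm v e).symm.trans hv)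
    refine ⟨?_, h1, h2⟩
    by_contra hw
    rcases hd r v with e | ⟨p, hp, e | e | ⟨y, hpy, hyv⟩⟩
    · exact h1 e
    · exact h2 (e ▸ hp)
    · exact hw (Or.inr (Or.inr ⟨p, hp, e⟩))
    · have hy : c y = k := by
        refine key y (Or.inr (Or.inr ⟨p, hp, hpy⟩)) ?_ ?_
        · rintro rfl; exact h2 hyv
        · intro e; exact hw (Or.inr (Or.inr ⟨y, e, hyv⟩))
      exact h.proper _ _ hyv (hy.trans hv.symm)
  · rintro ⟨h1, h2, h3⟩
    exact key v h1 h2 h3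

/-! ### A directed triangle -/

/-- Every neighbour of `t` except `p` is a child of `t` and has the colour `k`. -/
def Fans (G : SimpleGraph V) (c : V → Fin 3) (p t : V) (k : Fin 3) : Prop :=
  G.Adj p t ∧ ∀ x, G.Adj t x → x ≠ p → c x = k ∧ Arc G c t x

/-- The arcs run `t₂ → t₀ → t₁ → t₂`. Neighbourhoods of the triangle are coloured by the fans. The
delicate point is that a vertex of colour `c t₂` far from `t₁` lies within two of `t₀`; paths from
`t₁` and from `t₀` to a counterexample collide. -/
theorem IsStar.triangle (h : IsStar G c) (hd : DiamLeThree G) {t₀ t₁ t₂ : V}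
    (f0 : Fans G c t₂ t₀ (c t₁)) (f1 : Fans G c t₀ t₁ (c t₂)) (f2 : Fans G c t₁ t₂ (c t₀)) (v : V) :
    c v = c t₂ ↔ (G.Adj t₁ v ∧ t₀ ≠ v) ∨
      (¬ WithinTwo G t₁ v ∧ WithinTwo G t₀ v ∧ t₀ ≠ v ∧ ¬ G.Adj t₀ v) := by
  obtain ⟨a20, f0⟩ := f0
  obtain ⟨a01, f1⟩ := f1
  obtain ⟨a12, f2⟩ := f2
  have n01 := h.proper _ _ a01
  have n12 := h.proper _ _ a12
  have n20 := h.proper _ _ a20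
  have pr := h.proper
  by_cases e1 : t₁ = v
  · subst e1; simp [WithinTwo, n12]
  by_cases e2 : G.Adj t₁ v
  · by_cases e3 : t₀ = v
    · subst e3; simp [n20.symm]
    · simp [e2, e3, (f1 v e2 (Ne.symm e3)).1]
  have e0 : t₀ ≠ v := by rintro rfl; exact e2 a01.symm
  by_cases e3 : WithinTwo G t₁ v
  · simp only [e2, e3, false_and, not_true_eq_false, or_self, iff_false]
    rcases e3 with e | e | ⟨s, hs, hsv⟩
    · exact absurd e e1
    · exact absurd e e2
    · by_cases hs0 : s = t₀
      · subst hs0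
        have : v ≠ t₂ := by rintro rfl; exact e2 a12
        rw [(f0 v hsv this).1]; exact n12
      · rw [← (f1 s hs hs0).1]; exact (pr _ _ hsv).symm
  have e4 : ¬ G.Adj t₀ v := fun e => e3 (Or.inr (Or.inr ⟨t₀, a01.symm, e⟩))
  simp only [e2, e3, e4, e0, not_false_eq_true, true_and, false_or, ne_eq, and_true]
  -- Below a child `w` of `t₀`, the colour of `t₀` occurs only at `t₀` and the colour of `w` is
  -- excluded by properness.
  have up : ∀ w, G.Adj t₀ w → G.Adj w v → c v = c t₂ := by
    intro w hw hwv
    have hw2 : w ≠ t₂ := by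
      rintro rfl; exact e3 (Or.inr (Or.inr ⟨_, a12, hwv⟩))
    obtain ⟨cw, aw⟩ := f0 w hw hw2
    refine fin_three_eq n01 n20.symm n12 (fun e => e0 (aw v hwv e).symm) ?_
    rw [← cw]; exact (pr _ _ hwv).symm
  constructor
  · intro hv
    by_contra hn
    -- a path from `t₁`
    obtain ⟨w, hw⟩ : ∃ w, G.Adj w v ∧ c w = c t₀ ∧ ∃ s, G.Adj w s ∧ G.Adj t₁ s ∧ s ≠ t₂ ∧ c s = c t₂ := by
      rcases hd t₁ v with e | ⟨s, hs, e | e | ⟨w, hsw, hwv⟩⟩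
      · exact absurd e e1
      · exact absurd (e ▸ hs) e2
      · exact absurd (Or.inr (Or.inr ⟨s, hs, e⟩)) e3
      · have hs0 : s ≠ t₀ := by
          rintro rfl; exact hn (Or.inr (Or.inr ⟨w, hsw, hwv⟩))
        obtain ⟨cs, as⟩ := f1 s hs hs0
        have hw1 : w ≠ t₁ := by rintro rfl; exact e2 hwv
        have cw : c w = c t₀ := by
          refine fin_three_eq n12 n01.symm n20 (fun e => hw1 (as w hsw e)) ?_
          rw [← cs]; exact (pr _ _ hsw).symm
        refine ⟨w, hwv, cw, s, hsw.symm, hs, ?_, cs⟩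
        rintro rfl
        have := (f2 w hsw hw1).2 v hwv hv
        subst this; exact e2 hs
    obtain ⟨hwv, cw, s, hws, hs, hs2, cs⟩ := hw
    have hsv : s ≠ v := by
      rintro rfl; exact e2 hs
    have awv := h.arc_of_two hwv hws hsv.symm (hv.trans cs.symm)
    -- A path of length three from `t₀` either starts with a child of `t₀`, and then its third
    -- vertex has the colour of `v`, or starts with `t₂`. In the latter case the arc from `w` to `v`
    -- forces its third vertex to be `w`, a child of `t₂` which also sees `s` in the colour of `t₂`.
    rcases hd t₀ v with e | ⟨m', hm', e | e | ⟨m, hm, hmv⟩⟩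
    · exact absurd e e0
    · exact absurd (e ▸ hm') e4
    · exact hn (Or.inr (Or.inr ⟨m', hm', e⟩))
    · by_cases hm2 : m' = t₂
      · subst hm2
        have hm1 : m ≠ t₁ := by rintro rfl; exact e2 hmv
        obtain ⟨cm, am⟩ := f2 m hm hm1
        have : m = w := awv m hmv.symm (cm.trans cw.symm)
        subst this
        exact hs2 (am s hws cs)
      · obtain ⟨cm', am'⟩ := f0 m' hm' hm2
        have hm0 : m ≠ t₀ := by rintro rfl; exact e4 hmv
        have : c m = c t₂ := by
          refine fin_three_eq n01 n20.symm n12 (fun e => hm0 (am' m hm e)) ?_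
          rw [← cm']; exact (pr _ _ hm).symm
        exact pr _ _ hmv (this.trans hv.symm)
  · rintro (e | e | ⟨w, hw, hwv⟩)
    · exact absurd e e0
    · exact absurd e e4
    · exact up w hw hwv

/-! ### Colourings without a root -/

/-- `u` has the parent `p`, and at least two children, which all have the colour `k`. -/
structure Full (G : SimpleGraph V) (c : V → Fin 3) (u p : V) (k : Fin 3) : Prop where
  adj : G.Adj u p
  arc : Arc G c p u
  child : ∀ x, G.Adj u x → x ≠ p → c x = k ∧ Arc G c u x
  other : ∀ x, ∃ y, G.Adj u y ∧ y ≠ p ∧ y ≠ x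

/-- As `v` is no root, some neighbour `u` has a second neighbour coloured like `v`. As `u` is no
root either, it has a parent `p`, which uses up one colour at `u`; all other neighbours of `u` share
the remaining colour, and as there are two of them they are children. -/
theorem IsStar.exists_full (h : IsStar G c) (hn : ∀ r, ¬ IsRoot G c r) (v : V) :
    ∃ u p, G.Adj u v ∧ v ≠ p ∧ Full G c u p (c v) := by
  have hr : ∀ v, ∃ u, G.Adj v u ∧ ∃ y, G.Adj u y ∧ c y = c v ∧ y ≠ v := by
    intro v
    have := hn v
    simp only [IsRoot, not_forall] at this
    obtain ⟨u, hu, h1⟩ := this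
    exact ⟨u, hu, exists_two_of_not_arc h1⟩
  obtain ⟨u, hu, y, hy, cy, hyv⟩ := hr v
  obtain ⟨p, hp, y', hy', cy', hyu⟩ := hr u
  have apu : Arc G c p u := h.arc_of_two hp.symm hy' hyu.symm cy'.symm
  have hvp : v ≠ p := by
    rintro rfl; exact hyv (apu y hy cy)
  have cvp : c v ≠ c p := fun e => hvp (apu v hu.symm e)
  have cx : ∀ x, G.Adj u x → x ≠ p → c x = c v := by
    intro x hx hxp
    exact fin_three_eq (h.proper _ _ hp) (h.proper _ _ hu.symm) cvp.symm
      (h.proper _ _ hx).symm (fun e => hxp (apu x hx e))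
  have hyp : y ≠ p := by
    rintro rfl; exact hvp (apu v hu.symm cy.symm)
  refine ⟨u, p, hu.symm, hvp, hp, apu, fun x hx hxp => ⟨cx x hx hxp, ?_⟩, fun x => ?_⟩
  · by_cases hxv : x = v
    · subst hxv; exact h.arc_of_two hx hy hyv.symm cy.symm
    · exact h.arc_of_two hx hu.symm hxv (cx x hx hxp)
  · by_cases hxy : y = x
    · exact ⟨v, hu.symm, hvp, fun e => hyv (hxy.trans e.symm)⟩
    · exact ⟨y, hy, hyp, hxy⟩

/-- An infinite chain of ancestors. -/
structure Chain (G : SimpleGraph V) (c : V → Fin 3) (g : ℕ → V) : Prop where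
  adj : ∀ i, G.Adj (g (i + 1)) (g i)
  ne : ∀ i, g i ≠ g (i + 2)
  full : ∀ i, Full G c (g (i + 1)) (g (i + 2)) (c (g i))

theorem IsStar.exists_chain (h : IsStar G c) (hn : ∀ r, ¬ IsRoot G c r) (v : V) :
    ∃ g, Chain G c g := by
  choose up pa h1 h2 h3 using fun v => h.exists_full hn v
  -- If `up (up v)` were a child of `up v`, it would see the colour of `up v` only there, yet it has
  -- a second child of that colour.
  have hpa : ∀ v, pa v = up (up v) := by
    intro v
    by_contra hne
    obtain ⟨-, hb⟩ := (h3 v).child (up (up v)) (h1 (up v)).symm (Ne.symm hne)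
    obtain ⟨y, hy, hyp, hyu⟩ := (h3 (up v)).other (up v)
    have cy := ((h3 (up v)).child y hy hyp).1
    exact hyu (hb y hy cy)
  refine ⟨fun i => up^[i] v, fun i => ?_, fun i => ?_, fun i => ?_⟩
  · simp only [Function.iterate_succ_apply']; exact h1 _
  · simp only [Function.iterate_succ_apply']; rw [← hpa]; exact h2 _
  · simp only [Function.iterate_succ_apply']; rw [← hpa]; exact h3 _

theorem Chain.shift {g : ℕ → V} (hg : Chain G c g) (k : ℕ) : Chain G c (fun i => g (i + k)) where
  adj i := by have := hg.adj (i + k); rwa [show i + k + 1 = i + 1 + k by ring] at this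
  ne i := by have := hg.ne (i + k); rwa [show i + k + 2 = i + 2 + k by ring] at this
  full i := by
    have := hg.full (i + k)
    rwa [show i + k + 1 = i + 1 + k by ring, show i + k + 2 = i + 2 + k by ring] at this

theorem Chain.arc {g : ℕ → V} (hg : Chain G c g) (i : ℕ) : Arc G c (g (i + 1)) (g i) :=
  ((hg.full i).child _ (hg.adj i) (hg.ne i)).2

/-- Three consecutive members of the chain have three different colours, so the colours have period
three. -/
theorem Chain.color {g : ℕ → V} (h : IsStar G c) (hg : Chain G c g) (i : ℕ) :
    c (g (i + 3)) = c (g i) := by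
  have h0 := h.proper _ _ (hg.adj i)
  have h1 := h.proper _ _ (hg.adj (i + 1))
  have h2 := h.proper _ _ (hg.adj (i + 2))
  have e : c (g i) ≠ c (g (i + 2)) := fun e => hg.ne i (hg.arc (i + 1) _ (hg.adj i) e)
  have e' : c (g (i + 1)) ≠ c (g (i + 3)) :=
    fun e => hg.ne (i + 1) (hg.arc (i + 2) _ (hg.adj (i + 1)) e)
  exact fin_three_eq (i := c (g (i + 1))) (j := c (g (i + 2))) h1.symm h0 e.symm e'.symm h2

/-- If the chain does not close up after three steps, then children of `g 1` and `g 4` have a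
common neighbour. -/
theorem Chain.bridge {g : ℕ → V} (h : IsStar G c) (hd : DiamLeThree G) (hg : Chain G c g)
    (h3 : ∀ i, g i ≠ g (i + 3)) :
    ∃ y w e, G.Adj e y ∧ G.Adj e w ∧ y ≠ w ∧ y ≠ g 6 ∧ w ≠ g 3 ∧ c e = c (g 2) ∧
      c y = c (g 0) ∧ c w = c (g 0) ∧ (∀ x, G.Adj y x ↔ x = g 1 ∨ x = e) ∧
      (∀ x, G.Adj w x ↔ x = g 4 ∨ x = e) := by
  have pr := h.proper
  have c30 := hg.color h 0
  have c41 := hg.color h 1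
  have c52 := hg.color h 2
  have c63 := hg.color h 3
  have a1 := hg.adj 1
  have a2 := hg.adj 2
  have a0 := hg.adj 0
  simp only [Nat.reduceAdd, Nat.zero_add] at *
  have n10 : c (g 1) ≠ c (g 0) := pr _ _ a0
  have n21 : c (g 2) ≠ c (g 1) := pr _ _ a1
  have n20 : c (g 2) ≠ c (g 0) := by rw [← c30]; exact (pr _ _ a2).symm
  -- Avoiding `g 6` for `y` and `g 3` for `w` excludes precisely the two paths of length three from
  -- `y` to `w` that would run along the chain.
  obtain ⟨y, hy, hy2, hy6⟩ := (hg.full 0).other (g 6)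
  obtain ⟨w, hw, hw5, hw3⟩ := (hg.full 3).other (g 3)
  obtain ⟨cy, ay⟩ := (hg.full 0).child y hy hy2
  obtain ⟨cw, aw⟩ := (hg.full 3).child w hw hw5
  simp only [Nat.reduceAdd, Nat.zero_add] at *
  have p5 := hg.arc 4
  have p6 := hg.arc 5
  have p2 := hg.arc 1
  have p3 := hg.arc 2
  simp only [Nat.reduceAdd] at *
  have hyw : y ≠ w := by
    rintro rfl; exact h3 1 (ay _ hw.symm c41).symm
  have key : ∃ e, G.Adj e y ∧ G.Adj e w ∧ c e = c (g 2) := by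
    have col : ∀ x, c x ≠ c (g 0) → c x = c (g 1) ∨ c x = c (g 2) := by
      intro x hx
      rcases fin_three_cases n10.symm n20.symm n21.symm (c x) with e | e | e
      · exact absurd e hx
      · exact Or.inl e
      · exact Or.inr e
    rcases hd y w with e | ⟨e, hye, hew | hew | ⟨f, hef, hfw⟩⟩
    · exact absurd e hyw
    · subst hew; exact absurd (cy.trans (cw.trans c30).symm) (pr _ _ hye)
    · refine ⟨e, hye.symm, hew, ?_⟩
      rcases col e (fun e' => pr _ _ hye (cy.trans e'.symm)) with e' | e'
      · have i1 := ay e hye e'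
        have i4 := aw e hew.symm (e'.trans c41.symm)
        exact absurd (i1.symm.trans i4) (h3 1)
      · exact e'
    -- On a path `y e f w` the two inner colours are those of `g 1` and `g 2`. The arcs of the chain
    -- then force `e`, `f`, `w` to be `g 1`, `g 2`, `g 3`, or `f`, `e`, `y` to be `g 4`, `g 5`, `g
    -- 6`.
    · exfalso
      have ce := col e (fun e' => pr _ _ hye (cy.trans e'.symm))
      have cf := col f (fun e' => pr _ _ hfw (e'.trans (cw.trans c30).symm))
      have nef := pr _ _ hef
      rcases ce with e1 | e1
      · have i1 := ay e hye e1
        subst i1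
        have f2 : c f = c (g 2) := by
          rcases cf with e' | e'
          · exact absurd (e1.trans e'.symm) nef
          · exact e'
        have i2 := p2 f hef f2
        subst i2
        exact hw3 (p3 w hfw cw)
      · have f1 : c f = c (g 1) := by
          rcases cf with e' | e'
          · exact e'
          · exact absurd (e1.trans e'.symm) nef
        have i4 := aw f hfw.symm (f1.trans c41.symm)
        subst i4
        have i5 := p5 e hef.symm (e1.trans c52.symm)
        subst i5
        exact hy6 (p6 y hye.symm (by rw [c63, c30]; exact cy))
  obtain ⟨e, hey, hew, ce⟩ := key
  have cwy : c w = c y := by rw [cw, cy, c30]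
  have aey := h.arc_of_two hey hew hyw cwy.symm
  have aew := h.arc_of_two hew hey hyw.symm cwy
  refine ⟨y, w, e, hey, hew, hyw, hy6, hw3, ce, cy, cwy.trans cy, fun x => ⟨fun hx => ?_, ?_⟩,
    fun x => ⟨fun hx => ?_, ?_⟩⟩
  · rcases fin_three_cases n10.symm n20.symm n21.symm (c x) with e' | e' | e'
    · exact absurd (cy.trans e'.symm) (pr _ _ hx)
    · exact Or.inl (ay x hx e')
    · exact Or.inr (aey x hx (e'.trans ce.symm))
  · rintro (rfl | rfl)
    · exact hy.symm
    · exact hey.symm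
  · rcases fin_three_cases n10.symm n20.symm n21.symm (c x) with e' | e' | e'
    · exact absurd ((cwy.trans cy).trans e'.symm) (pr _ _ hx)
    · exact Or.inl (aw x hx (e'.trans c41.symm))
    · exact Or.inr (aew x hx (e'.trans ce.symm))
  · rintro (rfl | rfl)
    · exact hw.symm
    · exact hew.symm

/-- Since `e₁` is a child of `e₃`, the colour of `e₃` occurs only once around `e₁`; all other
neighbours have the colour of `e₂` and are children. -/
theorem IsStar.fans_of_arcs (h : IsStar G c) {e₁ e₂ e₃ : V} (h12 : G.Adj e₁ e₂) (h31 : G.Adj e₃ e₁)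
    (n23 : c e₂ ≠ c e₃) (a1 : ∀ x, G.Adj e₁ x → c x = c e₂ → Arc G c e₁ x)
    (a3 : ∀ x, G.Adj e₃ x → c x = c e₁ → Arc G c e₃ x) : Fans G c e₃ e₁ (c e₂) := by
  refine ⟨h31, fun x hx hx3 => ?_⟩
  have cx : c x = c e₂ := fin_three_eq (h.proper _ _ h31) n23.symm (h.proper _ _ h12)
    (fun e => hx3 (a3 e₁ h31 rfl x hx e)) (h.proper _ _ hx).symm
  exact ⟨cx, a1 x hx cx⟩

/-- Either the chain closes up after three steps and is itself the triangle, or the bridges of three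
consecutive shifts give centres `e1`, `e2`, `e3`. The vertices below these have degree two, and
short paths between such vertices force the centres to be pairwise adjacent. -/
theorem IsStar.exists_fans (h : IsStar G c) (hd : DiamLeThree G) (hn : ∀ r, ¬ IsRoot G c r)
    (v : V) : ∃ t₀ t₁ t₂, Fans G c t₂ t₀ (c t₁) ∧ Fans G c t₀ t₁ (c t₂) ∧ Fans G c t₁ t₂ (c t₀) := by
  obtain ⟨g, hg⟩ := h.exists_chain hn v
  have pr := h.proper
  by_cases h3 : ∀ i, g i ≠ g (i + 3)
  · have h3' : ∀ k i, g (i + k) ≠ g (i + 3 + k) := fun k i => by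
      have := h3 (i + k); rwa [show i + k + 3 = i + 3 + k by ring] at this
    obtain ⟨y1, w1, e1, hy1, hw1, n1, m1, l1, ce1, cy1, cw1, ny1, nw1⟩ := hg.bridge h hd h3
    obtain ⟨y2, w2, e2, hy2, hw2, n2, m2, l2, ce2, cy2, cw2, ny2, nw2⟩ :=
      (hg.shift 1).bridge h hd (h3' 1)
    obtain ⟨y3, w3, e3, hy3, hw3, n3, m3, l3, ce3, cy3, cw3, ny3, nw3⟩ :=
      (hg.shift 2).bridge h hd (h3' 2)
    simp only [Nat.reduceAdd, Nat.zero_add] at *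
    have c3 : c (g 3) = c (g 0) := hg.color h 0
    have c4 : c (g 4) = c (g 1) := hg.color h 1
    have c5 : c (g 5) = c (g 2) := hg.color h 2
    have c6 : c (g 6) = c (g 0) := (hg.color h 3).trans c3
    have c7 : c (g 7) = c (g 1) := (hg.color h 4).trans c4
    have n10 : c (g 1) ≠ c (g 0) := pr _ _ (hg.adj 0)
    have n21 : c (g 2) ≠ c (g 1) := pr _ _ (hg.adj 1)
    have n20 : c (g 2) ≠ c (g 0) := by rw [← c3]; exact (pr _ _ (hg.adj 2)).symm
    rw [c3] at ce2
    rw [c4] at ce3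
    -- children of `e1`, `e2`, `e3`
    have a1 : ∀ x, G.Adj e1 x → c x = c (g 0) → Arc G c e1 x := by
      intro x hx cx
      by_cases e : x = y1
      · subst e; exact h.arc_of_two hx hw1 n1 (cx.trans cw1.symm)
      · exact h.arc_of_two hx hy1 e (cx.trans cy1.symm)
    have a2 : ∀ x, G.Adj e2 x → c x = c (g 1) → Arc G c e2 x := by
      intro x hx cx
      by_cases e : x = y2
      · subst e; exact h.arc_of_two hx hw2 n2 (cx.trans cw2.symm)
      · exact h.arc_of_two hx hy2 e (cx.trans cy2.symm)
    have a3 : ∀ x, G.Adj e3 x → c x = c (g 2) → Arc G c e3 x := by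
      intro x hx cx
      by_cases e : x = y3
      · subst e; exact h.arc_of_two hx hw3 n3 (cx.trans cw3.symm)
      · exact h.arc_of_two hx hy3 e (cx.trans cy3.symm)
    -- Stated for any chain so that it serves for `e1`, `e2` and, after a shift, for `e2`, `e3`. A
    -- short path from `w1` to `y2` cannot pass through `g 4` or `g 2`, hence it is `w1 e1 e2 y2`.
    have A12 : ∀ (y1 w1 e1 y2 w2 e2 : V) (g : ℕ → V), Chain G c g → (∀ i, g i ≠ g (i + 3)) →
        G.Adj e1 y1 → G.Adj e1 w1 → y1 ≠ w1 → c e1 = c (g 2) → c y1 = c (g 0) → c w1 = c (g 0) →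
        (∀ x, G.Adj w1 x ↔ x = g 4 ∨ x = e1) → G.Adj e2 y2 → G.Adj e2 w2 → y2 ≠ w2 →
        c e2 = c (g 3) → c y2 = c (g 1) → c w2 = c (g 1) → (∀ x, G.Adj y2 x ↔ x = g 2 ∨ x = e2) →
        G.Adj e1 e2 := by
      clear * - h hd
      intro y1 w1 e1 y2 w2 e2 g hg h3 hy1 hw1 n1 ce1 cy1 cw1 nw1 hy2 hw2 n2 ce2 cy2 cw2 ny2
      have pr := h.proper
      have c3 : c (g 3) = c (g 0) := hg.color h 0
      have c4 : c (g 4) = c (g 1) := hg.color h 1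
      have c5 : c (g 5) = c (g 2) := hg.color h 2
      have n10 : c (g 1) ≠ c (g 0) := pr _ _ (hg.adj 0)
      have n21 : c (g 2) ≠ c (g 1) := pr _ _ (hg.adj 1)
      have n20 : c (g 2) ≠ c (g 0) := by rw [← c3]; exact (pr _ _ (hg.adj 2)).symm
      have p3 := hg.arc 2
      have p5 := hg.arc 4
      have f4 := hg.full 3
      simp only [Nat.reduceAdd] at p3 p5 f4
      rcases hd w1 y2 with e | ⟨p, hp, e | e | ⟨q, hpq, hq⟩⟩
      · grind
      · rcases (nw1 p).1 hp with rfl | rfl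
        · obtain ⟨y, hy, hy5, hye⟩ := f4.other e2
          have := (f4.child y hy hy5).1
          rw [e, ny2] at hy
          grind
        · grind
      · have h1 := (nw1 p).1 hp
        have h2 := (ny2 p).1 e.symm
        rcases h1 with rfl | rfl
        · grind
        · rcases h2 with rfl | rfl
          · exact absurd ((p3 y1 hy1 (by grind)).trans (p3 w1 hw1 (by grind)).symm) n1
          · grind
      · have h1 := (nw1 p).1 hp
        have h2 := (ny2 q).1 hq.symm
        rcases h1 with rfl | rfl
        · rcases h2 with rfl | rfl
          · exact absurd (p5 _ hpq c5.symm) (h3 2)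
          · have := (f4.child q hpq (by grind)).2
            exact absurd ((this y2 hy2 (by grind)).trans (this w2 hw2 (by grind)).symm) n2
        · rcases h2 with rfl | rfl
          · exact absurd ce1 (pr _ _ hpq)
          · exact hpq
    have e12 : G.Adj e1 e2 := A12 y1 w1 e1 y2 w2 e2 g hg h3 hy1 hw1 n1 ce1 cy1 cw1 nw1 hy2 hw2 n2
      (ce2.trans c3.symm) cy2 cw2 ny2
    have e23 : G.Adj e2 e3 := A12 y2 w2 e2 y3 w3 e3 _ (hg.shift 1) (h3' 1) hy2 hw2 n2
      (ce2.trans c3.symm) cy2 cw2 nw2 hy3 hw3 n3 (ce3.trans c4.symm) cy3 cw3 ny3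
    have e31 : G.Adj e3 e1 := by
      have p5 := hg.arc 4
      have f4 := hg.full 3
      have f6 := hg.full 5
      have g76 := hg.adj 6
      simp only [Nat.reduceAdd] at p5 f4 f6 g76
      rcases hd w3 w1 with e | ⟨p, hp, e | e | ⟨q, hpq, hq⟩⟩
      · grind
      · rcases (nw3 p).1 hp with rfl | rfl
        · obtain ⟨y, hy, hy5, hye⟩ := f6.other e1
          have := (f6.child y hy hy5).1
          rw [e, nw1] at hy
          grind
        · grind
      · have h1 := (nw3 p).1 hp
        have h2 := (nw1 p).1 e.symm
        rcases h1 with rfl | rfl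
        · grind
        · rcases h2 with rfl | rfl
          · exact absurd ((p5 y3 hy3 (by grind)).trans (p5 w3 hw3 (by grind)).symm) n3
          · grind
      · have h1 := (nw3 p).1 hp
        have h2 := (nw1 q).1 hq.symm
        rcases h1 with rfl | rfl
        · rcases h2 with rfl | rfl
          · have := (f4.child _ hpq.symm (by grind)).2
            exact absurd (this _ g76.symm (by grind)).symm (h3 4)
          · have := (f6.child q hpq (by grind)).2
            exact absurd (this y1 hy1 (by grind)) m1
        · rcases h2 with rfl | rfl
          · exact absurd (ce3.trans c4.symm) (pr _ _ hpq)
          · exact hpq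
    rw [← ce2] at a1
    rw [← ce3] at a2
    rw [← ce1] at a3
    exact ⟨e1, e2, e3, h.fans_of_arcs e12 e31 (pr _ _ e23) a1 a3,
      h.fans_of_arcs e23 e12 (pr _ _ e31) a2 a1, h.fans_of_arcs e31 e23 (pr _ _ e12) a3 a2⟩
  · push Not at h3
    obtain ⟨i, hi⟩ := h3
    have f1 := hg.full i
    have f2 := hg.full (i + 1)
    have f3 := hg.full (i + 2)
    have ad0 := hg.adj i
    have ad1 := hg.adj (i + 1)
    have ad2 := hg.adj (i + 2)
    rw [show i + 1 + 1 = i + 2 by ring] at f2 ad1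
    rw [show i + 1 + 2 = i + 3 by ring, ← hi] at f2
    rw [show i + 2 + 1 = i + 3 by ring, ← hi] at f3 ad2
    rw [show i + 2 + 2 = i + 1 + 3 by ring] at f3
    have n10 := pr _ _ ad0
    have n21 := pr _ _ ad1
    have n02 := pr _ _ ad2
    have c4 : c (g (i + 1 + 3)) = c (g (i + 1)) := hg.color h (i + 1)
    refine ⟨g (i + 2), g (i + 1), g i, h.fans_of_arcs ad1 ad2 n10 ?_ ?_,
      h.fans_of_arcs ad0 ad1 n02 ?_ ?_, h.fans_of_arcs ad2 ad0 n21 ?_ ?_⟩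
    all_goals intro x hx cx
    · exact (f2.child x hx (by grind)).2
    · exact (f3.child x hx (by grind)).2
    · exact (f1.child x hx (by grind)).2
    · exact (f2.child x hx (by grind)).2
    · exact (f3.child x hx (by grind)).2
    · exact (f1.child x hx (by grind)).2

/-! ### Colourings with a root -/

/-- The diameter bound as used from here on: a vertex of degree two forces every other vertex within
two of one of its neighbours. -/
theorem within_two_of_deg_two (hd : DiamLeThree G) {a p q : V} (ha : ∀ u, G.Adj a u → u = p ∨ u = q)
    (v : V) : a = v ∨ WithinTwo G p v ∨ WithinTwo G q v := by
  rcases hd a v with e | ⟨u, hu, hv⟩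
  · exact Or.inl e
  · rcases ha u hu with rfl | rfl
    · exact Or.inr (Or.inl hv)
    · exact Or.inr (Or.inr hv)

/-- The root `r` has a vertex `z` at distance three that has not the colour of `r`. -/
structure Bad (G : SimpleGraph V) (c : V → Fin 3) (r x q z : V) : Prop where
  root : IsRoot G c r
  rx : G.Adj r x
  xq : G.Adj x q
  qz : G.Adj q z
  far : ¬ WithinTwo G r z
  col : c z ≠ c r

section Root

variable (h : IsStar G c) (hd : DiamLeThree G)
  (hmono : ∀ r, IsRoot G c r → ∀ j, j ≠ c r → ∃ x, G.Adj r x ∧ c x = j)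
  (hgood : ∀ r, IsRoot G c r → ∃ v, ¬ WithinTwo G r v ∧ c v ≠ c r)
  {r x q z : V} (hb : Bad G c r x q z)

include h hb in
theorem Bad.basic : G.Adj q x ∧ q ≠ r ∧ ¬ G.Adj r q ∧ x ≠ z ∧ c x ≠ c r ∧ c q ≠ c r ∧ c q ≠ c x ∧
    c z = c x := by
  obtain ⟨root, rx, xq, qz, far, col⟩ := hb
  have pr := h.proper
  have h1 : q ≠ r := by rintro rfl; exact far (Or.inr (Or.inl qz))
  have h2 : ¬ G.Adj r q := fun e => far (Or.inr (Or.inr ⟨q, e, qz⟩))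
  have h3 : x ≠ z := by rintro rfl; exact far (Or.inr (Or.inl rx))
  have h4 := (pr _ _ rx).symm
  have h5 : c q ≠ c r := fun e => h1 (root x rx q xq e)
  have h6 := (pr _ _ xq).symm
  exact ⟨xq.symm, h1, h2, h3, h4, h5, h6,
    fin_three_eq h5.symm h4.symm h6 col (pr _ _ qz).symm⟩

include h hb in
theorem Bad.arc_q : ∀ v, G.Adj q v → c v = c x → Arc G c q v := by
  obtain ⟨qx, -, -, xz, -, -, -, cz⟩ := hb.basic h
  intro v hv cv
  by_cases e : v = x
  · subst e; exact h.arc_of_two hv hb.qz xz cz.symm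
  · exact h.arc_of_two hv qx e cv

include h hb in
-- Both colours available around `x` are used up: `x` is a child of the root `r` and also of `q`,
-- which has two neighbours `x`, `z` of one colour.
theorem Bad.nbr_x (v : V) : G.Adj x v ↔ v = r ∨ v = q := by
  obtain ⟨qx, -, -, -, n1, n2, n3, -⟩ := hb.basic h
  constructor
  · intro hv
    rcases fin_three_cases n1.symm n2.symm n3.symm (c v) with e | e | e
    · exact Or.inl (hb.root x hb.rx v hv e)
    · exact absurd e.symm (h.proper _ _ hv)
    · exact Or.inr (hb.arc_q h x qx rfl v hv e)
  · rintro (rfl | rfl)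
    · exact hb.rx.symm
    · exact hb.xq

include h hmono hb in
-- Otherwise all neighbours of `q` would have the colour of `x` and be children of `q`, making `q` a
-- root with one colour around it.
theorem Bad.exists_w : ∃ w, G.Adj q w ∧ c w = c r := by
  obtain ⟨qx, -, -, -, n1, n2, n3, -⟩ := hb.basic h
  by_contra hn
  push Not at hn
  have hq : IsRoot G c q := fun v hv => hb.arc_q h v hv
    (fin_three_eq n2.symm n1.symm n3 (hn v hv) (h.proper _ _ hv).symm)
  obtain ⟨w, hw, cw⟩ := hmono q hq (c r) n2.symm
  exact hn w hw cw

include h hd hb in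
-- As `z` is far from `r`, a shortest path from `z` to a neighbour `s` of `r` cannot be shorter than
-- three, and the root and the arcs from `q` leave one choice for the colours on it.
theorem Bad.exists_t {s : V} (hs : G.Adj r s) (cs : c s = c q) :
    ∃ t y, G.Adj z t ∧ G.Adj t y ∧ G.Adj y s ∧ c t = c r ∧ c y = c x ∧ y ≠ z := by
  obtain ⟨qx, qr, nrq, xz, n1, n2, n3, cz⟩ := hb.basic h
  have pr := h.proper
  have root := hb.root
  have far := hb.far
  have qz := hb.qz
  have aqz := hb.arc_q h z qz cz
  have col := fun v => fin_three_cases n1.symm n2.symm n3.symm (c v)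
  rcases hd z s with e | ⟨t, hzt, e | hts | ⟨y, hty, hys⟩⟩
  · subst e; exact absurd (Or.inr (Or.inl hs)) far
  · subst e; exact absurd (Or.inr (Or.inr ⟨t, hs, hzt.symm⟩)) far
  · exfalso
    rcases col t with e | e | e
    · have := root s hs t hts.symm e
      subst this; exact far (Or.inr (Or.inl hzt.symm))
    · exact pr _ _ hzt (cz.trans e.symm)
    · exact pr _ _ hts (e.trans cs.symm)
  · have yr : c y ≠ c r := by
      intro e
      have := root s hs y hys.symm e
      subst this; exact far (Or.inr (Or.inr ⟨t, hty.symm, hzt.symm⟩))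
    have cy : c y = c x := by
      rcases col y with e | e | e
      · exact absurd e yr
      · exact e
      · exact absurd (e.trans cs.symm) (pr _ _ hys)
    have ct : c t = c r := by
      rcases col t with e | e | e
      · exact e
      · exact absurd (cz.trans e.symm) (pr _ _ hzt)
      · have := aqz t hzt e
        subst this
        have := hb.arc_q h y hty cy s hys cs
        subst this; exact absurd hs nrq
    refine ⟨t, y, hzt, hty, hys, ct, cy, ?_⟩
    rintro rfl; exact far (Or.inr (Or.inr ⟨s, hs, hys.symm⟩))

end Root

end Structure

/-! ### The bad path and its return to the root. -/

section Root

variable {V : Type*} {G : SimpleGraph V} {c : V → Fin 3}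
variable (h : IsStar G c) (hd : DiamLeThree G)
  (hmono : ∀ r, IsRoot G c r → ∀ j, j ≠ c r → ∃ x, G.Adj r x ∧ c x = j)
  (hgood : ∀ r, IsRoot G c r → ∃ v, ¬ WithinTwo G r v ∧ c v ≠ c r)
  {r x q z : V} (hb : Bad G c r x q z)

/-- The second half of a path from `z` to a child of `r`. -/
structure Tail (G : SimpleGraph V) (c : V → Fin 3) (r x z t y : V) : Prop where
  zt : G.Adj z t
  ty : G.Adj t y
  ct : c t = c r
  cy : c y = c x
  yz : y ≠ z

variable {t y : V} (ht : Tail G c r x z t y)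

include h hb ht in
theorem Tail.arc_t (v : V) (hv : G.Adj t v) (cv : c v = c x) : Arc G c t v := by
  obtain ⟨-, -, -, -, -, -, -, cz⟩ := hb.basic h
  by_cases e : v = y
  · subst e; exact h.arc_of_two hv ht.zt.symm ht.yz (cv.trans cz.symm)
  · exact h.arc_of_two hv ht.ty e (cv.trans ht.cy.symm)

include h hb ht in
-- Here `z` is a child of both `q` and `t`, which have the two colours available around it.
theorem Tail.nbr_z (v : V) : G.Adj z v ↔ v = q ∨ v = t := by
  obtain ⟨qx, -, -, -, n1, n2, n3, cz⟩ := hb.basic h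
  constructor
  · intro hv
    rcases fin_three_cases n1.symm n2.symm n3.symm (c v) with e | e | e
    · exact Or.inr (ht.arc_t h hb z ht.zt.symm cz v hv (e.trans ht.ct.symm))
    · exact absurd (cz.trans e.symm) (h.proper _ _ hv)
    · exact Or.inl (hb.arc_q h z hb.qz cz v hv e)
  · rintro (rfl | rfl)
    · exact hb.qz.symm
    · exact ht.zt

include h hd hgood hb ht in
-- If `t` and `q` were adjacent, one of them would be a root. By `hgood` it has a far vertex of
-- another colour, but `x` and `z` have degree two and leave no place for such a vertex.
theorem Tail.not_adj : ¬ G.Adj t q := by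
  intro htq
  obtain ⟨qx, qr, nrq, xz, n1, n2, n3, cz⟩ := hb.basic h
  have pr := h.proper
  have col := fun v => fin_three_cases n1.symm n2.symm n3.symm (c v)
  have ct := ht.ct
  have nz := fun v => (ht.nbr_z h hb v).1
  have nx := fun v => (hb.nbr_x h v).1
  have aq := hb.arc_q h
  have at' := ht.arc_t h hb
  have qz := hb.qz
  by_cases hq : IsRoot G c q
  · obtain ⟨v, fv, cv⟩ := hgood q hq
    simp only [WithinTwo, not_or, not_exists, not_and] at fv
    obtain ⟨f0, f1, f2⟩ := fv
    have cvr : c v ≠ c r := by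
      rcases within_two_of_deg_two hd nx v with e | (e | e | ⟨p, hp, e⟩) | (e | e | ⟨p, hp, e⟩)
      · grind
      · subst e; exact absurd hb.rx.symm (f2 x qx)
      · exact (pr _ _ e).symm
      · intro e'
        have := hb.root p hp v e e'
        subst this; exact f2 x qx hb.rx.symm
      · grind
      · grind
      · grind
    rcases within_two_of_deg_two hd nz v with e | (e | e | ⟨p, hp, e⟩) | (e | e | ⟨p, hp, e⟩)
    · grind
    · grind
    · grind
    · grind
    · grind
    · exact f2 t htq.symm e
    · have : c p = c q := by
        have := pr _ _ e
        have := pr _ _ hp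
        grind
      have := hq t htq.symm p hp this
      grind
  · have : ∃ w, G.Adj q w ∧ ¬ Arc G c q w := by simpa [IsRoot] using hq
    obtain ⟨w, hw, haw⟩ := this
    obtain ⟨q', hq', cq', nq'⟩ := exists_two_of_not_arc haw
    have awq : Arc G c w q := (h.arc q w hw).resolve_left haw
    have cw : c w = c r := by
      have := pr _ _ hw
      have := aq w hw
      grind
    have : t = w := awq t htq.symm (ct.trans cw.symm)
    subst this
    have tr : IsRoot G c t := by
      intro v hv
      rcases col v with e | e | e
      · exact absurd (ct.trans e.symm) (pr _ _ hv)
      · exact at' v hv e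
      · by_cases e' : v = q
        · subst e'; exact awq
        · exact h.arc_of_two hv htq e' e
    obtain ⟨v, fv, cv⟩ := hgood t tr
    simp only [WithinTwo, not_or, not_exists, not_and] at fv
    obtain ⟨f0, f1, f2⟩ := fv
    rcases within_two_of_deg_two hd nz v with e | (e | e | ⟨p, hp, e⟩) | (e | e | ⟨p, hp, e⟩)
    · subst e; exact f1 ht.zt.symm
    · grind
    · exact f2 q htq e
    · have hpt : p ≠ t := by rintro rfl; exact f1 e
      have cp : c p = c x := by
        have := pr _ _ hp
        have := awq p hp
        grind
      have := aq p hp cp v e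
      have := pr _ _ e
      grind
    · grind
    · grind
    · grind

include h hd hmono hgood hb ht in
/-- A middle vertex on a path from `t` to a child `s` of `r` has no further neighbour with the
colour of `s`. -/
theorem Tail.unique_k {s : V} (hs : G.Adj r s) (cs : c s = c q) (hys : G.Adj y s) :
    ∀ m, G.Adj y m → c m = c q → m = s := by
  by_contra hcon
  push Not at hcon
  obtain ⟨m₀, hm₀, cm₀, nm₀⟩ := hcon
  obtain ⟨qx, qr, nrq, xz, n1, n2, n3, cz⟩ := hb.basic h
  have ntq := ht.not_adj h hd hgood hb
  have pr := h.proper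
  have col := fun v => fin_three_cases n1.symm n2.symm n3.symm (c v)
  have ct := ht.ct
  have cy := ht.cy
  have ty := ht.ty
  have root := hb.root
  have nz := fun v => (ht.nbr_z h hb v)
  have nx := fun v => (hb.nbr_x h v)
  have aq := hb.arc_q h
  have at' := ht.arc_t h hb
  have aty := at' y ty cy
  have tr : t ≠ r := by
    rintro rfl; exact hb.far (Or.inr (Or.inl ht.zt.symm))
  -- `y` is the centre of its neighbours with the colour of `q`
  have ay : ∀ v, G.Adj y v → c v = c q → Arc G c y v := by
    intro v hv cv
    by_cases e : v = s
    · subst e; exact h.arc_of_two hv hm₀ nm₀.symm (cv.trans cm₀.symm)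
    · exact h.arc_of_two hv hys e (cv.trans cs.symm)
  -- Now `s` is a child of both `r` and `y`, so its degree is two. The contradiction comes from a
  -- cascade of such vertices, each of which forces a new common neighbour: `m`, then `n`, `f` and
  -- `s'`.
  have ns : ∀ v, G.Adj s v → v = r ∨ v = y := by
    intro v hv
    have := pr _ _ hv
    have := root s hs v hv
    have := ay s hys cs v hv
    have := col v
    grind
  obtain ⟨w, hw, cw⟩ := hb.exists_w h hmono
  have wt : w ≠ t := by rintro rfl; exact ntq hw.symm
  have wr : w ≠ r := by rintro rfl; exact nrq hw.symm
  have nyq : ¬ G.Adj q y := by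
    intro e
    have := aq y e cy s hys cs
    grind
  obtain ⟨m, hym, cm, hmw⟩ : ∃ m, G.Adj y m ∧ c m = c q ∧ G.Adj w m := by
    rcases within_two_of_deg_two hd ns w with e | (e | e | ⟨p, hp, e⟩) | (e | e | ⟨p, hp, e⟩)
    · grind
    · grind
    · exact absurd cw (pr _ _ e).symm
    · have := root p hp w e cw; grind
    · grind
    · have := aty w e (cw.trans ct.symm); grind
    · refine ⟨p, hp, ?_, e.symm⟩
      have := pr _ _ hp
      have := pr _ _ e
      grind
  have mq : m ≠ q := by rintro rfl; exact nyq hym.symm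
  have aw : ∀ v, G.Adj w v → c v = c q → Arc G c w v := by
    intro v hv cv
    by_cases e : v = q
    · subst e; exact h.arc_of_two hv hmw mq.symm cm.symm
    · exact h.arc_of_two hv hw.symm e cv
  have nm : ∀ v, G.Adj m v → v = y ∨ v = w := by
    intro v hv
    have := pr _ _ hv
    have := aw m hmw cm v hv
    have := ay m hym cm v hv
    have := col v
    grind
  -- a neighbour `e` of `t` with the colour of `q`
  obtain ⟨e, hte, ce⟩ : ∃ e, G.Adj t e ∧ c e = c q := by
    by_contra hn
    push Not at hn
    have hroot : IsRoot G c t := by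
      intro v hv
      refine at' v hv ?_
      have := pr _ _ hv
      have := hn v hv
      have := col v
      grind
    obtain ⟨v, hv, cv⟩ := hmono t hroot (c q) (by rw [ct]; exact n2)
    exact hn v hv cv
  have nwe : ¬ G.Adj w e := fun e' => wt (aw e e' ce t hte.symm (ct.trans cw.symm)).symm
  have eq : e ≠ q := by rintro rfl; exact ntq hte
  have nre : ¬ G.Adj r e := fun e' => tr (root e e' t hte.symm ct)
  have aqw : ∀ v, G.Adj q v → c v = c r → v = w := by
    have awq := aw q hw.symm rfl
    exact fun v hv cv => awq v hv (cv.trans cw.symm)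
  -- From `x`, whose neighbours are `r` and `q`, the vertex `e` can be reached only through `r`.
  obtain ⟨n, hrn, hne, cn⟩ : ∃ n, G.Adj r n ∧ G.Adj n e ∧ c n = c x := by
    rcases within_two_of_deg_two hd (fun v => (nx v).1) e with
      e' | (e' | e' | ⟨p, hp, e'⟩) | (e' | e' | ⟨p, hp, e'⟩)
    · grind
    · grind
    · exact absurd e' nre
    · refine ⟨p, hp, e', ?_⟩
      have := pr _ _ hp
      have := pr _ _ e'
      have := col p
      grind
    · grind
    · exact absurd ce (pr _ _ e').symm
    · exfalso
      have h1 := pr _ _ hp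
      have h2 := aqw p hp
      have h3 := aq p hp
      rcases col p with cp | cp | cp
      · have := h2 cp
        subst this; exact nwe e'
      · exact eq (h3 cp e e' ce)
      · exact h1 cp.symm
  have nwn : ¬ G.Adj w n := fun e' => wr (root n hrn w e'.symm cw)
  have ntn : ¬ G.Adj t n := fun e' => tr (root n hrn t e'.symm ct)
  obtain ⟨f, hnf, hfw, cf⟩ : ∃ f, G.Adj n f ∧ G.Adj w f ∧ c f = c q := by
    rcases within_two_of_deg_two hd nm n with e' | (e' | e' | ⟨p, hp, e'⟩) | (e' | e' | ⟨p, hp, e'⟩)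
    · grind
    · subst e'
      exact absurd (aty r hrn.symm ct.symm).symm tr
    · exact absurd (cy.trans cn.symm) (pr _ _ e')
    · exfalso
      have h1 := pr _ _ hp
      have h2 := aty p hp
      have h3 := ay p hp
      rcases col p with cp | cp | cp
      · have := h2 (cp.trans ct.symm)
        subst this; exact ntn e'
      · exact h1 (cy.trans cp.symm)
      · have := h3 cp n e' (cn.trans cy.symm)
        subst this
        exact absurd (aty r hrn.symm ct.symm).symm tr
    · grind
    · exact absurd e' nwn
    · refine ⟨p, e'.symm, hp, ?_⟩
      have := pr _ _ hp
      have := pr _ _ e'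
      have := col p
      grind
  have fe : f ≠ e := by rintro rfl; exact nwe hfw
  have an : ∀ v, G.Adj n v → c v = c q → Arc G c n v := by
    intro v hv cv
    by_cases e' : v = f
    · subst e'; exact h.arc_of_two hv hne fe (cv.trans ce.symm)
    · exact h.arc_of_two hv hnf e' (cv.trans cf.symm)
  have nf : ∀ v, G.Adj f v → v = n ∨ v = w := by
    intro v hv
    have := pr _ _ hv
    have := aw f hfw cf v hv
    have := an f hnf cf v hv
    have := col v
    grind
  obtain ⟨g, hg, cg⟩ : ∃ g, G.Adj w g ∧ c g = c x := by
    by_contra hn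
    push Not at hn
    have hroot : IsRoot G c w := by
      intro v hv
      refine aw v hv ?_
      have := pr _ _ hv
      have := hn v hv
      have := col v
      grind
    obtain ⟨v, hv, cv⟩ := hmono w hroot (c x) (by rw [cw]; exact n1)
    exact hn v hv cv
  have ntg : ¬ G.Adj t g := fun e' => wt (at' g e' cg w hg.symm (cw.trans ct.symm))
  have nrg : ¬ G.Adj r g := fun e' => wr (root g e' w hg.symm cw)
  have gy : g ≠ y := by rintro rfl; exact ntg ty
  obtain ⟨s', hrs', hsg', cs'⟩ : ∃ s', G.Adj r s' ∧ G.Adj s' g ∧ c s' = c q := by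
    rcases within_two_of_deg_two hd ns g with e' | (e' | e' | ⟨p, hp, e'⟩) | (e' | e' | ⟨p, hp, e'⟩)
    · grind
    · grind
    · exact absurd e' nrg
    · refine ⟨p, hp, e', ?_⟩
      have := pr _ _ hp
      have := pr _ _ e'
      have := col p
      grind
    · grind
    · exact absurd (cy.trans cg.symm) (pr _ _ e')
    · exfalso
      have h1 := pr _ _ hp
      have h2 := aty p hp
      have h3 := ay p hp
      rcases col p with cp | cp | cp
      · have := h2 (cp.trans ct.symm)
        subst this; exact ntg e'
      · exact h1 (cy.trans cp.symm)
      · exact gy (h3 cp g e' (cg.trans cy.symm))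
  -- The new child `s'` of `r` has its own return path to `z`, which must use the same `t` because
  -- `z` has degree two.
  obtain ⟨t', y', hzt', hty', hys', ct', cy', yz'⟩ := hb.exists_t h hd hrs' cs'
  have htt : t' = t := by
    rcases (nz t').1 hzt' with e' | e'
    · grind
    · exact e'
  subst htt
  have gy' : y' ≠ g := by rintro rfl; exact ntg hty'
  have as' := h.arc_of_two hys'.symm hsg' gy' (cy'.trans cg.symm)
  have ay' := (h.arc_of_two hsg' hys'.symm gy'.symm (cg.trans cy'.symm))
  have aty' := at' y' hty' cy'
  have ny' : ∀ v, G.Adj y' v → v = t' ∨ v = s' := by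
    intro v hv
    have := pr _ _ hv
    have := aty' v hv
    have := as' v hv
    have := col v
    grind
  have nws : ¬ G.Adj w s' := fun e' => wr (root s' hrs' w e'.symm cw)
  -- The vertices `y'` and `f` both have degree two, and no path of length at most three joins them.
  rcases within_two_of_deg_two hd ny' f with e' | (e' | e' | ⟨p, hp, e'⟩) | (e' | e' | ⟨p, hp, e'⟩)
  · subst e'; exact n3 (cf.symm.trans cy')
  · subst e'; exact n2 (cf.symm.trans ct)
  · rcases nf _ e'.symm with e1 | e1
    · subst e1; exact n1 (cn.symm.trans ct)
    · exact wt e1.symm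
  · rcases nf _ e'.symm with e1 | e1
    · subst e1; exact ntn hp
    · subst e1; exact pr _ _ hp (ct.trans cw.symm)
  · subst e'
    exact nws hfw
  · exact pr _ _ e' (cs'.trans cf.symm)
  · rcases nf _ e'.symm with e1 | e1
    · subst e1
      have an' := an s' hp.symm cs'
      have := h.arc p s' hp.symm
      grind [Arc]
    · subst e1; exact nws hp.symm

end Root

/-! ### Further roots on the `7`-cycle. -/

section Root

variable {V : Type*} {G : SimpleGraph V} {c : V → Fin 3}
variable (h : IsStar G c) (hd : DiamLeThree G)
  (hmono : ∀ r, IsRoot G c r → ∀ j, j ≠ c r → ∃ x, G.Adj r x ∧ c x = j)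
  (hgood : ∀ r, IsRoot G c r → ∃ v, ¬ WithinTwo G r v ∧ c v ≠ c r)
  {r x q z : V} (hb : Bad G c r x q z)

include h hd hmono hgood hb in
-- If not, some `w` of the colour of `r` is the parent of `q` and has another child `f` coloured
-- like `q`. The vertex `y` has degree two with neighbours `t` and `s`, and `f` is within two of
-- neither.
theorem Bad.root_q : IsRoot G c q := by
  by_contra hq
  obtain ⟨w, hw, haw⟩ : ∃ w, G.Adj q w ∧ ¬ Arc G c q w := by simpa [IsRoot] using hq
  obtain ⟨qx, qr, nrq, xz, n1, n2, n3, cz⟩ := hb.basic h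
  have pr := h.proper
  have col := fun v => fin_three_cases n1.symm n2.symm n3.symm (c v)
  have aq := hb.arc_q h
  have root := hb.root
  obtain ⟨f, hwf, cf, fq⟩ := exists_two_of_not_arc haw
  have cw : c w = c r := by
    have := pr _ _ hw
    have := aq w hw
    have := col w
    grind
  have awq : Arc G c w q := (h.arc q w hw).resolve_left haw
  have awf : Arc G c w f := h.arc_of_two hwf hw.symm fq cf
  have wr : w ≠ r := by rintro rfl; exact nrq hw.symm
  obtain ⟨s, hs, cs⟩ := hmono r root (c q) n2
  obtain ⟨t, y, zt, ty, ys, ct, cy, yz⟩ := hb.exists_t h hd hs cs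
  have ht : Tail G c r x z t y := ⟨zt, ty, ct, cy, yz⟩
  have ntq := ht.not_adj h hd hgood hb
  have at' := ht.arc_t h hb
  have aty := at' y ty cy
  have nz := fun v => (ht.nbr_z h hb v)
  have nx := fun v => (hb.nbr_x h v)
  have uk := ht.unique_k h hd hmono hgood hb hs cs ys
  have tr : t ≠ r := by
    rintro rfl; exact hb.far (Or.inr (Or.inl zt.symm))
  have wt : w ≠ t := by rintro rfl; exact ntq hw.symm
  have ny : ∀ v, G.Adj y v → v = t ∨ v = s := by
    intro v hv
    have := pr _ _ hv
    have := aty v hv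
    have := uk v hv
    have := col v
    grind
  have fi : ∀ v, G.Adj f v → c v = c r → v = w := fun v hv cv => awf v hv (cv.trans cw.symm)
  rcases within_two_of_deg_two hd ny f with e' | (e' | e' | ⟨p, hp, e'⟩) | (e' | e' | ⟨p, hp, e'⟩)
  · subst e'; exact n3 (cf.symm.trans cy)
  · subst e'; exact n2 (cf.symm.trans ct)
  · exact wt (fi t e'.symm ct).symm
  · have cp : c p = c x := by
      have := pr _ _ hp
      have := pr _ _ e'
      have := col p
      grind
    have atp := at' p hp cp
    rcases within_two_of_deg_two hd (fun v => (nx v).1) p with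
      e | (e | e | ⟨p', hp', e⟩) | (e | e | ⟨p', hp', e⟩)
    · subst e
      rcases (nx t).1 hp.symm with e1 | e1
      · exact tr e1
      · exact n2 (by rw [← e1, ct])
    · subst e; exact n1 cp.symm
    · exact tr (root p e t hp.symm ct)
    · have cp' : c p' = c q := by
        have h1 := pr _ _ hp'
        have h2 := pr _ _ e
        have := col p'
        grind
      have pz : p ≠ z := by
        rintro rfl
        rcases (nz f).1 e' with e1 | e1
        · exact fq e1
        · exact n2 (by rw [← cf, e1, ct])
      have := Tail.unique_k h hd hmono hgood hb (y := p) ⟨zt, hp, ct, cp, pz⟩ hp' cp' e.symm f e' cf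
      subst this
      exact wr (root f hp' w hwf.symm cw)
    · subst e; exact n3 cp
    · exact fq (aq p e cp f e' cf)
    · have h1 := pr _ _ hp'
      have h2 := pr _ _ e
      have h3 : c p' = c r := by
        have := col p'
        grind
      have := awq p' hp' (h3.trans cw.symm)
      subst this
      exact wt (atp p' e.symm (cw.trans ct.symm))
  · subst e'; exact wr (root s hs w hwf.symm cw)
  · exact pr _ _ e' (cs.trans cf.symm)
  · rcases col p with cp | cp | cp
    · have := root s hs p hp cp
      subst this
      exact wr (fi p e'.symm rfl).symm
    · by_cases e : p = y
      · subst e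
        have := uk f e' cf
        subst this; exact wr (root f hs w hwf.symm cw)
      · have := h.arc_of_two hp ys.symm e (cp.trans cy.symm) f e' (cf.trans cs.symm)
        subst this; exact wr (root f hs w hwf.symm cw)
    · exact pr _ _ hp (cs.trans cp.symm)

include h hd hmono hgood hb in
/-- The vertices around a root with a vertex that is far from it and has another colour. -/
theorem Bad.exists_tail : ∃ t, ¬ G.Adj t q ∧ G.Adj z t ∧ c t = c r ∧ (∀ v, G.Adj z v → v = q ∨ v = t) ∧
    ∀ s, G.Adj r s → c s = c q → ∃ y, c y = c x ∧ y ≠ z ∧ G.Adj t y ∧ G.Adj y s ∧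
      ∀ v, G.Adj y v → v = t ∨ v = s := by
  obtain ⟨qx, qr, nrq, xz, n1, n2, n3, cz⟩ := hb.basic h
  have pr := h.proper
  have col := fun v => fin_three_cases n1.symm n2.symm n3.symm (c v)
  obtain ⟨s, hs, cs⟩ := hmono r hb.root (c q) n2
  obtain ⟨t, y, zt, ty, ys, ct, cy, yz⟩ := hb.exists_t h hd hs cs
  have ht : Tail G c r x z t y := ⟨zt, ty, ct, cy, yz⟩
  have nz := fun v => (ht.nbr_z h hb v)
  refine ⟨t, ht.not_adj h hd hgood hb, zt, ct, fun v => (nz v).1, fun s' hs' cs' => ?_⟩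
  obtain ⟨t', y', zt', ty', ys', ct', cy', yz'⟩ := hb.exists_t h hd hs' cs'
  have ht' : Tail G c r x z t' y' := ⟨zt', ty', ct', cy', yz'⟩
  have : t' = t := by
    rcases (nz t').1 zt' with e | e
    · exact absurd ct' (by rw [e]; exact n2)
    · exact e
  subst this
  refine ⟨y', cy', yz', ty', ys', fun v hv => ?_⟩
  have := pr _ _ hv
  have := ht'.arc_t h hb y' ty' cy' v hv
  have := ht'.unique_k h hd hmono hgood hb hs' cs' ys' v hv
  have := col v
  grind

end Root

/-! ### Colour classes as functions of two distances. -/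

section Levels

variable {V : Type*} {G : SimpleGraph V} {c : V → Fin 3}

open Classical in
/-- The distance from `a` to `v`, cut off at three. -/
noncomputable def lev (G : SimpleGraph V) (a v : V) : ℕ :=
  if a = v then 0 else if G.Adj a v then 1 else if ∃ p, G.Adj a p ∧ G.Adj p v then 2 else 3

theorem lev_le (a v : V) : lev G a v ≤ 3 := by
  unfold lev; split_ifs <;> omega

theorem lev_eq_zero {a v : V} : lev G a v = 0 ↔ a = v := by
  unfold lev; split_ifs <;> simp_all

theorem lev_eq_one {a v : V} : lev G a v = 1 ↔ G.Adj a v := by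
  unfold lev; split_ifs <;> simp_all

theorem lev_eq_two {a v : V} : lev G a v = 2 ↔ WithinTwo G a v ∧ a ≠ v ∧ ¬ G.Adj a v := by
  unfold lev WithinTwo; split_ifs <;> simp_all

theorem lev_eq_three {a v : V} : lev G a v = 3 ↔ ¬ WithinTwo G a v := by
  unfold lev WithinTwo; split_ifs <;> simp_all

/-- Four ways to choose a set of vertices (those with value `0`) from the distances to the two ends
of an edge. -/
def pattern (τ x y : ℕ) : ℕ :=
  if τ < 1 then
    if x < 1 then 0 else if x < 3 then 1 else 0
  else if τ < 2 then
    if x < 2 then 1 else if x < 3 then 0 else 1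
  else if τ < 3 then
    if x < 1 then 0 else if x < 3 then 1 else if y < 2 then 1 else if y < 3 then 0 else 1
  else
    if x < 1 then 1 else if x < 2 then (if y < 1 then 1 else 0) else
      if x < 3 then 1 else if y < 2 then 1 else if y < 3 then 0 else 1

theorem pattern_zero {x y : ℕ} (hx : x ≤ 3) : pattern 0 x y = 0 ↔ x = 0 ∨ x = 3 := by
  unfold pattern; grind

theorem pattern_one {x y : ℕ} : pattern 1 x y = 0 ↔ x = 2 := by
  unfold pattern; grind

theorem pattern_two {x y : ℕ} (hx : x ≤ 3) :
    pattern 2 x y = 0 ↔ x = 0 ∨ x = 3 ∧ y = 2 := by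
  unfold pattern; grind

theorem pattern_three {x y : ℕ} (hx : x ≤ 3) :
    pattern 3 x y = 0 ↔ x = 1 ∧ y ≠ 0 ∨ x = 3 ∧ y = 2 := by
  unfold pattern; grind

/-- Every vertex is `y` or within two of `t` or `s`, as `y` has degree two. The colour of `r` is
also that of the root `t`, so within two of `t` it occurs only at `t`, which is itself within two of
`s`. Conversely, the middle vertex on the way from `s` to such a `v` is a child of `s`, which leaves
only the colour of `r` for `v`. -/
theorem IsStar.far_class (h : IsStar G c) (hd : DiamLeThree G) {r s t y : V} (hr : IsRoot G c r)
    (ht : IsRoot G c t) (hs : G.Adj r s) (ct : c t = c r) (ty : G.Adj t y) (ys : G.Adj y s)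
    (ny : ∀ v, G.Adj y v → v = t ∨ v = s) (cyr : c y ≠ c r)
    (ha : ∀ v, G.Adj s v → c v = c y → Arc G c s v) (v : V) :
    c v = c r ↔ r = v ∨ (¬ WithinTwo G r v ∧ WithinTwo G s v ∧ s ≠ v ∧ ¬ G.Adj s v) := by
  have pr := h.proper
  have n1 := pr _ _ hs
  have n2 := pr _ _ ys
  constructor
  · intro cv
    by_cases e : r = v
    · exact Or.inl e
    refine Or.inr ⟨?_, ?_, ?_, ?_⟩
    · rintro (e' | e' | ⟨p, hp, hpv⟩)
      · exact e e'
      · exact pr _ _ e' cv.symm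
      · exact e (hr p hp v hpv cv).symm
    · rcases within_two_of_deg_two hd ny v with e' | (e' | e' | ⟨p, hp, e'⟩) | e'
      · subst e'; exact absurd cv cyr
      · subst e'; exact Or.inr (Or.inr ⟨y, ys.symm, ty.symm⟩)
      · exact absurd (ct.trans cv.symm) (pr _ _ e')
      · have := ht p hp v e' (cv.trans ct.symm)
        subst this; exact Or.inr (Or.inr ⟨y, ys.symm, ty.symm⟩)
      · exact e'
    · rintro rfl; exact n1 cv.symm
    · intro e'; exact e (hr s hs v e' cv).symm
  · rintro (rfl | ⟨h1, h2 | h2 | ⟨p, hp, hpv⟩, h3, h4⟩)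
    · rfl
    · exact absurd h2 h3
    · exact absurd h2 h4
    · have hpr : c p ≠ c r := by
        intro e
        have := hr s hs p hp e
        subst this; exact h1 (Or.inr (Or.inl hpv))
      have cp : c p = c y := fin_three_eq n1 cyr.symm n2.symm hpr (pr _ _ hp).symm
      have ap := ha p hp cp v hpv
      exact fin_three_eq n2 cyr n1.symm (fun e => pr _ _ hpv (cp.trans e.symm))
        (fun e => h3 (ap e).symm)

/-- Some colour class of a star `3`-colouring is given by the distances to the ends of an edge. -/
theorem IsStar.exists_pattern (h : IsStar G c) (hd : DiamLeThree G) {u v : V} (huv : G.Adj u v) :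
    ∃ a b, G.Adj a b ∧ ∃ τ < 4, ∃ i, ∀ v, c v = i ↔ pattern τ (lev G a v) (lev G b v) = 0 := by
  have hnbr : ∀ r, ∃ x, G.Adj r x := by
    intro r
    rcases hd r u with e | ⟨p, hp, -⟩
    · subst e; exact ⟨v, huv⟩
    · exact ⟨p, hp⟩
  by_cases hn : ∀ r, ¬ IsRoot G c r
  · obtain ⟨t₀, t₁, t₂, f0, f1, f2⟩ := h.exists_fans hd hn u
    refine ⟨t₁, t₀, f1.1.symm, 3, by norm_num, c t₂, fun v => ?_⟩
    rw [pattern_three (lev_le _ _), h.triangle hd f0 f1 f2, lev_eq_one, lev_eq_three, lev_eq_two]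
    simp only [ne_eq, lev_eq_zero]
  by_cases hgood : ∀ r, IsRoot G c r → ∃ v, ¬ WithinTwo G r v ∧ c v ≠ c r
  swap
  · push Not at hgood
    obtain ⟨r, hr, hg⟩ := hgood
    obtain ⟨x, hx⟩ := hnbr r
    -- The rule depends on `r` alone; the neighbour `x` only makes up an edge, since the search runs
    -- over edges.
    refine ⟨r, x, hx, 0, by norm_num, c r, fun v => ?_⟩
    rw [pattern_zero (lev_le _ _), h.good_root hr hg, lev_eq_three, lev_eq_zero]
  by_cases hmono : ∀ r, IsRoot G c r → ∀ j, j ≠ c r → ∃ x, G.Adj r x ∧ c x = j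
  swap
  · push Not at hmono
    obtain ⟨r, hr, k, hk, hm⟩ := hmono
    obtain ⟨x, hx⟩ := hnbr r
    refine ⟨r, x, hx, 1, by norm_num, k, fun v => ?_⟩
    rw [pattern_one, h.mono_root hd hr (h.proper _ _ hx) hk.symm (hm x hx)
      (fun y hy => fin_three_eq hk.symm (h.proper _ _ hx) (hm x hx).symm
        (h.proper _ _ hy).symm (hm y hy)), lev_eq_two]
  push Not at hn
  obtain ⟨r, hr⟩ := hn
  obtain ⟨z, far, cz⟩ := hgood r hr
  obtain ⟨x, q, hb⟩ : ∃ x q, Bad G c r x q z := by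
    rcases hd r z with e | ⟨x, hx, e | e | ⟨q, hq, hz⟩⟩
    · exact absurd (Or.inl e) far
    · exact absurd (Or.inr (Or.inl (e ▸ hx))) far
    · exact absurd (Or.inr (Or.inr ⟨x, hx, e⟩)) far
    · exact ⟨x, q, hr, hx, hq, hz, far, cz⟩
  obtain ⟨qx, qr, nrq, xz, n1, n2, n3, cz⟩ := hb.basic h
  have pr := h.proper
  obtain ⟨w, hw, cw⟩ := hb.exists_w h hmono
  obtain ⟨t, ntq, zt, ct, nz, hs⟩ := hb.exists_tail h hd hmono hgood
  obtain ⟨s, hrs, cs⟩ := hmono r hr (c q) n2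
  obtain ⟨y, cy, yz, ty, ys, ny⟩ := hs s hrs cs
  -- The configuration rotates along the cycle: `q z t y` is a bad path at the root `q`, so that the
  -- same lemmas apply again and make `t` a root.
  have hb' : Bad G c q z t y := by
    refine ⟨hb.root_q h hd hmono hgood, hb.qz, zt, ty, ?_, by rw [cy]; exact n3.symm⟩
    rintro (e | e | ⟨p, hp, hpy⟩)
    · exact n3 (by rw [e, cy])
    · have := hb.arc_q h y e cy s ys cs
      subst this; exact nrq hrs
    · rcases ny p hpy.symm with rfl | rfl
      · exact ntq hp.symm
      · exact pr _ _ hp cs.symm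
  have ht := hb'.root_q h hd hmono hgood
  obtain ⟨s', ns't, ys', cs', ny', hs'⟩ := hb'.exists_tail h hd hmono hgood
  have : s' = s := by
    rcases ny s' ys' with e | e
    · subst e; exact absurd (cs'.symm.trans ct) n2
    · exact e
  subst this
  -- The tail of the rotated path gives `s'` a second neighbour coloured like `y`, so `s'` is the
  -- centre of all its neighbours of that colour.
  obtain ⟨y1, cy1, y1y, sy1, -, -⟩ := hs' w hw (cw.trans ct.symm)
  have cyy : c y1 = c y := by rw [cy1, cz, cy]
  refine ⟨r, s', hrs, 2, by norm_num, c r, fun v => ?_⟩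
  rw [pattern_two (lev_le _ _), lev_eq_zero, lev_eq_three, lev_eq_two]
  refine h.far_class hd hr ht hrs ct ty ys ny (by rw [cy]; exact n1) (fun v hv cv => ?_) v
  by_cases e : v = y
  · subst e; exact h.arc_of_two hv sy1 y1y.symm cyy.symm
  · exact h.arc_of_two hv ys.symm e cv

end Levels

/-! ### The local description agrees with the definition of star colourings. -/

section Bridge

variable {V : Type*} {G : SimpleGraph V}

/-- An edge without an arc extends at both ends to a two-coloured path on four vertices. It is an
induced `P₄`, or its ends are adjacent and it closes to a `4`-cycle. -/
theorem IsStarColouring.isStar {c : G.Coloring (Fin 3)} (h : IsStarColouring G c) :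
    IsStar G c := by
  refine ⟨fun u v huv => c.valid huv, fun u v huv => ?_⟩
  by_contra hn
  push Not at hn
  obtain ⟨x, hvx, cx, xu⟩ := exists_two_of_not_arc hn.1
  obtain ⟨y, huy, cy, yv⟩ := exists_two_of_not_arc hn.2
  have nuv := c.valid huv
  obtain ⟨h1, h2⟩ := h (c u) (c v) nuv
  set H := G.induce {w | c w = c u ∨ c w = c v} with hH
  let u' : {w | c w = c u ∨ c w = c v} := ⟨u, Or.inl rfl⟩
  let v' : {w | c w = c u ∨ c w = c v} := ⟨v, Or.inr rfl⟩
  let x' : {w | c w = c u ∨ c w = c v} := ⟨x, Or.inl cx⟩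
  let y' : {w | c w = c u ∨ c w = c v} := ⟨y, Or.inr cy⟩
  have a1 : H.Adj u' v' := huv
  have a2 : H.Adj v' x' := hvx
  have a3 : H.Adj u' y' := huy
  have nyx : y ≠ x := by rintro rfl; exact nuv (cx.symm.trans cy)
  have nux : u' ≠ x' := fun e => xu (congrArg Subtype.val e).symm
  by_cases hyx : G.Adj y x
  · have a4 : H.Adj y' x' := hyx
    let p1 : H.Walk u' x' := .cons a1 (.cons a2 .nil)
    let p2 : H.Walk u' x' := .cons a3 (.cons a4 .nil)
    have hp1 : p1.IsPath := by
      simp [p1, SimpleGraph.Walk.cons_isPath_iff, a1.ne, a2.ne, nux]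
    have hp2 : p2.IsPath := by
      simp [p2, SimpleGraph.Walk.cons_isPath_iff, a3.ne, a4.ne, nux]
    have := (SimpleGraph.isAcyclic_iff_subsingleton_path.1 h1 u' x').elim ⟨p1, hp1⟩ ⟨p2, hp2⟩
    have := congrArg (fun p : H.Path u' x' => p.1.support) this
    simp only [p1, p2, SimpleGraph.Walk.support_cons, List.cons.injEq, true_and] at this
    exact yv (congrArg Subtype.val this.1).symm
  · refine h2 ⟨⟨⟨![y', u', v', x'], ?_⟩, ?_⟩⟩
    · have e1 := a1.ne
      have e2 := a2.ne
      have e3 := a3.ne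
      have e4 : y' ≠ x' := fun e => nyx (congrArg Subtype.val e)
      have e5 : y' ≠ v' := fun e => yv (congrArg Subtype.val e)
      clear_value u' v' x' y'
      intro a b hab
      have key : a ≠ b → ![y', u', v', x'] a ≠ ![y', u', v', x'] b := by
        fin_cases a <;> fin_cases b <;>
          simp [e1, e2, e3, e4, e5, nux, e1.symm, e2.symm, e3.symm, e4.symm, e5.symm, nux.symm]
      by_contra hne
      exact key hne hab
    · have b0 : ¬ H.Adj y' x' := hyx
      have b1 : ¬ H.Adj y' v' := fun e => c.valid e cy
      have b2 : ¬ H.Adj u' x' := fun e => c.valid e cx.symm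
      intro a b
      change H.Adj (![y', u', v', x'] a) (![y', u', v', x'] b) ↔ _
      clear_value u' v' x' y' H
      fin_cases a <;> fin_cases b <;>
        simp [SimpleGraph.pathGraph_adj, a1, a2, a3, b0, b1, b2, a1.symm, a2.symm, a3.symm,
          H.adj_comm x' y', H.adj_comm v' y', H.adj_comm x' u']

theorem IsStar.isStarColouring {c : G.Coloring (Fin 3)} (h : IsStar G c) :
    IsStarColouring G c := by
  -- The path `a b d e` need not be induced, and `a = e` is allowed. This lets the same claim
  -- exclude both an induced `P₄` and the first four vertices of a cycle.
  have key : ∀ i j : Fin 3, ∀ a b d e : V, (c a = i ∨ c a = j) → (c b = i ∨ c b = j) →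
      (c d = i ∨ c d = j) → (c e = i ∨ c e = j) → G.Adj a b → G.Adj b d → G.Adj d e →
      a ≠ d → b ≠ e → False := by
    intro i j a b d e ha hb hd' he hab hbd hde nad nbe
    have n1 := h.proper _ _ hab
    have n2 := h.proper _ _ hbd
    have n3 := h.proper _ _ hde
    rcases h.arc b d hbd with h1 | h1
    · exact nbe (h1 e hde (by grind)).symm
    · exact nad (h1 a hab.symm (by grind))
  refine fun i j _ => ⟨fun v p hp => ?_, fun ⟨f⟩ => ?_⟩
  · have h3 := hp.three_le_length
    have inj := hp.getVert_injOn
    have n1 : p.getVert 1 ≠ p.getVert 3 := fun e => by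
      have := inj ⟨le_rfl, by omega⟩ ⟨by norm_num, h3⟩ e
      omega
    have n2 : p.getVert 0 ≠ p.getVert 2 := fun e => by
      rw [p.getVert_zero] at e
      have := inj (x₁ := p.length) ⟨by omega, le_rfl⟩ (x₂ := 2) ⟨by norm_num, by omega⟩
        (by rw [p.getVert_length, ← e])
      omega
    exact key i j _ _ _ _ (p.getVert 0).2 (p.getVert 1).2 (p.getVert 2).2 (p.getVert 3).2
      (p.adj_getVert_succ (i := 0) (by omega)) (p.adj_getVert_succ (i := 1) (by omega))
      (p.adj_getVert_succ (i := 2) (by omega)) (fun e => n2 (Subtype.ext e))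
      (fun e => n1 (Subtype.ext e))
  · have ad : ∀ a b : Fin 4, a.val + 1 = b.val → G.Adj (f a) (f b) := fun a b hab =>
      f.map_rel_iff.2 (SimpleGraph.pathGraph_adj.2 (Or.inl hab))
    have ne : ∀ a b : Fin 4, a ≠ b → (f a : V) ≠ f b := fun a b hab e =>
      hab (f.injective (Subtype.ext e))
    exact key i j (f 0) (f 1) (f 2) (f 3) (f 0).2 (f 1).2 (f 2).2 (f 3).2 (ad _ _ rfl)
      (ad _ _ rfl) (ad _ _ rfl) (ne _ _ (by decide)) (ne _ _ (by decide))

theorem starColourable_three_iff : StarColourable G 3 ↔ ∃ c : V → Fin 3, IsStar G c := by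
  constructor
  · rintro ⟨c, hc⟩
    exact ⟨c, hc.isStar⟩
  · rintro ⟨c, hc⟩
    exact ⟨SimpleGraph.Coloring.mk c fun {u v} => hc.proper u v,
      IsStar.isStarColouring (c := SimpleGraph.Coloring.mk c fun {u v} => hc.proper u v) hc⟩

theorem diamLeThree_of_ediam_le (h : G.ediam ≤ 3) : DiamLeThree G := by
  intro a v
  have h1 : G.edist a v ≤ 3 := SimpleGraph.edist_le_ediam.trans h
  have h2 : G.edist a v ≠ ⊤ := ne_top_of_le_ne_top (by decide) h1
  obtain ⟨p, hp⟩ := SimpleGraph.exists_walk_of_edist_ne_top h2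
  rw [← hp] at h1
  have h3 : p.length ≤ 3 := by exact_mod_cast h1
  clear hp h1 h2
  cases p with
  | nil => exact Or.inl rfl
  | cons e p =>
    refine Or.inr ⟨_, e, ?_⟩
    cases p with
    | nil => exact Or.inl rfl
    | cons e p =>
      cases p with
      | nil => exact Or.inr (Or.inl e)
      | cons e' p =>
        cases p with
        | nil => exact Or.inr (Or.inr ⟨_, e, e'⟩)
        | cons e p => simp only [SimpleGraph.Walk.length_cons] at h3; omega

end Bridge

/-! ### Reasoning about random access machine programs -/

section Ram

/-- From `s`, the program `p` halts within `T` steps in a state with the property `Q`. -/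
def Runs (B : ℕ) (p : RamProg) (s : RamState) (T : ℕ) (Q : RamState → Prop) : Prop :=
  ∃ s' t, RamExec B p s s' t ∧ t ≤ T ∧ Q s'

variable {B T T' T₁ T₂ : ℕ} {p q : RamProg} {s : RamState} {Q R : RamState → Prop}

theorem Runs.mono (h : Runs B p s T Q) (hT : T ≤ T') (hQ : ∀ s', Q s' → R s') :
    Runs B p s T' R := by
  obtain ⟨s', t, h1, h2, h3⟩ := h
  exact ⟨s', t, h1, h2.trans hT, hQ s' h3⟩

theorem Runs.seq (h : Runs B p s T₁ Q) (h' : ∀ s', Q s' → Runs B q s' T₂ R) :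
    Runs B (.seq p q) s (T₁ + T₂) R := by
  obtain ⟨s', t, h1, h2, h3⟩ := h
  obtain ⟨s'', t', h4, h5, h6⟩ := h' s' h3
  exact ⟨s'', t + t', .seq h1 h4, Nat.add_le_add h2 h5, h6⟩

@[simp] theorem RamState.reg_setReg (s : RamState) (d v r : ℕ) :
    (s.setReg d v).reg r = if r = d then v else s.reg r := by
  simp [RamState.setReg, Function.update_apply]

@[simp] theorem RamState.arr_setReg (s : RamState) (d v : ℕ) : (s.setReg d v).arr = s.arr := rfl

@[simp] theorem RamState.reg_setArr (s : RamState) (a i v : ℕ) :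
    (s.setArr a i v).reg = s.reg := rfl

@[simp] theorem RamState.arr_setArr (s : RamState) (a i v b j : ℕ) :
    (s.setArr a i v).arr b j = if b = a then if j = i then v else s.arr b j else s.arr b j := by
  simp only [RamState.setArr, Function.update_apply]
  split_ifs <;> simp_all

/-- The register that an instruction writes. -/
def RamInstr.wregs : RamInstr → List ℕ
  | .const d _ | .copy d _ | .add d _ _ | .sub d _ _ | .mul d _ _ | .load d _ _ => [d]
  | .store _ _ _ => []

/-- The array that an instruction writes. -/
def RamInstr.warrs : RamInstr → List ℕ
  | .store a _ _ => [a]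
  | _ => []

/-- The registers that a program may write. -/
def RamProg.wregs : RamProg → List ℕ
  | .skip => []
  | .instr I => I.wregs
  | .seq p q | .ite _ _ p q => p.wregs ++ q.wregs
  | .loop _ _ p => p.wregs

/-- The arrays that a program may write. -/
def RamProg.warrs : RamProg → List ℕ
  | .skip => []
  | .instr I => I.warrs
  | .seq p q | .ite _ _ p q => p.warrs ++ q.warrs
  | .loop _ _ p => p.warrs

theorem RamExec.reg_eq {s s' : RamState} {t : ℕ} (h : RamExec B p s s' t) {r : ℕ}
    (hr : r ∉ p.wregs) : s'.reg r = s.reg r := by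
  induction h with
  | skip => rfl
  | instr I s =>
    cases I <;> simp_all [RamProg.wregs, RamInstr.wregs, RamInstr.exec]
  | seq _ _ ih1 ih2 => simp_all [RamProg.wregs]
  | ite_true _ _ ih => simp_all [RamProg.wregs]
  | ite_false _ _ ih => simp_all [RamProg.wregs]
  | loop_done => rfl
  | loop_step _ _ _ ih1 ih2 => simp_all [RamProg.wregs]

theorem RamExec.arr_eq {s s' : RamState} {t : ℕ} (h : RamExec B p s s' t) {a : ℕ}
    (ha : a ∉ p.warrs) : s'.arr a = s.arr a := by
  induction h with
  | skip => rfl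
  | instr I s =>
    funext j
    cases I <;> simp_all [RamProg.warrs, RamInstr.warrs, RamInstr.exec]
  | seq _ _ ih1 ih2 => simp_all [RamProg.warrs]
  | ite_true _ _ ih => simp_all [RamProg.warrs]
  | ite_false _ _ ih => simp_all [RamProg.warrs]
  | loop_done => rfl
  | loop_step _ _ _ ih1 ih2 => simp_all [RamProg.warrs]

/-- Whatever the program text does not write persists, so specifications need to mention only what
changes. -/
theorem Runs.frame (h : Runs B p s T Q) :
    Runs B p s T fun s' => Q s' ∧ (∀ r ∉ p.wregs, s'.reg r = s.reg r) ∧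
      ∀ a ∉ p.warrs, s'.arr a = s.arr a := by
  obtain ⟨s', t, h1, h2, h3⟩ := h
  exact ⟨s', t, h1, h2, h3, fun r hr => h1.reg_eq hr, fun a ha => h1.arr_eq ha⟩

/-- The weakest precondition of a program without loops. -/
def RamProg.wp (B : ℕ) : RamProg → RamState → (RamState → Prop) → Prop
  | .skip, s, Q => Q s
  | .instr I, s, Q => I.value s ≤ B ∧ Q (I.exec s)
  | .seq p q, s, Q => p.wp B s fun s' => q.wp B s' Q
  | .ite x y p q, s, Q =>
      (s.reg x < s.reg y → p.wp B s Q) ∧ (¬ s.reg x < s.reg y → q.wp B s Q)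
  | .loop _ _ _, _, _ => False

/-- A bound for the running time of a program without loops. -/
def RamProg.cost : RamProg → ℕ
  | .skip | .instr _ => 1
  | .seq p q => p.cost + q.cost
  | .ite _ _ p q => max p.cost q.cost + 1
  -- A dummy value: the precondition of a loop is `False`.
  | .loop _ _ _ => 0

theorem Runs.of_wp (h : p.wp B s Q) : Runs B p s p.cost Q := by
  induction p generalizing s Q with
  | skip => exact ⟨s, 1, .skip s, le_rfl, h⟩
  | instr I => exact ⟨_, 1, .instr I s h.1, le_rfl, h.2⟩
  | seq p q ihp ihq => exact (ihp h).seq fun s' h' => ihq h'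
  | ite x y p q ihp ihq =>
    by_cases hx : s.reg x < s.reg y
    · obtain ⟨s', t, h1, h2, h3⟩ := ihp (h.1 hx)
      exact ⟨s', t + 1, .ite_true hx h1, by simp only [RamProg.cost]; omega, h3⟩
    · obtain ⟨s', t, h1, h2, h3⟩ := ihq (h.2 hx)
      exact ⟨s', t + 1, .ite_false hx h1, by simp only [RamProg.cost]; omega, h3⟩
  | loop => exact h.elim

theorem Runs.ite_true {x y : ℕ} (hx : s.reg x < s.reg y) (h : Runs B p s T Q) :
    Runs B (.ite x y p q) s (T + 1) Q := by
  obtain ⟨s', t, h1, h2, h3⟩ := h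
  exact ⟨s', t + 1, .ite_true hx h1, Nat.succ_le_succ h2, h3⟩

theorem Runs.ite_false {x y : ℕ} (hx : ¬ s.reg x < s.reg y) (h : Runs B q s T Q) :
    Runs B (.ite x y p q) s (T + 1) Q := by
  obtain ⟨s', t, h1, h2, h3⟩ := h
  exact ⟨s', t + 1, .ite_false hx h1, Nat.succ_le_succ h2, h3⟩

theorem Runs.loop {x y N : ℕ} (I : ℕ → RamState → Prop)
    (hx : ∀ k s, I k s → s.reg x = k ∧ s.reg y = N)
    (hp : ∀ k < N, ∀ s, I k s → Runs B p s T (I (k + 1))) (h0 : I 0 s) :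
    Runs B (.loop x y p) s (N * (T + 1) + 1) (I N) := by
  have key : ∀ d k s, k + d = N → I k s → Runs B (.loop x y p) s (d * (T + 1) + 1) (I N) := by
    intro d
    induction d with
    | zero =>
      intro k s hk hI
      obtain ⟨h1, h2⟩ := hx k s hI
      have : k = N := by simpa using hk
      subst this
      exact ⟨s, 1, .loop_done (by omega), by omega, hI⟩
    | succ d ih =>
      intro k s hk hI
      obtain ⟨h1, h2⟩ := hx k s hI
      obtain ⟨s', t, h3, h4, h5⟩ := hp k (by omega) s hI
      obtain ⟨s'', t', h6, h7, h8⟩ := ih (k + 1) s' (by omega) h5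
      refine ⟨s'', _, .loop_step (by omega) h3 h6, ?_, h8⟩
      rw [Nat.succ_mul]
      omega
  exact key N 0 s (by simp) h0

/-! ### Programs on edge lists -/

variable {n : ℕ} {es : List (Fin n × Fin n)}

/-- Both orientations of all the edges in a list. -/
def dartList (es : List (Fin n × Fin n)) : List (Fin n × Fin n) :=
  es.flatMap fun e => [e, e.swap]

/-- The registers and arrays that stay fixed: the input and a few constants. -/
structure Env (B : ℕ) (es : List (Fin n × Fin n)) (s : RamState) : Prop where
  r0 : s.reg 0 = n
  r1 : s.reg 1 = es.length
  r2 : s.reg 2 = 0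
  r3 : s.reg 3 = 1
  r4 : s.reg 4 = 2
  r5 : s.reg 5 = 3
  a0 : ∀ k (hk : k < es.length), s.arr 0 k = es[k].1
  a1 : ∀ k (hk : k < es.length), s.arr 1 k = es[k].2
  hB : 4 * n + 2 * es.length + 8 ≤ B

/-- The program leaves the fixed registers and arrays unchanged. -/
def RamProg.Safe (p : RamProg) : Prop :=
  (∀ r ∈ p.wregs, 6 ≤ r) ∧ ∀ a ∈ p.warrs, 2 ≤ a

instance (p : RamProg) : Decidable p.Safe := by unfold RamProg.Safe; infer_instance

theorem Env.congr {s s' : RamState} (he : Env B es s) (hr : ∀ r < 6, s'.reg r = s.reg r)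
    (ha : ∀ a < 2, s'.arr a = s.arr a) : Env B es s' := by
  obtain ⟨h0, h1, h2, h3, h4, h5, h6, h7, h8⟩ := he
  constructor <;> simp_all

theorem Runs.env (h : Runs B p s T Q) (hp : p.Safe) (he : Env B es s) :
    Runs B p s T fun s' => Env B es s' ∧ Q s' ∧ (∀ r ∉ p.wregs, s'.reg r = s.reg r) ∧
      ∀ a ∉ p.warrs, s'.arr a = s.arr a := by
  refine h.frame.mono le_rfl fun s' ⟨h1, h2, h3⟩ => ⟨he.congr ?_ ?_, h1, h2, h3⟩
  · exact fun r hr => h2 r fun h => by have := hp.1 r h; omega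
  · exact fun a ha => h3 a fun h => by have := hp.2 a h; omega

/-- Run `body` for each directed edge, with the two ends in the registers `u` and `v`. -/
def darts (i u v : ℕ) (body : RamProg) : RamProg :=
  .seq (.instr (.const i 0)) (.loop i 1 (.seq (.seq (.instr (.load u 0 i)) (.instr (.load v 1 i)))
    (.seq body (.seq (.seq (.instr (.load u 1 i)) (.instr (.load v 0 i)))
      (.seq body (.instr (.add i i 3)))))))

/-- The invariant sees only the arrays and one register `f`, so the bookkeeping in `i`, `u`, `v`
cannot disturb it. A round costs two runs of the body, four loads, an increment and a test. -/
theorem Runs.darts {i u v f : ℕ} (he : Env B es s) (hi : 6 ≤ i) (hu : 6 ≤ u) (hv : 6 ≤ v)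
    (hui : u ≠ i) (hvi : v ≠ i) (huv : u ≠ v) (hfi : f ≠ i) (hfu : f ≠ u) (hfv : f ≠ v)
    (hs : p.Safe) (hpi : i ∉ p.wregs)
    (J : List (Fin n × Fin n) → (ℕ → ℕ → ℕ) → ℕ → Prop) (h0 : J [] s.arr (s.reg f))
    (hJ : ∀ l d s, l ++ [d] <+: dartList es → Env B es s → J l s.arr (s.reg f) → s.reg u = d.1 →
      s.reg v = d.2 → Runs B p s T fun s' => J (l ++ [d]) s'.arr (s'.reg f)) :
    Runs B (darts i u v p) s (es.length * (2 * T + 6) + 2) fun s' =>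
      J (dartList es) s'.arr (s'.reg f) := by
  have hlen : es.length ≤ B := by have := he.hB; omega
  let I : ℕ → RamState → Prop := fun k s =>
    (s.reg i = k ∧ k ≤ es.length) ∧ Env B es s ∧ J (dartList (es.take k)) s.arr (s.reg f)
  have hI0 : I 0 (s.setReg i 0) := by
    refine ⟨by simp, he.congr (fun r hr => ?_) (fun a ha => rfl), by simpa [hfi, dartList]⟩
    rw [RamState.reg_setReg, if_neg (by omega)]
  have hloop := Runs.loop (B := B) (x := i) (y := 1) (N := es.length) (T := 2 * T + 5) (p := .seq
    (.seq (.instr (.load u 0 i)) (.instr (.load v 1 i)))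
    (.seq p (.seq (.seq (.instr (.load u 1 i)) (.instr (.load v 0 i)))
      (.seq p (.instr (.add i i 3)))))) I (fun k s h => ⟨h.1.1, h.2.1.r1⟩) ?_ hI0
  · have h1 : Runs B (.instr (.const i 0)) s 1 fun s' => s' = s.setReg i 0 :=
      Runs.of_wp (p := .instr (.const i 0)) ⟨Nat.zero_le _, rfl⟩
    refine (h1.seq (R := fun s' => J (dartList es) s'.arr (s'.reg f))
      (T₂ := es.length * (2 * T + 5 + 1) + 1) fun s' hs' => ?_).mono
      (le_of_eq (by ring)) fun _ h => h
    subst hs'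
    exact hloop.mono le_rfl fun s' h => by simpa using h.2.2
  · rintro k hk s ⟨⟨hsi, hk'⟩, he, hJk⟩
    have b1 : (es[k].1 : ℕ) ≤ B := by have := he.hB; have := es[k].1.2; omega
    have b2 : (es[k].2 : ℕ) ≤ B := by have := he.hB; have := es[k].2.2; omega
    have htk : dartList (es.take (k + 1)) = dartList (es.take k) ++ [es[k]] ++ [es[k].swap] := by
      rw [dartList, List.take_succ_eq_append_getElem hk, List.flatMap_append]; simp [dartList]
    have hpre2 : dartList (es.take k) ++ [es[k]] ++ [es[k].swap] <+: dartList es := by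
      rw [← htk]
      refine ⟨dartList (es.drop (k + 1)), ?_⟩
      rw [dartList, dartList, ← List.flatMap_append, List.take_append_drop]; rfl
    have hpre1 := (List.prefix_append (dartList (es.take k) ++ [es[k]]) [es[k].swap]).trans hpre2
    have a0 := he.a0 k hk
    have a1 := he.a1 k hk
    have s1 : Runs B (.seq (.instr (.load u 0 i)) (.instr (.load v 1 i))) s 2 fun s' =>
        Env B es s' ∧ s'.reg i = k ∧ J (dartList (es.take k)) s'.arr (s'.reg f) ∧
          s'.reg u = es[k].1 ∧ s'.reg v = es[k].2 := by
      refine Runs.of_wp (p := .seq (.instr (.load u 0 i)) (.instr (.load v 1 i))) ?_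
      simp only [RamProg.wp, RamInstr.value, RamInstr.exec, RamState.reg_setReg,
        RamState.arr_setReg, hui.symm, hvi.symm, huv, hfu, hfv, if_true, if_false, hsi, a0, a1, b1,
        b2, hJk, and_true, true_and]
      exact he.congr (fun r hr => by simp [show r ≠ u by omega, show r ≠ v by omega])
        fun a ha => rfl
    have s2 : ∀ s, Env B es s ∧ s.reg i = k ∧ J (dartList (es.take k)) s.arr (s.reg f) ∧
          s.reg u = es[k].1 ∧ s.reg v = es[k].2 → Runs B p s T fun s' =>
        Env B es s' ∧ s'.reg i = k ∧ J (dartList (es.take k) ++ [es[k]]) s'.arr (s'.reg f) := by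
      rintro s ⟨he, hsi, hJk, hsu, hsv⟩
      refine ((hJ _ _ s hpre1 he hJk hsu hsv).env hs he).mono le_rfl ?_
      rintro s' ⟨h1, h2, h3, -⟩
      exact ⟨h1, (h3 i hpi).trans hsi, h2⟩
    have s3 : ∀ s, Env B es s ∧ s.reg i = k ∧ J (dartList (es.take k) ++ [es[k]]) s.arr (s.reg f) →
        Runs B (.seq (.instr (.load u 1 i)) (.instr (.load v 0 i))) s 2 fun s' =>
        Env B es s' ∧ s'.reg i = k ∧ J (dartList (es.take k) ++ [es[k]]) s'.arr (s'.reg f) ∧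
          s'.reg u = es[k].2 ∧ s'.reg v = es[k].1 := by
      rintro s ⟨he, hsi, hJk⟩
      have a0 := he.a0 k hk
      have a1 := he.a1 k hk
      refine Runs.of_wp (p := .seq (.instr (.load u 1 i)) (.instr (.load v 0 i))) ?_
      simp only [RamProg.wp, RamInstr.value, RamInstr.exec, RamState.reg_setReg,
        RamState.arr_setReg, hui.symm, hvi.symm, huv, hfu, hfv, if_true, if_false, hsi, a0, a1, b1,
        b2, hJk, and_true, true_and]
      exact he.congr (fun r hr => by simp [show r ≠ u by omega, show r ≠ v by omega])
        fun a ha => rfl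
    have s4 : ∀ s, Env B es s ∧ s.reg i = k ∧ J (dartList (es.take k) ++ [es[k]]) s.arr (s.reg f) ∧
          s.reg u = es[k].2 ∧ s.reg v = es[k].1 → Runs B p s T fun s' =>
        Env B es s' ∧ s'.reg i = k ∧ J (dartList (es.take (k + 1))) s'.arr (s'.reg f) := by
      rintro s ⟨he, hsi, hJk, hsu, hsv⟩
      refine ((hJ _ _ s hpre2 he hJk hsu hsv).env hs he).mono le_rfl ?_
      rintro s' ⟨h1, h2, h3, -⟩
      exact ⟨h1, (h3 i hpi).trans hsi, htk ▸ h2⟩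
    have s5 : ∀ s, Env B es s ∧ s.reg i = k ∧ J (dartList (es.take (k + 1))) s.arr (s.reg f) →
        Runs B (.instr (.add i i 3)) s 1 (I (k + 1)) := by
      rintro s ⟨he, hsi, hJk⟩
      refine Runs.of_wp (p := .instr (.add i i 3)) ?_
      simp only [RamProg.wp, RamInstr.value, RamInstr.exec, hsi, he.r3]
      refine ⟨by omega, ⟨by simp, hk⟩, he.congr (fun r hr => by simp [show r ≠ i by omega])
        fun a ha => rfl, by simpa [hfi] using hJk⟩
    refine (s1.seq fun s h => (s2 s h).seq fun s h => (s3 s h).seq fun s h => (s4 s h).seq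
      fun s h => s5 s h).mono (by omega) fun _ h => h

/-- Run `body` for each vertex, with the vertex in the register `i`. -/
def verts (i : ℕ) (body : RamProg) : RamProg :=
  .seq (.instr (.const i 0)) (.loop i 0 (.seq body (.instr (.add i i 3))))

theorem Runs.verts {i : ℕ} (he : Env B es s) (hi : 6 ≤ i) (hs : p.Safe) (hpi : i ∉ p.wregs)
    (J : ℕ → RamState → Prop) (hJi : ∀ k s x, J k s → J k (s.setReg i x)) (h0 : J 0 s)
    (hJ : ∀ k < n, ∀ s, Env B es s → J k s → s.reg i = k → Runs B p s T (J (k + 1))) :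
    Runs B (verts i p) s (n * (T + 2) + 2) (J n) := by
  have hn : n ≤ B := by have := he.hB; omega
  have hI0 : (s.setReg i 0).reg i = 0 ∧ Env B es (s.setReg i 0) ∧ J 0 (s.setReg i 0) :=
    ⟨by simp, he.congr (fun r hr => by simp [show r ≠ i by omega]) fun a ha => rfl, hJi _ _ _ h0⟩
  have hloop := Runs.loop (B := B) (x := i) (y := 0) (N := n) (T := T + 1)
    (p := .seq p (.instr (.add i i 3))) (fun k s => s.reg i = k ∧ Env B es s ∧ J k s)
    (fun k s h => ⟨h.1, h.2.1.r0⟩) ?_ hI0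
  · have h1 : Runs B (.instr (.const i 0)) s 1 fun s' => s' = s.setReg i 0 :=
      Runs.of_wp (p := .instr (.const i 0)) ⟨Nat.zero_le _, rfl⟩
    refine (h1.seq (R := J n) (T₂ := n * (T + 1 + 1) + 1) fun s' hs' => ?_).mono
      (le_of_eq (by ring)) fun _ h => h
    subst hs'
    exact hloop.mono le_rfl fun s' h => h.2.2
  · rintro k hk s ⟨hsi, he, hJk⟩
    refine ((hJ k hk s he hJk hsi).env hs he).seq (T₂ := 1) ?_
    rintro s' ⟨he', h2, h3, -⟩
    refine Runs.of_wp (p := .instr (.add i i 3)) ?_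
    simp only [RamProg.wp, RamInstr.value, RamInstr.exec, h3 i hpi, hsi, he'.r3]
    exact ⟨by omega, by simp, he'.congr (fun r hr => by simp [show r ≠ i by omega])
      fun a ha => rfl, hJi _ _ _ h2⟩

end Ram

/-! ### Completing a star colouring from one known class. -/

section Solver

variable {n : ℕ} {G : SimpleGraph (Fin n)} {c : Fin n → Fin 3} {i : Fin 3}
  {col col₀ comp P : Fin n → ℕ}

/-- The edge `u v` is properly coloured, and one of its ends is the only neighbour of the other
with its colour. -/
def EdgeOk (G : SimpleGraph (Fin n)) (col : Fin n → ℕ) (u v : Fin n) : Prop :=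
  col u ≠ col v ∧ ((∀ x, G.Adj v x → col x = col u → x = u) ∨
    ∀ x, G.Adj u x → col x = col v → x = v)

theorem exists_isStar_of_edgeOk (hc : ∀ v, col v ≤ 2) (h : ∀ u v, G.Adj u v → EdgeOk G col u v) :
    ∃ c, IsStar G c := by
  refine ⟨fun v => ⟨col v, Nat.lt_succ_of_le (hc v)⟩, fun u v huv => ?_, fun u v huv => ?_⟩
  · simpa using (h u v huv).1
  · simpa [Arc] using (h u v huv).2

/-- The vertex `z` has two neighbours in the class `0`. -/
def Heavy (G : SimpleGraph (Fin n)) (col : Fin n → ℕ) (z : Fin n) : Prop :=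
  ∃ a b, a ≠ b ∧ G.Adj z a ∧ G.Adj z b ∧ col a = 0 ∧ col b = 0

/-- `P u` is `u` if `u` is outside the class `0`, and otherwise a heavy neighbour of `u`, or `n`
if there is none. -/
def Partner (G : SimpleGraph (Fin n)) (col P : Fin n → ℕ) : Prop :=
  ∀ u, (col u ≠ 0 ∧ P u = u) ∨ (col u = 0 ∧ ((P u = n ∧ ∀ z, G.Adj u z → ¬ Heavy G col z) ∨
    ∃ z : Fin n, P u = z ∧ G.Adj u z ∧ Heavy G col z))

/-- A heavy vertex has two neighbours in the class `0`, so none of them can be the centre of an edge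
to it. -/
theorem IsStar.arc_of_heavy (h : IsStar G c) (hi : ∀ v, c v = i ↔ col v = 0) {u z : Fin n}
    (hz : Heavy G col z) (huz : G.Adj u z) (hu : col u = 0) : Arc G c z u := by
  obtain ⟨a, b, hab, ha, hb, ca, cb⟩ := hz
  refine (h.arc u z huz).resolve_left fun h1 => ?_
  rw [← hi] at hu ca cb
  exact hab ((h1 a ha (ca.trans hu.symm)).trans (h1 b hb (cb.trans hu.symm)).symm)

/-- For `p = u` this is properness. Otherwise `p` is heavy and hence the parent of `u`, so no other
neighbour of `u` repeats its colour. -/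
theorem IsStar.partner_ne (h : IsStar G c) (hi : ∀ v, c v = i ↔ col v = 0)
    (hP : Partner G col P) {u v p : Fin n} (huv : G.Adj u v) (hp : P u = p) (hpv : p ≠ v) :
    c p ≠ c v ∧ col p ≠ 0 := by
  rcases hP u with ⟨h1, h2⟩ | ⟨h1, ⟨h2, -⟩ | ⟨z, h2, h3, h4⟩⟩
  · have : p = u := Fin.ext (hp.symm.trans h2)
    subst this
    exact ⟨h.proper _ _ huv, h1⟩
  · have := p.2; omega
  · have : p = z := Fin.ext (hp.symm.trans h2)
    subst this
    refine ⟨fun e => hpv (h.arc_of_heavy hi h4 h3 h1 v huv e.symm).symm, fun e => ?_⟩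
    rw [← hi] at h1 e
    exact h.proper _ _ h3 (h1.trans e.symm)

/-- A colouring that satisfies the parity constraints is a star colouring, if there is any star
colouring with the same class `0`. -/
theorem IsStar.edgeOk_of_partner (h : IsStar G c) (hi : ∀ v, c v = i ↔ col v = 0)
    (hP : Partner G col P)
    (hd : ∀ u v p : Fin n, G.Adj u v → P u = p → p ≠ v → col v ≠ 0 → col p ≠ col v)
    (u v : Fin n) (huv : G.Adj u v) : EdgeOk G col u v := by
  have pr := h.proper
  have hn : ∀ u v, G.Adj u v → col u ≠ 0 → col v ≠ 0 → col u ≠ col v := by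
    intro u v huv hu hv
    rcases hP u with ⟨h1, h2⟩ | ⟨h1, -⟩
    · exact hd u v u huv h2 huv.ne hv
    · exact absurd h1 hu
  have h0 : ∀ u v, G.Adj u v → col u = 0 → col v ≠ 0 := by
    intro u v huv hu hv
    rw [← hi] at hu hv
    exact pr _ _ huv (hu.trans hv.symm)
  have hz : ∀ u v, G.Adj u v → col u = 0 → EdgeOk G col u v := by
    intro u v huv hu
    have hv := h0 u v huv hu
    refine ⟨by omega, ?_⟩
    -- If `v` is not heavy, `u` is its only neighbour in the class `0`. If `v` is heavy, so is the
    -- partner of `u`, which may be another vertex; the constraints at the partner and the arcs of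
    -- `c` together show that `v` is unique in its colour.
    by_cases hh : Heavy G col v
    · right
      intro x hx cx
      rcases hP u with ⟨h1, -⟩ | ⟨-, ⟨-, h2⟩ | ⟨z, h2, h3, h4⟩⟩
      · exact absurd hu h1
      · exact absurd hh (h2 v huv)
      · have dz := fun w hw hzw => hd u w z hw h2 hzw (h0 u w hw hu)
        by_contra hxv
        by_cases e1 : z = v
        · subst e1; exact dz x hx (Ne.symm hxv) cx.symm
        by_cases e2 : z = x
        · subst e2; exact dz v huv e1 cx
        have az := h.arc_of_heavy hi h4 h3 hu
        have av := h.arc_of_heavy hi hh huv hu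
        have nu : ∀ w, G.Adj u w → c w ≠ i := fun w hw => mt (hi w).1 (h0 u w hw hu)
        have d1 : c v ≠ c z := fun e => e1 (az v huv e).symm
        have d2 : c x ≠ c z := fun e => e2 (az x hx e).symm
        have := av x hx (fin_three_eq (nu z h3).symm (nu v huv).symm d1.symm (nu x hx) d2)
        exact hxv this
    · left
      intro x hx cx
      by_contra hxu
      exact hh ⟨x, u, hxu, hx, huv.symm, cx.trans hu, hu⟩
  by_cases hu : col u = 0
  · exact hz u v huv hu
  by_cases hv : col v = 0
  · obtain ⟨h1, h2⟩ := hz v u huv.symm hv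
    exact ⟨h1.symm, h2.symm⟩
  have ci : ∀ x, c x ≠ i ↔ col x ≠ 0 := fun x => not_congr (hi x)
  -- Between the two unknown classes the arcs of `c` carry over, since both colourings alternate
  -- along edges outside the class `0`.
  have key : ∀ u v, G.Adj u v → col u ≠ 0 → col v ≠ 0 → Arc G c u v →
      ∀ x, G.Adj v x → col x = col u → x = u := by
    intro u v huv hu hv ha x hx cx
    have hx0 : col x ≠ 0 := by omega
    rw [← ci] at hu hv hx0
    exact ha x hx (fin_three_eq hv.symm hu.symm (pr _ _ huv.symm) hx0 (pr _ _ hx).symm)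
  exact ⟨hn u v huv hu hv, (h.arc u v huv).imp (key u v huv hu hv) (key v u huv.symm hv hu)⟩

/-- The colours of the vertices in a component are right up to a swap. -/
def Agrees (c : Fin n → Fin 3) (col comp : Fin n → ℕ) : Prop :=
  ∀ u v, col u ≠ 0 → col v ≠ 0 → comp u = comp v → (col u = col v ↔ c u = c v)

/-- The colours after the merge of the components of `p` and `q`. -/
def mergeCol (p q : Fin n) (col comp : Fin n → ℕ) (w : Fin n) : ℕ :=
  if comp w = comp q ∧ 0 < col w ∧ col p = col q then 3 - col w else col w

/-- The components after the merge of the components of `p` and `q`. -/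
def mergeComp (p q : Fin n) (col comp : Fin n → ℕ) (w : Fin n) : ℕ :=
  if comp w = comp q ∧ 0 < col w then comp p else comp w

theorem mergeCol_le {p q : Fin n} (hc : ∀ v, col v ≤ 2) (w : Fin n) :
    mergeCol p q col comp w ≤ 2 ∧ (mergeCol p q col comp w = 0 ↔ col w = 0) := by
  have := hc w
  unfold mergeCol; split_ifs <;> omega

/-- Outside the class `0` only two colours of `c` remain, so swapping the component of `q` when `col
p = col q` aligns it with that of `p`. -/
theorem Agrees.merge {p q : Fin n} (h : Agrees c col comp) (hi : ∀ v, c v = i ↔ col v = 0)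
    (hc : ∀ v, col v ≤ 2) (hp : col p ≠ 0) (hq : col q ≠ 0) (hpq : c p ≠ c q) :
    Agrees c (mergeCol p q col comp) (mergeComp p q col comp) := by
  have ci : ∀ x, col x ≠ 0 → c x = c p ∨ c x = c q := by
    intro x hx
    by_contra hn
    push Not at hn
    have h3 := mt (hi x).1 hx
    exact hn.2 (fin_three_eq (Ne.symm (mt (hi p).1 hp)) (Ne.symm (mt (hi q).1 hq)) hpq h3 hn.1)
  have key : ∀ u v, col u ≠ 0 → col v ≠ 0 → comp u = comp q → comp v ≠ comp q →
      comp p = comp v → (mergeCol p q col comp u = col v ↔ c u = c v) := by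
    intro u v hu hv h1 h2 h3
    have e1 := h u q hu hq h1
    have e2 := h p v hp hv h3
    have e3 := ci u hu
    have e4 := ci v hv
    have b1 := hc u
    have b2 := hc v
    have b3 := hc p
    have b4 := hc q
    unfold mergeCol
    by_cases e : col p = col q
    · rw [if_pos ⟨h1, by omega, e⟩]
      clear * - e1 e2 e3 e4 b1 b2 b3 b4 hpq e hu hv hp hq
      grind
    · rw [if_neg (fun h => e h.2.2)]
      clear * - e1 e2 e3 e4 b1 b2 b3 b4 hpq e hu hv hp hq
      grind
  intro u v hu hv huv
  rw [Ne, (mergeCol_le hc _).2] at hu hv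
  have pu : 0 < col u := Nat.pos_of_ne_zero hu
  have pv : 0 < col v := Nat.pos_of_ne_zero hv
  by_cases h1 : comp u = comp q <;> by_cases h2 : comp v = comp q
  · rw [← h u v hu hv (h1.trans h2.symm)]
    have b1 := hc u
    have b2 := hc v
    simp only [mergeCol, h1, h2, pu, pv, true_and]
    split_ifs <;> omega
  · simp only [mergeComp, h1, h2, pu, pv, if_true, true_and, if_false, false_and] at huv
    have := key u v hu hv h1 h2 huv
    rwa [show mergeCol p q col comp v = col v by simp [mergeCol, h2]]
  · simp only [mergeComp, h1, h2, pu, pv, if_true, true_and, if_false, false_and] at huv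
    have := key v u hv hu h2 h1 huv.symm
    rw [show mergeCol p q col comp u = col u by simp [mergeCol, h1], eq_comm, this, eq_comm]
  · simp only [mergeComp, h1, h2, if_false, false_and] at huv
    simp only [mergeCol, h1, h2, if_false, false_and]
    exact h u v hu hv huv

/-- The state of the solver after the constraints from the directed edges in `l`. -/
structure Solved (G : SimpleGraph (Fin n)) (col₀ P : Fin n → ℕ) (l : List (Fin n × Fin n))
    (col comp : Fin n → ℕ) : Prop where
  le : ∀ v, col v ≤ 2
  zero : ∀ v, col v = 0 ↔ col₀ v = 0
  lt : ∀ v, comp v < n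
  agrees : ∀ c i, IsStar G c → (∀ v, c v = i ↔ col₀ v = 0) → Agrees c col comp
  done : ∀ d ∈ l, ∀ p : Fin n, P d.1 = p → p ≠ d.2 → col₀ d.2 ≠ 0 → col₀ p ≠ 0 →
    comp p = comp d.2

theorem Solved.init (h : ∀ v, col₀ v ≤ 1) : Solved G col₀ P [] col₀ (fun v => v) where
  le v := (h v).trans one_le_two
  zero _ := Iff.rfl
  lt v := v.2
  agrees c i _ _ u v _ _ huv := by
    have := Fin.ext huv
    subst this; simp
  done := by simp

theorem Solved.skip {l : List (Fin n × Fin n)} {u v : Fin n} (h : Solved G col₀ P l col comp)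
    (hs : ∀ p : Fin n, P u = p → p ≠ v → col v = 0) : Solved G col₀ P (l ++ [(u, v)]) col comp where
  le := h.le
  zero := h.zero
  lt := h.lt
  agrees := h.agrees
  done d hd := by
    rw [List.mem_append, List.mem_singleton] at hd
    rcases hd with hd | rfl
    · exact h.done d hd
    · exact fun p hp hpv h0 _ => absurd ((h.zero v).1 (hs p hp hpv)) h0

theorem Solved.merge {l : List (Fin n × Fin n)} {u v p : Fin n} (h : Solved G col₀ P l col comp)
    (hP : Partner G col₀ P) (huv : G.Adj u v) (hp : P u = p) (hpv : p ≠ v) (hv : col v ≠ 0) :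
    Solved G col₀ P (l ++ [(u, v)]) (mergeCol p v col comp) (mergeComp p v col comp) where
  le w := (mergeCol_le h.le w).1
  zero w := ((mergeCol_le h.le w).2).trans (h.zero w)
  lt w := by unfold mergeComp; split_ifs; exacts [h.lt p, h.lt w]
  agrees c i hc hi := by
    obtain ⟨h1, h2⟩ := hc.partner_ne hi hP huv hp hpv
    exact (h.agrees c i hc hi).merge (fun w => (hi w).trans (h.zero w).symm) h.le
      (mt (h.zero p).1 h2) hv h1
  done d hd := by
    have pos : ∀ w, col₀ w ≠ 0 → 0 < col w := fun w hw =>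
      Nat.pos_of_ne_zero (mt (h.zero w).1 hw)
    rw [List.mem_append, List.mem_singleton] at hd
    intro p' hp' hpv' h0 h1
    rcases hd with hd | rfl
    · have := h.done d hd p' hp' hpv' h0 h1
      simp [mergeComp, this, pos _ h0, pos _ h1]
    · have : p' = p := Fin.ext (hp'.symm.trans hp)
      subst this
      simp only [mergeComp, pos _ h0, pos _ h1, and_true, if_true]
      split_ifs <;> rfl

/-- The field `done` records only that `p` and `v` lie in one component; that their colours differ
follows from agreement with `c`. If no such `c` exists, nothing is claimed and the final check
decides. -/
theorem Solved.edgeOk {l : List (Fin n × Fin n)} (h : Solved G col₀ P l col comp)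
    (hl : ∀ u v, G.Adj u v → (u, v) ∈ l) (hP : Partner G col₀ P) (hc : IsStar G c)
    (hi : ∀ v, c v = i ↔ col₀ v = 0) (u v : Fin n) (huv : G.Adj u v) : EdgeOk G col u v := by
  have hP' : Partner G col P := by
    have : ∀ z, Heavy G col z ↔ Heavy G col₀ z := fun z => by simp [Heavy, h.zero]
    simpa [Partner, this, h.zero] using hP
  refine hc.edgeOk_of_partner (fun v => (hi v).trans (h.zero v).symm) hP' ?_ u v huv
  intro u v p huv hp hpv hv
  obtain ⟨h1, h2⟩ := hc.partner_ne hi hP huv hp hpv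
  have := h.done _ (hl u v huv) p hp hpv (mt (h.zero v).2 hv) h2
  rw [Ne, h.agrees c i hc hi p v (mt (h.zero p).1 h2) hv this]
  exact h1

end Solver

/-! ### The program -/

section Program

variable {n B : ℕ} {G : SimpleGraph (Fin n)} {es : List (Fin n × Fin n)} {s : RamState}

/-- In the array `A`, give the value `1` to the neighbours of a vertex with value `0`. -/
def levelOne (A : ℕ) : RamProg :=
  .seq (.instr (.load 16 A 12)) (.ite 16 3
    (.seq (.instr (.load 17 A 13)) (.ite 3 17 (.instr (.store A 13 3)) .skip)) .skip)

/-- In the array `A`, give the value `2` to the further neighbours of a vertex with value `1`. -/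
def levelTwo (A : ℕ) : RamProg :=
  .seq (.instr (.load 16 A 12)) (.ite 16 4 (.ite 2 16
    (.seq (.instr (.load 17 A 13)) (.ite 4 17 (.instr (.store A 13 4)) .skip)) .skip) .skip)

/-- In the array `A`, compute the distances to the vertex in the register `x`, up to three. -/
def levels (x A : ℕ) : RamProg :=
  .seq (verts 11 (.instr (.store A 11 5))) (.seq (.instr (.store A x 2))
    (.seq (darts 11 12 13 (levelOne A)) (darts 11 12 13 (levelTwo A))))

theorem runs_darts {p : RamProg} {T : ℕ} (he : Env B es s) (hs : p.Safe) (hp : 11 ∉ p.wregs)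
    (J : List (Fin n × Fin n) → (ℕ → ℕ → ℕ) → ℕ → Prop) (h0 : J [] s.arr (s.reg 14))
    (hJ : ∀ l (u v : Fin n) s, l ++ [(u, v)] <+: dartList es → Env B es s → J l s.arr (s.reg 14) →
      s.reg 12 = u → s.reg 13 = v → p.wp B s fun s' => J (l ++ [(u, v)]) s'.arr (s'.reg 14))
    (hT : p.cost ≤ T) :
    Runs B (darts 11 12 13 p) s (es.length * (2 * T + 6) + 2) fun s' =>
      J (dartList es) s'.arr (s'.reg 14) :=
  Runs.darts he (by norm_num) (by norm_num) (by norm_num) (by norm_num) (by norm_num) (by norm_num)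
    (by norm_num) (by norm_num) (by norm_num) hs hp J h0 fun l d s h1 h2 h3 h4 h5 =>
      (Runs.of_wp (hJ l d.1 d.2 s h1 h2 h3 h4 h5)).mono hT fun _ h => h

theorem runs_fill {A : ℕ} (he : Env B es s) (hA : 2 ≤ A) :
    Runs B (verts 11 (.instr (.store A 11 5))) s (3 * n + 2) fun s' =>
      ∀ w : Fin n, s'.arr A w = 3 := by
  have hB := he.hB
  refine (Runs.verts he (by norm_num) ⟨by simp [RamProg.wregs, RamInstr.wregs],
    by simpa [RamProg.warrs, RamInstr.warrs]⟩ (by simp [RamProg.wregs, RamInstr.wregs])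
    (J := fun k s => ∀ w < k, s.arr A w = 3) (T := 1) (fun k s x h => h) (by simp) ?_).mono
    (by omega) fun s' h w => h w w.2
  intro k hk s he h hs
  refine (Runs.of_wp (p := .instr (.store A 11 5)) ?_)
  simp only [RamProg.wp, RamInstr.value, RamInstr.exec, he.r5, hs, RamState.arr_setArr, if_true]
  refine ⟨by omega, fun w hw => ?_⟩
  split_ifs with e
  · rfl
  · exact h w (by omega)

/-- Updating in place is harmless: only the value `0` propagates, and no new `0` is written. The
same holds for the value `1` in the second round. -/
theorem runs_levelOne {A : ℕ} {a : Fin n} (he : Env B es s) (hA : 2 ≤ A)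
    (h : ∀ w : Fin n, s.arr A w = if a = w then 0 else 3) :
    Runs B (darts 11 12 13 (levelOne A)) s (es.length * 16 + 2) fun s' =>
      ∀ w : Fin n, s'.arr A w = if a = w then 0 else if (a, w) ∈ dartList es then 1 else 3 := by
  have hB := he.hB
  refine runs_darts (T := 5) he ⟨by simp [levelOne, RamProg.wregs, RamInstr.wregs],
      by simpa [levelOne, RamProg.warrs, RamInstr.warrs]⟩
    (by simp [levelOne, RamProg.wregs, RamInstr.wregs])
    (fun l arr _ => ∀ w : Fin n, arr A w = if a = w then 0 else if (a, w) ∈ l then 1 else 3)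
    (by simpa using h) ?_ (by simp [levelOne, RamProg.cost])
  intro l u v s _ he h hu hv
  have hu' := h u
  have hv' := h v
  simp only [levelOne, RamProg.wp, RamInstr.value, RamInstr.exec, he.r3, hu, hv,
    RamState.arr_setArr, RamState.arr_setReg, RamState.reg_setReg, if_true, if_false,
    Nat.reduceEqDiff, List.mem_append, List.mem_singleton, Prod.mk.injEq]
  refine ⟨?_, fun h1 => ⟨?_, fun h2 => ⟨by omega, fun w => ?_⟩, fun h2 w => ?_⟩, fun h1 w => ?_⟩
  · grind
  · grind
  all_goals have hw := h w
  · simp only [Fin.val_inj]; grind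
  · grind
  · grind

open Classical in
theorem runs_levelTwo {A : ℕ} {a : Fin n} (he : Env B es s) (hA : 2 ≤ A)
    (hG : ∀ u v, G.Adj u v ↔ (u, v) ∈ dartList es)
    (h : ∀ w : Fin n, s.arr A w = if a = w then 0 else if (a, w) ∈ dartList es then 1 else 3) :
    Runs B (darts 11 12 13 (levelTwo A)) s (es.length * 18 + 2) fun s' =>
      ∀ w : Fin n, s'.arr A w = lev G a w := by
  have hB := he.hB
  refine (runs_darts (T := 6) he ⟨by simp [levelTwo, RamProg.wregs, RamInstr.wregs],
      by simpa [levelTwo, RamProg.warrs, RamInstr.warrs]⟩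
    (by simp [levelTwo, RamProg.wregs, RamInstr.wregs])
    (fun l arr _ => ∀ w : Fin n, arr A w = if a = w then 0 else if G.Adj a w then 1 else
      if ∃ p, G.Adj a p ∧ (p, w) ∈ l then 2 else 3)
    (by simpa [hG] using h) ?_ (by simp [levelTwo, RamProg.cost])).mono le_rfl fun s' h w => ?_
  · intro l u v s _ he h hu hv
    have hX : ∀ w, (∃ p, G.Adj a p ∧ (p, w) ∈ l ++ [(u, v)]) ↔
        (∃ p, G.Adj a p ∧ (p, w) ∈ l) ∨ G.Adj a u ∧ w = v := by
      intro w
      simp only [List.mem_append, List.mem_singleton, Prod.mk.injEq]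
      constructor
      · rintro ⟨p, hp, hl | ⟨rfl, rfl⟩⟩
        exacts [Or.inl ⟨p, hp, hl⟩, Or.inr ⟨hp, rfl⟩]
      · rintro (⟨p, hp, hl⟩ | ⟨hp, rfl⟩)
        exacts [⟨p, hp, Or.inl hl⟩, ⟨u, hp, Or.inr ⟨rfl, rfl⟩⟩]
    simp only [hX]
    clear hX
    obtain ⟨X, hX⟩ : ∃ X : Fin n → Prop, ∀ w, (∃ p, G.Adj a p ∧ (p, w) ∈ l) ↔ X w :=
      ⟨_, fun _ => Iff.rfl⟩
    simp only [hX] at h ⊢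
    clear hX
    have hau : G.Adj a u → a ≠ u := fun e => e.ne
    have hu' := h u
    have hv' := h v
    simp only [levelTwo, RamProg.wp, RamInstr.value, RamInstr.exec, he.r2, he.r4, hu, hv,
      RamState.arr_setArr, RamState.arr_setReg, RamState.reg_setReg, if_true, if_false,
      Nat.reduceEqDiff]
    refine ⟨?_, fun h1 => ⟨fun h2 => ⟨?_, fun h3 => ⟨by omega, fun w => ?_⟩, fun h3 w => ?_⟩,
      fun h2 w => ?_⟩, fun h1 w => ?_⟩
    · split_ifs at hu' <;> omega
    · split_ifs at hv' <;> omega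
    · simp only [Fin.val_inj, h w]
      clear h
      grind
    · rw [h w]
      clear h
      grind
    · rw [h w]
      clear h
      grind
    · rw [h w]
      clear h
      grind
  · rw [h w, lev]
    simp only [hG]

theorem runs_levels {x A : ℕ} {a : Fin n} (he : Env B es s) (hA : 2 ≤ A) (hx : s.reg x = a)
    (hx6 : x ≠ 11)
    (hG : ∀ u v, G.Adj u v ↔ (u, v) ∈ dartList es) :
    Runs B (levels x A) s (3 * n + 34 * es.length + 7) fun s' =>
      ∀ w : Fin n, s'.arr A w = lev G a w := by
  have hA0 : ∀ r ∈ (RamProg.instr (.store A x 2)).wregs, 6 ≤ r := by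
    simp [RamProg.wregs, RamInstr.wregs]
  refine (((runs_fill he hA).env ⟨by simp [verts, RamProg.wregs, RamInstr.wregs],
    by simpa [verts, RamProg.warrs, RamInstr.warrs]⟩ he).seq (T₂ := 34 * es.length + 5)
    fun s1 ⟨e1, h1, r1, _⟩ => ?_).mono (by omega) fun _ h => h
  have hx1 : s1.reg x = a := by
    rw [r1 x (by simpa [verts, RamProg.wregs, RamInstr.wregs]), hx]
  have st : Runs B (.instr (.store A x 2)) s1 1 fun s' =>
      ∀ w : Fin n, s'.arr A w = if a = w then 0 else 3 := by
    refine Runs.of_wp (p := .instr (.store A x 2)) ?_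
    simp only [RamProg.wp, RamInstr.value, RamInstr.exec, e1.r2, hx1, RamState.arr_setArr, if_true,
      h1, Fin.val_inj, Nat.zero_le, true_and]
    intro w
    simp only [eq_comm]
  refine ((st.env ⟨hA0, by simpa [RamProg.warrs, RamInstr.warrs]⟩ e1).seq
    (T₂ := 34 * es.length + 4) fun s2 ⟨e2, h2, _, _⟩ => ?_).mono (by omega) fun _ h => h
  refine (((runs_levelOne e2 hA h2).env ⟨by simp [darts, levelOne, RamProg.wregs, RamInstr.wregs],
    by simpa [darts, levelOne, RamProg.warrs, RamInstr.warrs]⟩ e2).seq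
    fun s3 ⟨e3, h3, _, _⟩ => runs_levelTwo e3 hA hG h3).mono (by omega) fun _ h => h

end Program

/-! ### Initial colours and memory for one guess. -/

section Program

variable {n B : ℕ} {G : SimpleGraph (Fin n)} {es : List (Fin n × Fin n)} {s : RamState}

/-- Compute the pattern `τ` of the numbers in the registers `15` and `16`. -/
def table (τ : ℕ) : RamProg :=
  if τ < 1 then
    .ite 15 3 (.instr (.const 17 0)) (.ite 15 5 (.instr (.const 17 1)) (.instr (.const 17 0)))
  else if τ < 2 then
    .ite 15 4 (.instr (.const 17 1)) (.ite 15 5 (.instr (.const 17 0)) (.instr (.const 17 1)))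
  else if τ < 3 then
    .ite 15 3 (.instr (.const 17 0)) (.ite 15 5 (.instr (.const 17 1))
      (.ite 16 4 (.instr (.const 17 1)) (.ite 16 5 (.instr (.const 17 0)) (.instr (.const 17 1)))))
  else
    .ite 15 3 (.instr (.const 17 1)) (.ite 15 4
      (.ite 16 3 (.instr (.const 17 1)) (.instr (.const 17 0)))
      (.ite 15 5 (.instr (.const 17 1)) (.ite 16 4 (.instr (.const 17 1))
        (.ite 16 5 (.instr (.const 17 0)) (.instr (.const 17 1))))))

theorem pattern_le (τ x y : ℕ) : pattern τ x y ≤ 1 := by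
  unfold pattern; split_ifs <;> omega

theorem table_wp {τ : ℕ} {Q : RamState → Prop} (he : Env B es s)
    (h : Q (s.setReg 17 (pattern τ (s.reg 15) (s.reg 16)))) : (table τ).wp B s Q := by
  have hB := he.hB
  have h1 : 1 ≤ B := by omega
  have r3 := he.r3
  have r4 := he.r4
  have r5 := he.r5
  revert h
  unfold pattern table
  split_ifs <;> intro h <;> simp_all [RamProg.wp, RamInstr.value, RamInstr.exec]

theorem table_cost (τ : ℕ) : (table τ).cost ≤ 6 := by
  unfold table; split_ifs <;> simp [RamProg.cost]

theorem table_wregs (τ : ℕ) : ∀ r ∈ (table τ).wregs, r = 17 := by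
  unfold table; split_ifs <;> simp [RamProg.wregs, RamInstr.wregs]

theorem table_warrs (τ : ℕ) : (table τ).warrs = [] := by
  unfold table; split_ifs <;> simp [RamProg.warrs, RamInstr.warrs]

/-- The first colours, and the initial content of all arrays. -/
def startBody (τ : ℕ) : RamProg :=
  -- Arrays `4` to `8` hold the colour, the component, the number of neighbours in the class `0`,
  -- the partner (with `n` for none), and in cell `3 * w + j` the number of neighbours of `w` of
  -- colour `j`.
  .seq (.instr (.load 15 2 11)) (.seq (.instr (.load 16 3 11)) (.seq (table τ)
    (.seq (.instr (.store 4 11 17)) (.seq (.instr (.store 5 11 11)) (.seq (.instr (.store 6 11 2))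
    (.seq (.ite 2 17 (.instr (.store 7 11 11)) (.instr (.store 7 11 0)))
    (.seq (.instr (.add 18 11 11)) (.seq (.instr (.add 18 18 11)) (.seq (.instr (.store 8 18 2))
    (.seq (.instr (.add 18 18 3)) (.seq (.instr (.store 8 18 2))
    (.seq (.instr (.add 18 18 3)) (.instr (.store 8 18 2))))))))))))))

theorem startBody_regs (τ : ℕ) : ∀ r ∈ (startBody τ).wregs, 15 ≤ r ∧ r ≤ 18 := by
  intro r hr
  by_cases hm : r ∈ (table τ).wregs
  · have := table_wregs τ r hm
    omega
  · simp only [startBody, RamProg.wregs, RamInstr.wregs, List.mem_append, List.mem_singleton,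
      List.not_mem_nil, false_or, or_false, hm] at hr
    omega

theorem startBody_arrs (τ : ℕ) : ∀ a ∈ (startBody τ).warrs, 4 ≤ a ∧ a ≤ 8 := by
  intro r hr
  simp only [startBody, RamProg.warrs, RamInstr.warrs, table_warrs, List.mem_append,
    List.mem_singleton, List.not_mem_nil, false_or] at hr
  omega

theorem startBody_cost (τ : ℕ) : (startBody τ).cost ≤ 20 := by
  have hc := table_cost τ
  simp only [startBody, RamProg.cost]
  generalize (table τ).cost = x at hc ⊢
  omega

/-- The state after the initialisation of the cells of the first `k` vertices. -/
structure Started (n τ : ℕ) (la lb : Fin n → ℕ) (k : ℕ) (s : RamState) : Prop where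
  eqA : ∀ w : Fin n, s.arr 2 w = la w
  eqB : ∀ w : Fin n, s.arr 3 w = lb w
  col : ∀ w : Fin n, w < k → s.arr 4 w = pattern τ (la w) (lb w)
  comp : ∀ w : Fin n, w < k → s.arr 5 w = w
  heavy : ∀ w : Fin n, w < k → s.arr 6 w = 0
  partner : ∀ w : Fin n, w < k → s.arr 7 w = if 0 < pattern τ (la w) (lb w) then ↑w else n
  count : ∀ x < 3 * k, s.arr 8 x = 0

theorem runs_start {τ : ℕ} {la lb : Fin n → ℕ} (he : Env B es s)
    (ha : ∀ w : Fin n, s.arr 2 w = la w) (hb : ∀ w : Fin n, s.arr 3 w = lb w)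
    (ha3 : ∀ w, la w ≤ 3) (hb3 : ∀ w, lb w ≤ 3) :
    Runs B (verts 11 (startBody τ)) s (22 * n + 2) (Started n τ la lb n) := by
  have hB := he.hB
  refine (Runs.verts (T := 20) he (by norm_num)
    ⟨fun r hr => by have := startBody_regs τ r hr; omega,
      fun a ha => by have := startBody_arrs τ a ha; omega⟩
    (fun h => by have := startBody_regs τ 11 h; omega) (J := Started n τ la lb)
    (fun k s x h => ⟨h.eqA, h.eqB, h.col, h.comp, h.heavy, h.partner, h.count⟩)
    ⟨ha, hb, by simp, by simp, by simp, by simp, by simp⟩ ?_).mono (by omega) fun s' h => h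
  intro k hk s he h hs
  refine (Runs.of_wp (p := startBody τ) ?_).mono (startBody_cost τ) fun _ h => h
  have la' := h.eqA ⟨k, hk⟩
  have lb' := h.eqB ⟨k, hk⟩
  have la3 := ha3 ⟨k, hk⟩
  have lb3 := hb3 ⟨k, hk⟩
  have hp1 := pattern_le τ (la ⟨k, hk⟩) (lb ⟨k, hk⟩)
  simp only at la' lb'
  simp only [startBody, RamProg.wp, RamInstr.value, RamInstr.exec, hs]
  simp only [RamState.reg_setReg, RamState.arr_setReg, if_true, if_false, Nat.reduceEqDiff, hs,
    la', lb']
  refine ⟨by omega, by omega, table_wp (he.congr (fun r hr => ?_) fun a _ => rfl) ?_⟩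
  · simp [show r ≠ 15 by omega, show r ≠ 16 by omega]
  simp only [RamState.reg_setReg, RamState.reg_setArr, if_true, if_false,
    Nat.reduceEqDiff, hs, he.r0, he.r2, he.r3]
  refine ⟨by omega, by omega, by omega, fun h0 => ⟨by omega, by omega, by omega, by omega, by omega,
    by omega, by omega, by omega, ?_⟩, fun h0 => ⟨by omega, by omega, by omega, by omega, by omega,
    by omega, by omega, by omega, ?_⟩⟩
  all_goals
    refine ⟨fun w => ?_, fun w => ?_, fun w hw => ?_, fun w hw => ?_, fun w hw => ?_, fun w hw => ?_,
      fun x hx => ?_⟩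
    all_goals simp only [RamState.arr_setReg, RamState.arr_setArr, if_true, if_false,
      Nat.reduceEqDiff]
    · exact h.eqA w
    · exact h.eqB w
    all_goals try by_cases e : w = ⟨k, hk⟩
    all_goals try have e' : ¬ (w : ℕ) = k := fun h => e (Fin.ext h)
    · rw [e, if_pos rfl]
    · rw [if_neg e']
      exact h.col w (by omega)
    · rw [e, if_pos rfl]
    · rw [if_neg e']
      exact h.comp w (by omega)
    · rw [e, if_pos rfl]
    · rw [if_neg e']
      exact h.heavy w (by omega)
    · rw [e, if_pos rfl]
      simp only [h0, if_true, if_false]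
    · rw [if_neg e']
      exact h.partner w (by omega)
    · split_ifs <;> first | rfl | exact h.count x (by omega)

end Program

/-! ### Directed edges, counting and heavy neighbours. -/

section Program

variable {n B : ℕ} {G : SimpleGraph (Fin n)} {es : List (Fin n × Fin n)} {s : RamState}

theorem mem_dartList {u v : Fin n} : (u, v) ∈ dartList es ↔ (u, v) ∈ es ∨ (v, u) ∈ es := by
  simp only [dartList, List.mem_flatMap, List.mem_cons, List.not_mem_nil, or_false]
  constructor
  · rintro ⟨e, he, h | h⟩
    · exact Or.inl (h ▸ he)
    · rw [Prod.ext_iff] at h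
      obtain ⟨h1, h2⟩ := h
      simp only [Prod.fst_swap, Prod.snd_swap] at h1 h2
      subst h1 h2
      exact Or.inr he
  · rintro (h | h)
    · exact ⟨_, h, Or.inl rfl⟩
    · exact ⟨_, h, Or.inr rfl⟩

theorem IsEdgeList.adj_iff (h : IsEdgeList G es) (u v : Fin n) :
    G.Adj u v ↔ (u, v) ∈ dartList es := by
  rw [mem_dartList, ← SimpleGraph.mem_edgeSet, ← h.2, List.mem_map]
  constructor
  · rintro ⟨⟨a, b⟩, hab, e⟩
    rcases Sym2.eq_iff.1 e with ⟨rfl, rfl⟩ | ⟨rfl, rfl⟩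
    exacts [Or.inl hab, Or.inr hab]
  · rintro (h | h)
    exacts [⟨_, h, rfl⟩, ⟨_, h, Sym2.eq_swap⟩]

theorem IsEdgeList.nodup (h : IsEdgeList G es) : (dartList es).Nodup := by
  rw [dartList, List.nodup_flatMap]
  constructor
  · rintro ⟨a, b⟩ he
    have : G.Adj a b := (h.adj_iff a b).2 (mem_dartList.2 (Or.inl he))
    simp [this.ne]
  · refine (List.pairwise_map.1 h.1).imp ?_
    rintro ⟨a, b⟩ ⟨a', b'⟩ hne
    simp only [ne_eq, Sym2.eq_iff] at hne
    simp only [Function.onFun, Prod.swap_prod_mk, List.disjoint_cons_left, List.mem_cons,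
      Prod.mk.injEq, List.not_mem_nil, or_false, List.disjoint_nil_left, and_true]
    tauto

theorem IsEdgeList.length_eq (h : IsEdgeList G es) : es.length = G.edgeSet.ncard := by
  have : G.edgeSet = ((es.map fun e => s(e.1, e.2)).toFinset : Set (Sym2 (Fin n))) := by
    ext e; rw [← h.2]; simp
  rw [this, Set.ncard_coe_finset, List.toFinset_card_of_nodup h.1, List.length_map]

theorem two_le_countP {α : Type*} [DecidableEq α] {l : List α} (hl : l.Nodup) (p : α → Bool) :
    1 < l.countP p ↔ ∃ a ∈ l, p a ∧ ∃ b ∈ l, p b ∧ a ≠ b := by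
  rw [List.countP_eq_length_filter, ← List.toFinset_card_of_nodup (hl.filter p),
    Finset.one_lt_card]
  simp [and_assoc]

/-- The number of directed edges in `l` from `u` to a vertex of colour `j`. -/
def countTo (l : List (Fin n × Fin n)) (col : Fin n → ℕ) (u : Fin n) (j : ℕ) : ℕ :=
  l.countP fun d => d.1 = u ∧ col d.2 = j

theorem countTo_le {l : List (Fin n × Fin n)} (hl : l <+: dartList es) (col : Fin n → ℕ)
    (u : Fin n) (j : ℕ) : countTo l col u j ≤ 2 * es.length := by
  have h1 : (dartList es).length = 2 * es.length := by
    simp [dartList, List.length_flatMap, mul_comm]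
  exact (List.countP_le_length).trans (hl.length_le.trans h1.le)

theorem countTo_append (l : List (Fin n × Fin n)) (col : Fin n → ℕ) (u v w : Fin n) (j : ℕ) :
    countTo (l ++ [(u, v)]) col w j = countTo l col w j + if u = w ∧ col v = j then 1 else 0 := by
  simp [countTo, List.countP_append, List.countP_singleton]

/-- No directed edge is repeated in the list, so counting entries counts distinct neighbours. -/
theorem one_lt_countTo (h : IsEdgeList G es) (col : Fin n → ℕ) (u : Fin n) (j : ℕ) :
    1 < countTo (dartList es) col u j ↔
      ∃ a b, a ≠ b ∧ G.Adj u a ∧ G.Adj u b ∧ col a = j ∧ col b = j := by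
  rw [countTo, two_le_countP h.nodup]
  simp only [decide_eq_true_eq, Prod.exists]
  constructor
  · rintro ⟨u', a, ha, ⟨rfl, ca⟩, u'', b, hb, ⟨rfl, cb⟩, hab⟩
    exact ⟨a, b, fun e => hab (by rw [e]), (h.adj_iff _ _).2 ha, (h.adj_iff _ _).2 hb, ca, cb⟩
  · rintro ⟨a, b, hab, ha, hb, ca, cb⟩
    exact ⟨u, a, (h.adj_iff _ _).1 ha, ⟨rfl, ca⟩, u, b, (h.adj_iff _ _).1 hb, ⟨rfl, cb⟩,
      fun e => hab (Prod.ext_iff.1 e).2⟩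

/-- Count the neighbours of colour `0`. -/
def countZero : RamProg :=
  .seq (.instr (.load 15 4 13)) (.ite 15 3 (.seq (.instr (.load 16 6 12))
    (.seq (.instr (.add 16 16 3)) (.instr (.store 6 12 16)))) .skip)

theorem runs_countZero {col : Fin n → ℕ} (he : Env B es s) (hc : ∀ w, col w ≤ 2)
    (h4 : ∀ w : Fin n, s.arr 4 w = col w) (h6 : ∀ w : Fin n, s.arr 6 w = 0) :
    Runs B (darts 11 12 13 countZero) s (es.length * 16 + 2) fun s' =>
      ∀ w : Fin n, s'.arr 6 w = countTo (dartList es) col w 0 := by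
  have hB := he.hB
  refine (runs_darts (T := 5) he (by decide) (by decide)
    (fun l arr _ => (∀ w : Fin n, arr 4 w = col w) ∧ ∀ w : Fin n, arr 6 w = countTo l col w 0)
    ⟨h4, by simpa [countTo] using h6⟩ ?_ (by simp [countZero, RamProg.cost])).mono le_rfl
    fun s' h => h.2
  rintro l u v s hl he ⟨h4, h6⟩ hu hv
  have c1 := countTo_le hl col u 0
  have c2 := hc v
  have c3 := countTo_append l col u v
  simp only [countZero, RamProg.wp, RamInstr.value, RamInstr.exec, he.r3, hu, hv, h4, h6,
    RamState.arr_setArr, RamState.arr_setReg, RamState.reg_setReg, if_true, if_false,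
    Nat.reduceEqDiff, Fin.val_inj, c3] at c1 ⊢
  refine ⟨by omega, fun h1 => ?_, fun h1 => ?_⟩
  · have hz : col v = 0 := by omega
    simp only [hz, and_true, if_true] at c1 ⊢
    refine ⟨by omega, by omega, by omega, by simp, fun w => ?_⟩
    by_cases e : w = u
    · simp [e]
    · simp [e, Ne.symm e]
  · have hz : col v ≠ 0 := by omega
    simp [hz]

/-- Find a heavy neighbour. -/
def findHeavy : RamProg :=
  .seq (.instr (.load 15 4 12)) (.ite 15 3 (.seq (.instr (.load 16 6 13))
    (.ite 3 16 (.instr (.store 7 12 13)) .skip)) .skip)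

/-- Later heavy neighbours overwrite earlier ones; any one of them may serve as partner. -/
theorem runs_findHeavy {col : Fin n → ℕ} (h : IsEdgeList G es) (he : Env B es s)
    (hc : ∀ w, col w ≤ 2) (h4 : ∀ w : Fin n, s.arr 4 w = col w)
    (h6 : ∀ w : Fin n, s.arr 6 w = countTo (dartList es) col w 0)
    (h7 : ∀ w : Fin n, s.arr 7 w = if 0 < col w then ↑w else n) :
    Runs B (darts 11 12 13 findHeavy) s (es.length * 16 + 2) fun s' =>
      ∃ P, Partner G col P ∧ ∀ w : Fin n, s'.arr 7 w = P w := by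
  have hB := he.hB
  have hh : ∀ w, 1 < countTo (dartList es) col w 0 ↔ Heavy G col w :=
    fun w => one_lt_countTo h col w 0
  refine (runs_darts (T := 5) he (by decide) (by decide)
    (fun l arr _ => (∀ w : Fin n, arr 4 w = col w) ∧
      (∀ w : Fin n, arr 6 w = countTo (dartList es) col w 0) ∧
      ∀ u : Fin n, (col u ≠ 0 ∧ arr 7 u = u) ∨ (col u = 0 ∧
        ((arr 7 u = n ∧ ∀ z, (u, z) ∈ l → ¬ Heavy G col z) ∨
          ∃ z : Fin n, arr 7 u = z ∧ G.Adj u z ∧ Heavy G col z)))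
    ⟨h4, h6, fun u => ?_⟩ ?_ (by simp [findHeavy, RamProg.cost])).mono le_rfl
    fun s' h' => ⟨fun w => s'.arr 7 w, ?_, fun w => rfl⟩
  · rw [h7]
    by_cases e : col u = 0
    · simp [e]
    · simp [e, Nat.pos_of_ne_zero e]
  · rintro l u v s hl he ⟨h4, h6, h7⟩ hu hv
    have huv : G.Adj u v := (h.adj_iff u v).2 (hl.subset (by simp))
    have c1 := countTo_le (List.prefix_refl _) col v 0 (es := es)
    have c2 := hc u
    simp only [findHeavy, RamProg.wp, RamInstr.value, RamInstr.exec, he.r3, hu, hv, h4, h6,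
      RamState.arr_setArr, RamState.arr_setReg, RamState.reg_setReg, if_true, if_false,
      Nat.reduceEqDiff, Fin.val_inj, hh]
    have hv2 := v.2
    refine ⟨by omega, fun h1 => ⟨by omega, fun h2 => ⟨by omega, by simp, by simp, fun w => ?_⟩,
      fun h2 => ⟨by simp, by simp, fun w => ?_⟩⟩, fun h1 => ⟨by simp, by simp, fun w => ?_⟩⟩
    · by_cases e : w = u
      · subst e
        exact Or.inr ⟨by omega, Or.inr ⟨v, by simp, huv, h2⟩⟩
      · simpa [e] using h7 w
    · by_cases e : w = u
      · subst e
        have := h7 w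
        simp only [List.mem_append, List.mem_singleton, Prod.mk.injEq, true_and]
        grind
      · simpa [e] using h7 w
    · by_cases e : w = u
      · subst e
        have := h7 w
        simp only [List.mem_append, List.mem_singleton, Prod.mk.injEq, true_and]
        grind
      · simpa [e] using h7 w
  · intro u
    have := h'.2.2 u
    simpa only [← h.adj_iff] using this

end Program

/-! ### Merging two components. -/

section Program

variable {n B : ℕ} {G : SimpleGraph (Fin n)} {es : List (Fin n × Fin n)} {s : RamState}

/-- Merge the component of the vertex in the register `21`. -/
def mergeVertex : RamProg :=
  .seq (.instr (.load 22 5 21)) (.ite 22 17 .skip (.ite 17 22 .skip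
    (.seq (.instr (.load 23 4 21)) (.ite 2 23 (.seq (.instr (.store 5 21 16))
      (.ite 2 20 (.seq (.instr (.sub 23 5 23)) (.instr (.store 4 21 23))) .skip)) .skip))))

/-- Prepare to merge the components of the vertices in the registers `15` and `13`. -/
def mergeInit : RamProg :=
  .seq (.instr (.load 16 5 15)) (.seq (.instr (.load 17 5 13)) (.seq (.instr (.load 18 4 15))
    (.seq (.instr (.load 19 4 13)) (.seq (.instr (.const 20 1))
    (.seq (.ite 18 19 (.instr (.const 20 0)) .skip) (.ite 19 18 (.instr (.const 20 0)) .skip))))))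

/-- Merge the components of the vertices in the registers `15` and `13`. -/
def mergeProg : RamProg := .seq mergeInit (verts 21 mergeVertex)

/-- The state of a merge after the first `k` vertices. -/
structure Merging (p q : Fin n) (col comp : Fin n → ℕ) (k : ℕ) (s : RamState) : Prop where
  r16 : s.reg 16 = comp p
  r17 : s.reg 17 = comp q
  r20 : s.reg 20 = if col p = col q then 1 else 0
  eqCol : ∀ w : Fin n, s.arr 4 w = if w < k then mergeCol p q col comp w else col w
  eqComp : ∀ w : Fin n, s.arr 5 w = if w < k then mergeComp p q col comp w else comp w

theorem runs_mergeInit {col comp : Fin n → ℕ} {p q : Fin n} (he : Env B es s)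
    (hc : ∀ w, col w ≤ 2) (hl : ∀ w, comp w < n) (h4 : ∀ w : Fin n, s.arr 4 w = col w)
    (h5 : ∀ w : Fin n, s.arr 5 w = comp w) (h15 : s.reg 15 = p) (h13 : s.reg 13 = q) :
    Runs B mergeInit s 9 (Merging p q col comp 0) := by
  have hB := he.hB
  have b1 := hc p
  have b2 := hc q
  have b3 := hl p
  have b4 := hl q
  refine (Runs.of_wp (p := mergeInit) ?_).mono (by simp [mergeInit, RamProg.cost]) fun _ h => h
  simp only [mergeInit, RamProg.wp, RamInstr.value, RamInstr.exec, h15, h13, h4, h5,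
    RamState.arr_setReg, RamState.reg_setReg, if_true, if_false, Nat.reduceEqDiff]
  refine ⟨by omega, by omega, by omega, by omega, by omega, fun e1 => ⟨by omega, fun e2 =>
    ⟨by omega, ?_⟩, fun e2 => ?_⟩, fun e1 => ⟨fun e2 => ⟨by omega, ?_⟩, fun e2 => ?_⟩⟩
  all_goals
    refine ⟨by simp, by simp, ?_, by simpa using h4, by simpa using h5⟩
    simp only [RamState.reg_setReg, if_true, if_false, Nat.reduceEqDiff]
    split_ifs <;> omega

/-- Both component numbers and the colour comparison are saved before the loop, so overwriting cell
by cell still evaluates the merge on the old arrays. -/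
theorem runs_mergeProg {col comp : Fin n → ℕ} {p q : Fin n} (he : Env B es s)
    (hc : ∀ w, col w ≤ 2) (hl : ∀ w, comp w < n) (h4 : ∀ w : Fin n, s.arr 4 w = col w)
    (h5 : ∀ w : Fin n, s.arr 5 w = comp w) (h15 : s.reg 15 = p) (h13 : s.reg 13 = q) :
    Runs B mergeProg s (11 * n + 11) fun s' =>
      (∀ w : Fin n, s'.arr 4 w = mergeCol p q col comp w) ∧
        ∀ w : Fin n, s'.arr 5 w = mergeComp p q col comp w := by
  have hB := he.hB
  refine (((runs_mergeInit he hc hl h4 h5 h15 h13).env (by decide) he).seq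
    (T₂ := n * (9 + 2) + 2) fun s1 ⟨e1, h1, _, _⟩ => ?_).mono (by omega) fun _ h => h
  refine (Runs.verts e1 (by norm_num) (by decide) (by decide) (Merging p q col comp)
    (fun k s x h => ⟨by simpa using h.r16, by simpa using h.r17, by simpa using h.r20, h.eqCol,
      h.eqComp⟩) h1 ?_).mono le_rfl fun s' h => ⟨fun w => ?_, fun w => ?_⟩
  · intro k hk s he h hs
    refine (Runs.of_wp (p := mergeVertex) ?_).mono (by simp [mergeVertex, RamProg.cost])
      fun _ h => h
    obtain ⟨r16, r17, r20, hcol, hcomp⟩ := h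
    have c1 := hcol ⟨k, hk⟩
    have c2 := hcomp ⟨k, hk⟩
    simp only [lt_irrefl, if_false] at c1 c2
    have b1 := hc ⟨k, hk⟩
    have b2 := hl ⟨k, hk⟩
    have b3 := hl p
    have b4 := hl q
    have step : ∀ (f g : Fin n → ℕ) (w : Fin n),
        (if (w : ℕ) = k then f ⟨k, hk⟩ else if (w : ℕ) < k then f w else g w) =
          if (w : ℕ) < k + 1 then f w else g w := by
      intro f g w
      by_cases e : (w : ℕ) = k
      · have : w = ⟨k, hk⟩ := Fin.ext e
        simp [this]
      · simp only [e, if_false, show (w : ℕ) < k + 1 ↔ (w : ℕ) < k by omega]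
    have step' : ∀ (f g : Fin n → ℕ) (w : Fin n), f ⟨k, hk⟩ = g ⟨k, hk⟩ →
        (if (w : ℕ) < k then f w else g w) = if (w : ℕ) < k + 1 then f w else g w := by
      intro f g w hfg
      rw [← step]
      by_cases e : (w : ℕ) = k
      · have : w = ⟨k, hk⟩ := Fin.ext e
        simp [this, hfg]
      · simp [e]
    simp only [mergeVertex, RamProg.wp, RamInstr.value, RamInstr.exec, hs, he.r2, he.r5, r16, r17,
      r20, c1, c2, RamState.arr_setReg, RamState.reg_setReg, RamState.reg_setArr,
      if_true, if_false, Nat.reduceEqDiff]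
    refine ⟨by omega, fun d1 => ?_, fun d1 => ⟨fun d2 => ?_, fun d2 => ⟨by omega, fun d3 =>
      ⟨by omega, fun d4 => ⟨by omega, by omega, ?_⟩, fun d4 => ?_⟩, fun d3 => ?_⟩⟩⟩
    all_goals
      refine ⟨by simpa using r16, by simpa using r17, by simpa using r20, fun w => ?_, fun w => ?_⟩
      all_goals simp only [RamState.arr_setReg, RamState.arr_setArr, if_true, if_false,
        Nat.reduceEqDiff, hcol, hcomp]
    · exact step' (mergeCol p q col comp) col w (if_neg (by omega))
    · exact step' (mergeComp p q col comp) comp w (if_neg (by omega))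
    · exact step' (mergeCol p q col comp) col w (if_neg (by omega))
    · exact step' (mergeComp p q col comp) comp w (if_neg (by omega))
    · rw [← step (mergeCol p q col comp) col w]
      congr 1
      exact (if_pos ⟨by omega, d3, by by_contra h; simp [h] at d4⟩).symm
    · rw [← step (mergeComp p q col comp) comp w]
      congr 1
      exact (if_pos ⟨by omega, d3⟩).symm
    · exact step' (mergeCol p q col comp) col w (if_neg (fun h => by simp [h.2.2] at d4))
    · rw [← step (mergeComp p q col comp) comp w]
      congr 1
      exact (if_pos ⟨by omega, d3⟩).symm
    · exact step' (mergeCol p q col comp) col w (if_neg (by omega))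
    · exact step' (mergeComp p q col comp) comp w (if_neg (by omega))
  · rw [h.eqCol, if_pos w.2]
  · rw [h.eqComp, if_pos w.2]

end Program

/-! ### Processing the constraints and verifying the outcome. -/

section Program

variable {n B : ℕ} {G : SimpleGraph (Fin n)} {es : List (Fin n × Fin n)} {s : RamState}

/-- Take account of the constraint from a directed edge. -/
def mergeDart : RamProg :=
  .seq (.seq (.instr (.load 15 7 12)) (.instr (.load 16 4 13)))
    (.ite 15 0 (.ite 2 16 (.ite 15 13 mergeProg (.ite 13 15 mergeProg .skip)) .skip) .skip)

theorem runs_merges {col₀ P : Fin n → ℕ} (h : IsEdgeList G es) (he : Env B es s)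
    (hc : ∀ w, col₀ w ≤ 1) (hP : Partner G col₀ P) (h4 : ∀ w : Fin n, s.arr 4 w = col₀ w)
    (h5 : ∀ w : Fin n, s.arr 5 w = w) (h7 : ∀ w : Fin n, s.arr 7 w = P w) :
    Runs B (darts 11 12 13 mergeDart) s (es.length * (22 * n + 40) + 2) fun s' =>
      ∃ col comp, Solved G col₀ P (dartList es) col comp ∧ ∀ w : Fin n, s'.arr 4 w = col w := by
  have hB := he.hB
  refine (Runs.darts (f := 14) (T := 11 * n + 17) he (by norm_num) (by norm_num) (by norm_num)
    (by norm_num) (by norm_num) (by norm_num) (by norm_num) (by norm_num) (by norm_num)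
    (by decide) (by decide)
    (fun l arr _ => (∀ w : Fin n, arr 7 w = P w) ∧ ∃ col comp, Solved G col₀ P l col comp ∧
      (∀ w : Fin n, arr 4 w = col w) ∧ ∀ w : Fin n, arr 5 w = comp w)
    ⟨h7, col₀, _, Solved.init hc, h4, h5⟩ ?_).mono (le_of_eq (by ring)) ?_
  swap
  · rintro s' ⟨-, col, comp, h1, h2, -⟩
    exact ⟨col, comp, h1, h2⟩
  rintro l ⟨u, v⟩ s hl he ⟨h7, col, comp, hS, h4, h5⟩ hu hv
  have huv : G.Adj u v := (h.adj_iff u v).2 (hl.subset (by simp))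
  have hPu : P u ≤ n := by
    rcases hP u with ⟨-, h⟩ | ⟨-, ⟨h, -⟩ | ⟨z, h, -⟩⟩
    · rw [h]; exact u.2.le
    · exact h.le
    · rw [h]; exact z.2.le
  have hcv := hS.le v
  have st : Runs B (.seq (.instr (.load 15 7 12)) (.instr (.load 16 4 13))) s 2 fun s' =>
      s'.reg 15 = P u ∧ s'.reg 16 = col v := by
    refine Runs.of_wp (p := .seq (.instr (.load 15 7 12)) (.instr (.load 16 4 13))) ?_
    simp only [RamProg.wp, RamInstr.value, RamInstr.exec, hu, hv, h4, h7, RamState.arr_setReg,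
      RamState.reg_setReg, if_true, if_false, Nat.reduceEqDiff, and_true]
    omega
  refine ((st.env (by decide) he).seq (T₂ := 11 * n + 15) ?_).mono (by omega) fun _ h => h
  rintro s1 ⟨e1, ⟨h15, h16⟩, hr, ha⟩
  have a4 := ha 4 (by decide)
  have a5 := ha 5 (by decide)
  have a7 := ha 7 (by decide)
  have h13 : s1.reg 13 = v := (hr 13 (by decide)).trans hv
  have skip : (∀ p : Fin n, P u = p → p ≠ v → col v = 0) → Runs B .skip s1 1 fun s' =>
      (∀ w : Fin n, s'.arr 7 w = P w) ∧ ∃ col comp, Solved G col₀ P (l ++ [(u, v)]) col comp ∧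
        (∀ w : Fin n, s'.arr 4 w = col w) ∧ ∀ w : Fin n, s'.arr 5 w = comp w := fun hs =>
    Runs.of_wp (p := .skip) ⟨by simpa [a7] using h7, col, comp, hS.skip hs, by simpa [a4] using h4,
      by simpa [a5] using h5⟩
  have merge : P u < n → P u ≠ v → col v ≠ 0 → Runs B mergeProg s1 (11 * n + 11) fun s' =>
      (∀ w : Fin n, s'.arr 7 w = P w) ∧ ∃ col comp, Solved G col₀ P (l ++ [(u, v)]) col comp ∧
        (∀ w : Fin n, s'.arr 4 w = col w) ∧ ∀ w : Fin n, s'.arr 5 w = comp w := by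
    intro hp hpv hv0
    refine (runs_mergeProg (col := col) (comp := comp) (p := ⟨P u, hp⟩) (q := v) e1 hS.le hS.lt
      (by simpa [a4] using h4) (by simpa [a5] using h5) h15 h13).frame.mono le_rfl ?_
    rintro s' ⟨⟨m4, m5⟩, -, ma⟩
    refine ⟨by simpa [ma 7 (by decide), a7] using h7, _, _, ?_, m4, m5⟩
    exact hS.merge hP huv rfl (fun e => hpv (congrArg Fin.val e)) hv0
  have r0 := e1.r0
  have r2 := e1.r2
  by_cases c1 : P u < n
  · refine Runs.mono (T := 11 * n + 14 + 1) (Runs.ite_true (by omega) ?_) le_rfl fun _ h => h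
    by_cases c2 : 0 < col v
    · refine Runs.mono (T := 11 * n + 13 + 1) (Runs.ite_true (by omega) ?_) le_rfl fun _ h => h
      by_cases c3 : P u < v
      · exact (Runs.ite_true (by omega) (merge c1 (by omega) (by omega))).mono (by omega)
          fun _ h => h
      · refine Runs.mono (T := 11 * n + 12 + 1) (Runs.ite_false (by omega) ?_) le_rfl fun _ h => h
        by_cases c4 : (v : ℕ) < P u
        · exact (Runs.ite_true (by omega) (merge c1 (by omega) (by omega))).mono (by omega)
            fun _ h => h
        · exact (Runs.ite_false (by omega) (skip fun p hp hpv =>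
            absurd (Fin.ext (by omega)) hpv)).mono (by omega) fun _ h => h
    · exact (Runs.ite_false (by omega) (skip fun p hp hpv => by omega)).mono (by omega) fun _ h => h
  · exact (Runs.ite_false (by omega) (skip fun p hp hpv => by omega)).mono (by omega) fun _ h => h

/-- Count the neighbours of each colour. -/
def countColours : RamProg :=
  .seq (.instr (.load 15 4 13)) (.seq (.instr (.add 16 12 12)) (.seq (.instr (.add 16 16 12))
    (.seq (.instr (.add 16 16 15)) (.seq (.instr (.load 17 8 16)) (.seq (.instr (.add 17 17 3))
      (.instr (.store 8 16 17)))))))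

theorem runs_countColours {col : Fin n → ℕ} (he : Env B es s) (hc : ∀ w, col w ≤ 2)
    (h4 : ∀ w : Fin n, s.arr 4 w = col w) (h8 : ∀ x < 3 * n, s.arr 8 x = 0) :
    Runs B (darts 11 12 13 countColours) s (es.length * 20 + 2) fun s' =>
      ∀ (w : Fin n), ∀ j < 3, s'.arr 8 (3 * w + j) = countTo (dartList es) col w j := by
  have hB := he.hB
  refine (runs_darts (T := 7) he (by decide) (by decide)
    (fun l arr _ => (∀ w : Fin n, arr 4 w = col w) ∧
      ∀ (w : Fin n), ∀ j < 3, arr 8 (3 * w + j) = countTo l col w j)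
    ⟨h4, fun w j hj => ?_⟩ ?_ (by simp [countColours, RamProg.cost])).mono le_rfl
    fun s' h => h.2
  · rw [h8 _ (by have := w.2; omega)]; simp [countTo]
  rintro l u v s hl he ⟨h4, h8⟩ hu hv
  have c1 := countTo_le hl col u (col v)
  have c2 := hc v
  have c3 := countTo_append l col u v
  have c4 := h8 u (col v) (by omega)
  have hu2 := u.2
  have e3 : (u : ℕ) + u + u + col v = 3 * u + col v := by ring
  simp only [countColours, RamProg.wp, RamInstr.value, RamInstr.exec, he.r3, hu, hv, h4,
    RamState.arr_setArr, RamState.arr_setReg, RamState.reg_setReg, if_true, if_false,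
    Nat.reduceEqDiff, c3, e3, c4, and_true] at c1 ⊢
  refine ⟨by omega, by omega, by omega, by omega, by omega, by omega, by omega, by simp,
    fun w j hj => ?_⟩
  rw [h8 w j hj]
  by_cases e : u = w ∧ col v = j
  · obtain ⟨rfl, rfl⟩ := e
    simp
  · rw [if_neg e, if_neg, add_zero]
    intro e'
    exact e ⟨Fin.ext (by omega), by omega⟩

/-- Check the colouring at an edge. -/
def verify : RamProg :=
  .seq (.instr (.load 15 4 12)) (.seq (.instr (.load 16 4 13)) (.seq (.instr (.add 17 13 13))
    (.seq (.instr (.add 17 17 13)) (.seq (.instr (.add 17 17 15)) (.seq (.instr (.load 17 8 17))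
    (.seq (.instr (.add 18 12 12)) (.seq (.instr (.add 18 18 12)) (.seq (.instr (.add 18 18 16))
    (.seq (.instr (.load 18 8 18))
      (.ite 15 16 (.ite 3 17 (.ite 3 18 (.instr (.const 14 0)) .skip) .skip)
        (.ite 16 15 (.ite 3 17 (.ite 3 18 (.instr (.const 14 0)) .skip) .skip)
          (.instr (.const 14 0)))))))))))))

/-- As `u` itself is counted around `v`, uniqueness means that the count does not exceed one, so an
edge is checked in constant time. -/
theorem edgeOk_iff (h : IsEdgeList G es) {col : Fin n → ℕ} {u v : Fin n} (huv : G.Adj u v) :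
    EdgeOk G col u v ↔ col u ≠ col v ∧ (¬ 1 < countTo (dartList es) col v (col u) ∨
      ¬ 1 < countTo (dartList es) col u (col v)) := by
  have key : ∀ u v, G.Adj u v → ((∀ x, G.Adj v x → col x = col u → x = u) ↔
      ¬ 1 < countTo (dartList es) col v (col u)) := by
    intro u v huv
    rw [one_lt_countTo h]
    constructor
    · rintro h1 ⟨a, b, hab, ha, hb, ca, cb⟩
      exact hab ((h1 a ha ca).trans (h1 b hb cb).symm)
    · intro h1 x hx cx
      by_contra hne
      exact h1 ⟨x, u, hne, hx, huv.symm, cx, rfl⟩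
  rw [EdgeOk, key u v huv, key v u huv.symm]

theorem runs_verify {col : Fin n → ℕ} (h : IsEdgeList G es) (he : Env B es s)
    (hc : ∀ w, col w ≤ 2) (h4 : ∀ w : Fin n, s.arr 4 w = col w)
    (h8 : ∀ (w : Fin n), ∀ j < 3, s.arr 8 (3 * w + j) = countTo (dartList es) col w j)
    (h14 : s.reg 14 = 1) :
    Runs B (darts 11 12 13 verify) s (es.length * 36 + 2) fun s' =>
      s'.reg 14 ≤ 1 ∧ (s'.reg 14 = 1 ↔ ∀ u v, G.Adj u v → EdgeOk G col u v) := by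
  have hB := he.hB
  refine (runs_darts (T := 15) he (by decide) (by decide)
    (fun l arr f => (∀ w : Fin n, arr 4 w = col w) ∧
      (∀ (w : Fin n), ∀ j < 3, arr 8 (3 * w + j) = countTo (dartList es) col w j) ∧
      f ≤ 1 ∧ (f = 1 ↔ ∀ d ∈ l, EdgeOk G col d.1 d.2))
    ⟨h4, h8, by omega, by simp [h14]⟩ ?_ (by simp [verify, RamProg.cost])).mono le_rfl
    fun s' h' => ⟨h'.2.2.1, h'.2.2.2.trans ?_⟩
  · rintro l u v s hl he ⟨h4, h8, hf, hf1⟩ hu hv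
    have huv : G.Adj u v := (h.adj_iff u v).2 (hl.subset (by simp))
    have c1 := countTo_le (List.prefix_refl _) col v (col u) (es := es)
    have c2 := countTo_le (List.prefix_refl _) col u (col v) (es := es)
    have c3 := hc u
    have c4 := hc v
    have c5 := h8 v (col u) (by omega)
    have c6 := h8 u (col v) (by omega)
    have hu2 := u.2
    have hv2 := v.2
    have e3 : (u : ℕ) + u + u + col v = 3 * u + col v := by ring
    have e4 : (v : ℕ) + v + v + col u = 3 * v + col u := by ring
    have hiff := edgeOk_iff h (col := col) huv
    simp only [verify, RamProg.wp, RamInstr.value, RamInstr.exec, he.r3, hu, hv, h4,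
      RamState.arr_setReg, RamState.reg_setReg, if_true, if_false,
      Nat.reduceEqDiff, e3, e4, c5, c6, List.forall_mem_append, List.forall_mem_singleton, ← hf1]
    generalize countTo (dartList es) col v (col u) = x at c1 hiff ⊢
    generalize countTo (dartList es) col u (col v) = y at c2 hiff ⊢
    refine ⟨by omega, by omega, by omega, by omega, by omega, by omega, by omega, by omega,
      by omega, by omega, fun d1 => ⟨fun d2 => ⟨fun d3 => ?_, fun d3 => ?_⟩, fun d2 => ?_⟩,
      fun d1 => ⟨fun d2 => ⟨fun d3 => ⟨fun d4 => ?_, fun d4 => ?_⟩, fun d3 => ?_⟩, fun d2 => ?_⟩⟩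
    all_goals
      simp only [hiff, implies_true, true_and, zero_le, hf]
    all_goals
      refine ⟨h8, ?_⟩
      first | omega | (simp only [false_iff]; omega)
  · constructor
    · intro h1 u v huv
      exact h1 _ ((h.adj_iff u v).1 huv)
    · rintro h1 ⟨u, v⟩ hd
      exact h1 u v ((h.adj_iff u v).2 hd)

end Program

/-! ### The complete search. -/

section Program

variable {n B : ℕ} {G : SimpleGraph (Fin n)} {es : List (Fin n × Fin n)} {s : RamState}

/-- Try to find a star colouring in which a colour class is given by the pattern `τ` of the
distances to the vertices in the registers `9` and `10`. -/
def attempt (τ : ℕ) : RamProg :=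
  .seq (levels 9 2) (.seq (levels 10 3) (.seq (verts 11 (startBody τ))
    (.seq (darts 11 12 13 countZero) (.seq (darts 11 12 13 findHeavy)
    (.seq (darts 11 12 13 mergeDart) (.seq (darts 11 12 13 countColours)
    (.seq (.instr (.const 14 1)) (.seq (darts 11 12 13 verify)
      (.ite 2 14 (.instr (.const 7 1)) .skip)))))))))

theorem verts_startBody_regs (τ : ℕ) :
    ∀ r ∈ (verts 11 (startBody τ)).wregs, 11 ≤ r ∧ r ≤ 18 := by
  intro r hr
  by_cases hm : r ∈ (startBody τ).wregs
  · have := startBody_regs τ r hm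
    omega
  · simp only [verts, RamProg.wregs, RamInstr.wregs, List.mem_append, List.mem_singleton, hm,
      false_or, or_self] at hr
    omega

theorem verts_startBody_arrs (τ : ℕ) :
    ∀ a ∈ (verts 11 (startBody τ)).warrs, 4 ≤ a ∧ a ≤ 8 := by
  intro a ha
  refine startBody_arrs τ a ?_
  simpa only [verts, RamProg.warrs, RamInstr.warrs, List.mem_append, List.not_mem_nil, false_or,
    or_false] using ha

/-- In some star colouring, a colour class is given by the pattern `τ` of the distances to `a` and
`b`. -/
def HasPattern (G : SimpleGraph (Fin n)) (τ : ℕ) (a b : Fin n) : Prop :=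
  ∃ c i, IsStar G c ∧ ∀ v, c v = i ↔ pattern τ (lev G a v) (lev G b v) = 0

/-- Register `7` is raised only after a successful verification and never lowered, so successes
persist through later guesses. If the guess is right, the solver's colouring passes the
verification. -/
theorem runs_attempt {τ : ℕ} {a b : Fin n} (h : IsEdgeList G es) (he : Env B es s)
    (h9 : s.reg 9 = a) (h10 : s.reg 10 = b) :
    Runs B (attempt τ) s (28 * n + 196 * es.length + 22 * (es.length * n) + 29) fun s' =>
      (s'.reg 7 = 1 ∧ ∃ c, IsStar G c) ∨ (s'.reg 7 = s.reg 7 ∧ ¬ HasPattern G τ a b) := by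
  have hB := he.hB
  set m := es.length with hm
  set col₀ : Fin n → ℕ := fun w => pattern τ (lev G a w) (lev G b w) with hcol
  have hc1 : ∀ w, col₀ w ≤ 1 := fun w => pattern_le _ _ _
  have hc2 : ∀ w, col₀ w ≤ 2 := fun w => (hc1 w).trans one_le_two
  refine Runs.mono (T := (3 * n + 34 * m + 7) + ((3 * n + 34 * m + 7) + ((22 * n + 2) +
    ((m * 16 + 2) + ((m * 16 + 2) + ((m * (22 * n + 40) + 2) + ((m * 20 + 2) + (1 +
      ((m * 36 + 2) + 2))))))))) ?_ (le_of_eq (by ring)) fun _ h => h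
  refine ((runs_levels he (by norm_num) h9 (by norm_num) h.adj_iff).env (by decide) he).seq ?_
  rintro s1 ⟨e1, la1, hr, -⟩
  have h7 := hr 7 (by decide)
  have h10' := (hr 10 (by decide)).trans h10
  refine ((runs_levels e1 (by norm_num) h10' (by norm_num) h.adj_iff).env (by decide) e1).seq ?_
  rintro s2 ⟨e2, lb2, hr, ha⟩
  replace h7 := (hr 7 (by decide)).trans h7
  have la2 : ∀ w : Fin n, s2.arr 2 w = lev G a w := by rw [ha 2 (by decide)]; exact la1
  refine ((runs_start (τ := τ) e2 la2 lb2 (fun w => lev_le _ _) fun w => lev_le _ _).env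
    ⟨fun r hr => by have := verts_startBody_regs τ r hr; omega,
      fun a ha => by have := verts_startBody_arrs τ a ha; omega⟩ e2).seq ?_
  rintro s3 ⟨e3, st, hr, -⟩
  replace h7 := (hr 7 fun h => by have := verts_startBody_regs τ 7 h; omega).trans h7
  have h4 : ∀ w : Fin n, s3.arr 4 w = col₀ w := fun w => st.col w w.2
  refine ((runs_countZero e3 hc2 h4 fun w => st.heavy w w.2).env (by decide) e3).seq ?_
  rintro s4 ⟨e4, h6, hr, ha⟩
  replace h7 := (hr 7 (by decide)).trans h7
  rw [← ha 4 (by decide)] at h4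
  have p7 : ∀ w : Fin n, s4.arr 7 w = if 0 < col₀ w then ↑w else n := by
    rw [ha 7 (by decide)]; exact fun w => st.partner w w.2
  have a5 := ha 5 (by decide)
  have a8 := ha 8 (by decide)
  refine ((runs_findHeavy h e4 hc2 h4 h6 p7).env (by decide) e4).seq ?_
  rintro s5 ⟨e5, ⟨P, hP, p7⟩, hr, ha⟩
  replace h7 := (hr 7 (by decide)).trans h7
  rw [← ha 4 (by decide)] at h4
  rw [← ha 5 (by decide)] at a5
  rw [← ha 8 (by decide)] at a8
  have h5 : ∀ w : Fin n, s5.arr 5 w = w := by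
    rw [a5]; exact fun w => st.comp w w.2
  refine ((runs_merges h e5 hc1 hP h4 h5 p7).env (by decide) e5).seq ?_
  rintro s6 ⟨e6, ⟨col, comp, hS, h4⟩, hr, ha⟩
  replace h7 := (hr 7 (by decide)).trans h7
  rw [← ha 8 (by decide)] at a8
  refine ((runs_countColours e6 hS.le h4 (by rw [a8]; exact st.count)).env (by decide) e6).seq ?_
  rintro s7 ⟨e7, h8, hr, ha⟩
  replace h7 := (hr 7 (by decide)).trans h7
  rw [← ha 4 (by decide)] at h4
  have st14 : Runs B (.instr (.const 14 1)) s7 1 fun s' => s'.reg 14 = 1 :=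
    Runs.of_wp (p := .instr (.const 14 1)) ⟨by change 1 ≤ B; omega, by simp [RamInstr.exec,
      RamInstr.value]⟩
  refine (st14.env (by decide) e7).seq ?_
  rintro s8 ⟨e8, h14, hr, ha⟩
  replace h7 := (hr 7 (by decide)).trans h7
  rw [← ha 4 (by decide)] at h4
  rw [← ha 8 (by decide)] at h8
  refine ((runs_verify h e8 hS.le h4 h8 h14).env (by decide) e8).seq ?_
  rintro s9 ⟨e9, ⟨h14, hok⟩, hr, -⟩
  replace h7 := (hr 7 (by decide)).trans h7
  refine Runs.of_wp (p := .ite 2 14 (.instr (.const 7 1)) .skip) ?_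
  simp only [RamProg.wp, RamInstr.value, RamInstr.exec, RamState.reg_setReg, if_true, e9.r2]
  refine ⟨fun h0 => ⟨by omega, Or.inl ⟨trivial, ?_⟩⟩, fun h0 => Or.inr ⟨h7, ?_⟩⟩
  · exact exists_isStar_of_edgeOk hS.le (hok.1 (by omega))
  · rintro ⟨c, i, hc, hi⟩
    have := hok.2 (hS.edgeOk (fun u v => (h.adj_iff u v).1) hP hc hi)
    omega

theorem attempt_regs (τ : ℕ) : ∀ r ∈ (attempt τ).wregs, r = 7 ∨ 11 ≤ r := by
  intro r hr
  simp only [attempt, RamProg.wregs.eq_3, List.mem_append] at hr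
  rcases hr with hr | hr | hr | hr | hr | hr | hr | hr | hr | hr
  case inr.inr.inl =>
    have := verts_startBody_regs τ r hr
    omega
  all_goals exact (by decide : ∀ r ∈ RamProg.wregs _, r = 7 ∨ 11 ≤ r) r hr

theorem attempt_safe (τ : ℕ) : (attempt τ).Safe := by
  refine ⟨fun r hr => by have := attempt_regs τ r hr; omega, fun a ha => ?_⟩
  simp only [attempt, RamProg.warrs.eq_3, List.mem_append] at ha
  rcases ha with ha | ha | ha | ha | ha | ha | ha | ha | ha | ha
  case inr.inr.inl =>
    have := verts_startBody_arrs τ a ha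
    omega
  all_goals exact (by decide : ∀ a ∈ RamProg.warrs _, 2 ≤ a) a ha

/-- Try all the patterns. -/
def attempts : RamProg :=
  .seq (attempt 0) (.seq (attempt 1) (.seq (attempt 2) (attempt 3)))

theorem attempts_regs : ∀ r ∈ attempts.wregs, r = 7 ∨ 11 ≤ r := by
  intro r hr
  simp only [attempts, RamProg.wregs.eq_3, List.mem_append] at hr
  rcases hr with hr | hr | hr | hr <;> exact attempt_regs _ r hr

theorem attempts_safe : attempts.Safe := by
  refine ⟨fun r hr => by have := attempts_regs r hr; omega, fun a ha => ?_⟩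
  simp only [attempts, RamProg.warrs.eq_3, List.mem_append] at ha
  rcases ha with ha | ha | ha | ha <;> exact (attempt_safe _).2 a ha

theorem runs_attempts {a b : Fin n} (h : IsEdgeList G es) (he : Env B es s)
    (h9 : s.reg 9 = a) (h10 : s.reg 10 = b) :
    Runs B attempts s
      (4 * (28 * n + 196 * es.length + 22 * (es.length * n) + 29)) fun s' =>
      (s'.reg 7 = 1 ∧ ∃ c, IsStar G c) ∨
        (s'.reg 7 = s.reg 7 ∧ ∀ τ < 4, ¬ HasPattern G τ a b) := by
  have hr9 : ∀ τ, 9 ∉ (attempt τ).wregs := fun τ h => by have := attempt_regs τ 9 h; omega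
  have hr10 : ∀ τ, 10 ∉ (attempt τ).wregs := fun τ h => by have := attempt_regs τ 10 h; omega
  generalize hT : 28 * n + 196 * es.length + 22 * (es.length * n) + 29 = T
  have run : ∀ τ s, Env B es s → s.reg 9 = a → s.reg 10 = b → _ := fun τ s he h9 h10 =>
    hT ▸ (runs_attempt (τ := τ) h he h9 h10).env (attempt_safe τ) he
  refine Runs.mono (T := T + (T + (T + T))) ((run 0 s he h9 h10).seq ?_) (by omega) fun _ h => h
  rintro s1 ⟨e1, q1, hr, -⟩
  have k9 := (hr 9 (hr9 _)).trans h9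
  have k10 := (hr 10 (hr10 _)).trans h10
  refine (run 1 s1 e1 k9 k10).seq ?_
  rintro s2 ⟨e2, q2, hr, -⟩
  replace k9 := (hr 9 (hr9 _)).trans k9
  replace k10 := (hr 10 (hr10 _)).trans k10
  refine (run 2 s2 e2 k9 k10).seq ?_
  rintro s3 ⟨e3, q3, hr, -⟩
  replace k9 := (hr 9 (hr9 _)).trans k9
  replace k10 := (hr 10 (hr10 _)).trans k10
  refine (run 3 s3 e3 k9 k10).mono le_rfl fun s4 ⟨_, q4, _, _⟩ => ?_
  have key : (∀ τ < 4, ¬ HasPattern G τ a b) ↔ ¬ HasPattern G 0 a b ∧ ¬ HasPattern G 1 a b ∧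
      ¬ HasPattern G 2 a b ∧ ¬ HasPattern G 3 a b := by
    constructor
    · intro h
      exact ⟨h 0 (by norm_num), h 1 (by norm_num), h 2 (by norm_num), h 3 (by norm_num)⟩
    · rintro ⟨h0, h1, h2, h3⟩ τ hτ
      interval_cases τ <;> assumption
  rw [key]
  clear key hr
  generalize (∃ c, IsStar G c) = X at *
  rcases q4 with q4 | ⟨q4, p4⟩
  · exact Or.inl q4
  rcases q3 with q3 | ⟨q3, p3⟩
  · exact Or.inl ⟨q4.trans q3.1, q3.2⟩
  rcases q2 with q2 | ⟨q2, p2⟩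
  · exact Or.inl ⟨(q4.trans q3).trans q2.1, q2.2⟩
  rcases q1 with q1 | ⟨q1, p1⟩
  · exact Or.inl ⟨((q4.trans q3).trans q2).trans q1.1, q1.2⟩
  · exact Or.inr ⟨((q4.trans q3).trans q2).trans q1, p1, p2, p3, p4⟩

/-- Decide whether there is a star `3`-colouring. -/
def starProgram : RamProg :=
  .seq (.seq (.instr (.const 3 1)) (.seq (.instr (.const 4 2)) (.seq (.instr (.const 5 3))
    (.ite 1 3 (.instr (.const 7 1)) .skip))))
  (.seq (darts 8 9 10 attempts)
    (.instr (.copy 0 7)))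

theorem runs_starProgram (h : IsEdgeList G es) (hd : DiamLeThree G)
    (hB : 4 * n + 2 * es.length + 8 ≤ B) :
    Runs B starProgram (graphInput es)
      (es.length * (8 * (28 * n + 196 * es.length + 22 * (es.length * n) + 29) + 6) + 8) fun s' =>
      ((∃ c, IsStar G c) → s'.reg 0 = 1) ∧ ((¬ ∃ c, IsStar G c) → s'.reg 0 = 0) := by
  have init : Runs B (.seq (.instr (.const 3 1)) (.seq (.instr (.const 4 2))
      (.seq (.instr (.const 5 3)) (.ite 1 3 (.instr (.const 7 1)) .skip)))) (graphInput es) 5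
      fun s' => Env B es s' ∧ (es.length = 0 ∧ s'.reg 7 = 1 ∨ es.length ≠ 0 ∧ s'.reg 7 = 0) := by
    refine (Runs.of_wp (p := .seq (.instr (.const 3 1)) (.seq (.instr (.const 4 2))
      (.seq (.instr (.const 5 3)) (.ite 1 3 (.instr (.const 7 1)) .skip)))) ?_).mono
      (by simp [RamProg.cost]) fun _ h => h
    have a0 : ∀ k (hk : k < es.length), (graphInput es).arr 0 k = es[k].1 := by
      intro k hk; simp [graphInput, hk]
    have a1 : ∀ k (hk : k < es.length), (graphInput es).arr 1 k = es[k].2 := by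
      intro k hk; simp [graphInput, hk]
    simp only [RamProg.wp, RamInstr.value, RamInstr.exec]
    refine ⟨by omega, by omega, by omega, fun h0 => ⟨by omega, ?_, Or.inl ⟨?_, ?_⟩⟩,
      fun h0 => ⟨?_, Or.inr ⟨?_, ?_⟩⟩⟩
    · constructor <;> first | exact hB | exact a0 | exact a1 | simp [graphInput]
    · simpa [graphInput] using h0
    · simp
    · constructor <;> first | exact hB | exact a0 | exact a1 | simp [graphInput]
    · intro e; simp [graphInput, e] at h0
    · simp [graphInput]
  refine Runs.mono (T := 5 + ((es.length * (2 * (4 * (28 * n + 196 * es.length +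
    22 * (es.length * n) + 29)) + 6) + 2) + 1)) (init.seq ?_) (le_of_eq (by ring)) fun _ h => h
  rintro s1 ⟨e1, h7⟩
  have outer := Runs.darts (i := 8) (u := 9) (v := 10) (f := 7)
    (p := attempts) e1 (by norm_num)
    (by norm_num) (by norm_num) (by norm_num) (by norm_num) (by norm_num) (by norm_num)
    (by norm_num) (by norm_num) attempts_safe (fun h => by have := attempts_regs 8 h; omega)
    -- The flag is sound, and complete for the directed edges treated so far. The clause for an
    -- empty edge list covers the case in which the loop is never entered.
    (fun l _ x => (x = 0 ∨ x = 1) ∧ (es.length = 0 → x = 1) ∧ (x = 1 → ∃ c, IsStar G c) ∧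
      ∀ d ∈ l, ∀ τ < 4, HasPattern G τ d.1 d.2 → x = 1) ?_
    (T := 4 * (28 * n + 196 * es.length + 22 * (es.length * n) + 29)) ?_
  · refine outer.seq fun s2 ⟨h01, h0, hs, hp⟩ => ?_
    refine Runs.of_wp (p := .instr (.copy 0 7)) ?_
    simp only [RamProg.wp, RamInstr.value, RamInstr.exec, RamState.reg_setReg, if_true]
    refine ⟨by omega, fun ⟨c, hc⟩ => ?_, fun hn => ?_⟩
    · by_cases hm : es.length = 0
      · exact h0 hm
      · have hm' : 0 < es.length := Nat.pos_of_ne_zero hm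
        have huv : G.Adj es[0].1 es[0].2 :=
          (h.adj_iff _ _).2 (mem_dartList.2 (Or.inl (List.getElem_mem hm')))
        obtain ⟨a, b, hab, τ, hτ, i, hi⟩ := hc.exists_pattern hd huv
        exact hp (a, b) ((h.adj_iff a b).1 hab) τ hτ ⟨c, i, hc, hi⟩
    · rcases h01 with h | h
      · exact h
      · exact absurd (hs h) hn
  · refine ⟨by omega, by omega, fun h1 => ?_, by simp⟩
    have hm : es = [] := List.eq_nil_of_length_eq_zero (by omega)
    subst hm
    have hn : ∀ u v, ¬ G.Adj u v := fun u v huv => by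
      have := (h.adj_iff u v).1 huv
      simp [dartList] at this
    exact ⟨fun _ => 0, fun u v huv => absurd huv (hn u v), fun u v huv => absurd huv (hn u v)⟩
  · rintro l ⟨a, b⟩ s hl he ⟨h01, h0, hs, hp⟩ h9 h10
    refine (runs_attempts h he h9 h10).mono le_rfl ?_
    rintro s' (⟨h1, hc⟩ | ⟨h1, hn⟩)
    · exact ⟨Or.inr h1, fun _ => h1, fun _ => hc, fun _ _ _ _ _ => h1⟩
    · rw [h1]
      refine ⟨h01, h0, hs, fun d hd τ hτ hP => ?_⟩
      rw [List.mem_append, List.mem_singleton] at hd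
      rcases hd with hd | rfl
      · exact hp d hd τ hτ hP
      · exact absurd hP (hn τ hτ)

end Program

theorem mainTheorem4 :
    ∃ (P : RamProg) (C k : ℕ),
      ∀ (n : ℕ) (G : SimpleGraph (Fin n)) (es : List (Fin n × Fin n)),
        G.ediam ≤ 3 → IsEdgeList G es →
          ∃ (s : RamState) (t : ℕ),
            RamExec ((n + 2) ^ k) P (graphInput es) s t ∧
            t ≤ C * (n * G.edgeSet.ncard ^ 2 + 1) ∧
            (StarColourable G 3 → s.reg 0 = 1) ∧
            (¬ StarColourable G 3 → s.reg 0 = 0) := by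
  refine ⟨starProgram, 3000, 8, fun n G es hd h => ?_⟩
  -- The directed edges are distinct pairs of vertices. This keeps all numbers polynomial in `n`.
  have hm : 2 * es.length ≤ n * n := by
    have h1 : (dartList es).length = 2 * es.length := by
      simp [dartList, List.length_flatMap, mul_comm]
    have h2 := h.nodup.length_le_card
    rw [h1] at h2
    simpa using h2
  have hB : 4 * n + 2 * es.length + 8 ≤ (n + 2) ^ 8 := by
    have h6 : 1 ≤ (n + 2) ^ 6 := Nat.one_le_pow _ _ (by omega)
    have h6' : 2 ^ 6 ≤ (n + 2) ^ 6 := Nat.pow_le_pow_left (by omega) 6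
    calc 4 * n + 2 * es.length + 8 ≤ (n + 2) ^ 2 * 2 ^ 6 := by nlinarith
      _ ≤ (n + 2) ^ 2 * (n + 2) ^ 6 := Nat.mul_le_mul_left _ h6'
      _ = (n + 2) ^ 8 := by ring
  obtain ⟨s, t, h1, h2, h3, h4⟩ := runs_starProgram h (diamLeThree_of_ediam_le hd) hB
  rw [← starColourable_three_iff] at h3 h4
  refine ⟨s, t, h1, h2.trans ?_, h3, h4⟩
  rw [← h.length_eq]
  generalize es.length = m at hm ⊢
  rcases Nat.eq_zero_or_pos m with rfl | hm0
  · simp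
  · have hn0 : 1 ≤ n := by
      by_contra hn
      have : n = 0 := by omega
      subst this
      omega
    have a1 : n ≤ m * n := Nat.le_mul_of_pos_left n hm0
    have a2 : m ≤ m * n := Nat.le_mul_of_pos_right m hn0
    have a3 : m ≤ m * (m * n) := Nat.le_mul_of_pos_right m (Nat.mul_pos hm0 hn0)
    -- For `m > 0` each of the terms `n`, `m`, `m * n`, `1` is at most `m * n`, and `28 + 196 + 22 +
    -- 29 = 275`.
    calc m * (8 * (28 * n + 196 * m + 22 * (m * n) + 29) + 6) + 8
        ≤ m * (8 * (275 * (m * n)) + 6) + 8 := by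
          have : 28 * n + 196 * m + 22 * (m * n) + 29 ≤ 275 * (m * n) := by omega
          gcongr
      _ = 2200 * (m * (m * n)) + 6 * m + 8 := by ring
      _ ≤ 3000 * (m * (m * n) + 1) := by omega
      _ = 3000 * (n * m ^ 2 + 1) := by ring
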